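/- Fix $d\ge 1$. A (sequence of) density dependent Markov jump process(es) $X=(X_n)_{n\ge1}$ on $\mathbb Z^d$ is given by a finite set $\mathcal J\subset\mathbb Z^d$ of jumps and functions $g^J:\mathbb R^d\to[0,\infty)$, $J\in\mathcal J$; $X_n$ jumps from $x$ to $x+J$ at rate $n\,g^J(x/n)$. For $c\in\mathbb R^d$ put $$F(x)=\sum_{J\in\mathcal J}J\,g^J(x),\qquad A=DF(c),\qquad \sigma^2=\sum_{J\in\mathcal J}JJ^T g^J(c).$$ Let $B_r(c)$ be the closed Euclidean ball. Assume for some $\delta_0>0$: * (G0) $F(c)=0$; * (G1) all eigenvalues of $A$ have negative real parts; * (G2) each $g^J$ is $C^2$ on $B_{\delta_0}(c)$; * (G3) there is $\varepsilon_0>0$ with $\inf_{x\in B_{\delta_0}(c)}g^J(x)\ge\varepsilon_0 g^J(c)>0$ for all $J\in\mathcal J$; * (G4) each coordinate vector $e^{(j)}$ is a finite sum of elements of $\mathcal J$. Let $\Sigma$ be the symmetric positive definite solution of $A\Sigma+\Sigma A^T+\sigma^2=0$, and $|y|_\Sigma=(y^T\Sigma^{-1}y)^{1/2}$. For $\delta>0$,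 let $X_n^\delta$ be the Markov jump process on the finite set $\{x\in\mathbb Z^d:|x-nc|_\Sigma\le n\delta\}$ with the rates of $X_n$, except that jumps out of this set are suppressed, and let $\Pi_n^\delta$ be its equilibrium distribution (unique for all large $n$). A process is called *elementary* with radius $\hat\delta_0>0$ (with respect to $c$) if it satisfies (G0), (G1), its rates $\hat g^J$ are positive at $c$ for all its jumps $J\in\hat{\mathcal J}$, $\hat{\mathcal J}\ni\pm e^{(j)}$ for all $j$, $\hat g^J$ is constant on $B_{\hat\delta_0}(c)$ for each $J\in\hat{\mathcal J}\setminus\{e^{(1)},\dots,e^{(d)}\}$, and each $\hat g^{e^{(j)}}$ is linear (affine) with $\hat g^{e^{(j)}}(x)\ge\frac12\hat g^{e^{(j)}}(c)$ on $B_{\hat\delta_0}(c)$. Write $\lambda_{\min},\lambda_{\max}$ for the extreme eigenvalues of a symmetric matrix, $\|\cdot\|$ for the spectral norm, and let $$\hat\delta_0=\frac{\lambda_{\min}(\sigma^2)}{8\|A\|},\quad \tilde\delta_0=\min\Bigl\{1,\frac{\hat\delta_0}{3\sqrt{\lambda_{\max}(\Sigma)}}\Bigr\},\quad \alpha_1=\tfrac12\lambda_{\min}(\Sigma^{-1/2}\sigma^2\Sigma^{-1/2}),\quad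 L_2=\max_{J\in\mathcal J}\frac{\sup_{x\in B_{\delta_0}(c)}\|D^2g^J(x)\|}{g^J(c)}.$$ **Theorem.** There is a sequence of elementary processes $\hat X_n$ with radius $\hat\delta_0$, with the same $c$, $A$ and $\sigma^2$ as $X_n$, such that, for any fixed $\delta$ with $$0<\delta<\min\Bigl\{\frac{\delta_0}{\sqrt{\lambda_{\max}(\Sigma)}},\ \tilde\delta_0\Bigr\}\quad\text{and}\quad 4\,{\rm Tr}(\sigma^2)\,L_2\,\lambda_{\max}(\Sigma)\,\delta\ \le\ \alpha_1\sqrt{\lambda_{\min}(\Sigma)},$$ the truncated processes $X_n^\delta$ and $\hat X_n^\delta$ have unique equilibrium distributions $\Pi_n^\delta$ and $\hat\Pi_n^\delta$ for all large $n$, and $$d_{TV}(\Pi_n^\delta,\hat\Pi_n^\delta)=O(n^{-1/2}\log n)\qquad(n\to\infty),$$ where $d_{TV}(P,Q)=\sup_{B}|P(B)-Q(B)|$. -/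

import Mathlib

open Filter Topology

noncomputable section

/-! ### Matrices: extreme eigenvalues, spectral norm, the Lyapunov equation -/

/-- The smallest eigenvalue of a real (symmetric) matrix. -/
def lamMin {d : ℕ} (M : Matrix (Fin d) (Fin d) ℝ) : ℝ := sInf (spectrum ℝ M)

/-- The largest eigenvalue of a real (symmetric) matrix. -/
def lamMax {d : ℕ} (M : Matrix (Fin d) (Fin d) ℝ) : ℝ := sSup (spectrum ℝ M)

/-- The spectral norm: the operator norm for the Euclidean norm. -/
def spectralNorm₂ {d : ℕ} (M : Matrix (Fin d) (Fin d) ℝ) : ℝ :=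
  ‖Matrix.toEuclideanCLM (𝕜 := ℝ) M‖

/-- All (complex) eigenvalues of the real matrix `A` have negative real parts. -/
def IsHurwitz {d : ℕ} (A : Matrix (Fin d) (Fin d) ℝ) : Prop :=
  ∀ z : ℂ, Module.End.HasEigenvalue (Matrix.toLin' (A.map (algebraMap ℝ ℂ))) z → z.re < 0

/-- The positive definite symmetric solution `S` of the continuous Lyapunov equation
`A S + S Aᵀ + s = 0` (it exists and is unique if `A` is Hurwitz and `s` positive definite). -/
def lyapunovSol {d : ℕ} (A s : Matrix (Fin d) (Fin d) ℝ) : Matrix (Fin d) (Fin d) ℝ :=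
  Classical.epsilon fun S => S.PosDef ∧ A * S + S * A.transpose + s = 0

open scoped MatrixOrder in
/-- `S^{-1/2} s S^{-1/2}`. -/
def standardized {d : ℕ} (S s : Matrix (Fin d) (Fin d) ℝ) : Matrix (Fin d) (Fin d) ℝ :=
  (CFC.sqrt S)⁻¹ * s * (CFC.sqrt S)⁻¹

/-! ### Lattice balls -/

/-- The norm `|y|_S = (yᵀ S⁻¹ y)^{1/2}`. -/
def sigmaNorm {d : ℕ} (S : Matrix (Fin d) (Fin d) ℝ) (y : Fin d → ℝ) : ℝ :=
  √(y ⬝ᵥ (S⁻¹).mulVec y)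

/-- The lattice points `X` with `|X - n c|_S ≤ n δ`. -/
def latticeBallSet {d : ℕ} (S : Matrix (Fin d) (Fin d) ℝ) (c : EuclideanSpace ℝ (Fin d))
    (n : ℕ) (δ : ℝ) : Set (Fin d → ℤ) :=
  {X | sigmaNorm S (fun i => (X i : ℝ) - n * c i) ≤ n * δ}

theorem latticeBallSet_finite {d : ℕ} {S : Matrix (Fin d) (Fin d) ℝ} (hS : S.PosDef)
    (c : EuclideanSpace ℝ (Fin d)) (n : ℕ) (δ : ℝ) : (latticeBallSet S c n δ).Finite := by
  have hSi := hS.inv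
  have hcont : Continuous fun y : EuclideanSpace ℝ (Fin d) =>
      (y.ofLp ⬝ᵥ (S⁻¹).mulVec y.ofLp : ℝ) := by
    simp only [dotProduct, Matrix.mulVec]
    fun_prop
  -- the quadratic form is coercive
  obtain ⟨m, hm, hle⟩ : ∃ m : ℝ, 0 < m ∧ ∀ y : EuclideanSpace ℝ (Fin d),
      m * ‖y‖ ^ 2 ≤ y.ofLp ⬝ᵥ (S⁻¹).mulVec y.ofLp := by
    have hpos : ∀ y : EuclideanSpace ℝ (Fin d), y ≠ 0 →
        0 < y.ofLp ⬝ᵥ (S⁻¹).mulVec y.ofLp := by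
      intro y hy
      have := hSi.dotProduct_mulVec_pos (x := y.ofLp) (by simpa using hy)
      simpa using this
    rcases (Metric.sphere (0 : EuclideanSpace ℝ (Fin d)) 1).eq_empty_or_nonempty with he | hne
    · refine ⟨1, one_pos, fun y => ?_⟩
      have hy : y = 0 := by
        by_contra hy
        have : (‖y‖⁻¹ • y) ∈ Metric.sphere (0 : EuclideanSpace ℝ (Fin d)) 1 := by
          simp [norm_smul, inv_mul_cancel₀ (norm_ne_zero_iff.2 hy)]
        simp [he] at this
      simp [hy]
    · obtain ⟨u, hu, hmin⟩ := (isCompact_sphere (0 : EuclideanSpace ℝ (Fin d)) 1).exists_isMinOn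
        hne hcont.continuousOn
      have hu0 : u ≠ 0 := by
        rintro rfl
        simp at hu
      refine ⟨_, hpos u hu0, fun y => ?_⟩
      by_cases hy : y = 0
      · simp [hy]
      have hny : ‖y‖ ≠ 0 := norm_ne_zero_iff.2 hy
      have h1 := hmin (show (‖y‖⁻¹ • y) ∈ Metric.sphere (0 : EuclideanSpace ℝ (Fin d)) 1 by
          simp [norm_smul, inv_mul_cancel₀ hny])
      simp only [Set.mem_ofPred_eq, WithLp.ofLp_smul, Matrix.mulVec_smul, dotProduct_smul,
        smul_dotProduct, smul_eq_mul] at h1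
      calc _ ≤ (‖y‖⁻¹ * (‖y‖⁻¹ * (y.ofLp ⬝ᵥ (S⁻¹).mulVec y.ofLp))) * ‖y‖ ^ 2 := by gcongr
        _ = _ := by field_simp
  set R : ℝ := √((n * δ) ^ 2 / m) with hR
  refine (Set.Finite.pi' (fun i : Fin d => Set.finite_Icc ⌊n * c i - R⌋ ⌈n * c i + R⌉)).subset ?_
  intro X hX i
  set y : EuclideanSpace ℝ (Fin d) := WithLp.toLp 2 fun i => (X i : ℝ) - n * c i with hy
  have hq : 0 ≤ y.ofLp ⬝ᵥ (S⁻¹).mulVec y.ofLp := le_trans (by positivity) (hle y)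
  have h2 : y.ofLp ⬝ᵥ (S⁻¹).mulVec y.ofLp ≤ (n * δ) ^ 2 := by
    rw [← Real.sq_sqrt hq]
    exact pow_le_pow_left₀ (Real.sqrt_nonneg _) hX 2
  have h3 : ‖y‖ ≤ R := by
    apply Real.le_sqrt_of_sq_le
    rw [le_div_iff₀ hm]
    linarith [hle y]
  have h4 : |(X i : ℝ) - n * c i| ≤ R := by
    have := PiLp.norm_apply_le y i
    simp only [hy, Real.norm_eq_abs] at this
    exact this.trans h3
  have h5 := abs_le.1 h4
  constructor
  · have : (⌊n * c i - R⌋ : ℝ) ≤ X i := (Int.floor_le _).trans (by linarith)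
    exact_mod_cast this
  · have : (X i : ℝ) ≤ ⌈n * c i + R⌉ := le_trans (by linarith) (Int.le_ceil _)
    exact_mod_cast this

open Classical in
/-- The finite state space `ℤᵈ ∩ {y : |y - n c|_S ≤ n δ}`. It is finite whenever `S` is positive
definite; otherwise this is a junk value. -/
def latticeBall {d : ℕ} (S : Matrix (Fin d) (Fin d) ℝ) (c : EuclideanSpace ℝ (Fin d))
    (n : ℕ) (δ : ℝ) : Finset (Fin d → ℤ) :=
  if h : (latticeBallSet S c n δ).Finite then h.toFinset else ∅

theorem mem_latticeBall {d : ℕ} {S : Matrix (Fin d) (Fin d) ℝ} (hS : S.PosDef)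
    (c : EuclideanSpace ℝ (Fin d)) (n : ℕ) (δ : ℝ) (X : Fin d → ℤ) :
    X ∈ latticeBall S c n δ ↔ sigmaNorm S (fun i => (X i : ℝ) - n * c i) ≤ n * δ := by
  rw [latticeBall, dif_pos (latticeBallSet_finite hS c n δ)]
  simp [latticeBallSet]

/-! ### Total variation distance -/

/-- `d_TV(p, q) = sup_B |p(B) - q(B)|`. -/
def dTV {α : Type*} (p q : PMF α) : ℝ :=
  ⨆ B : Set α, |(p.toOuterMeasure B).toReal - (q.toOuterMeasure B).toReal|

/-! ### Density dependent Markov jump processes -/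

/-- The data of a sequence of density dependent Markov jump processes `(X_n)` on `ℤᵈ`: a finite
set of jumps `J` and non-negative functions `g^J`; the process `X_n` jumps from `X` to `X + J` at
rate `n g^J(X / n)`. -/
structure JumpProcess (d : ℕ) where
  jumps : Finset (Fin d → ℤ)
  g : (Fin d → ℤ) → EuclideanSpace ℝ (Fin d) → ℝ
  g_nonneg : ∀ J ∈ jumps, ∀ x, 0 ≤ g J x

/-- An integer vector as an element of Euclidean space. -/
def intVec {d : ℕ} (J : Fin d → ℤ) : EuclideanSpace ℝ (Fin d) :=
  WithLp.toLp 2 fun i => (J i : ℝ)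

namespace JumpProcess

variable {d : ℕ} (P : JumpProcess d) (c : EuclideanSpace ℝ (Fin d))

/-- The drift `F(x) = ∑_J J g^J(x)`. -/
def drift (x : EuclideanSpace ℝ (Fin d)) : EuclideanSpace ℝ (Fin d) :=
  ∑ J ∈ P.jumps, P.g J x • intVec J

/-- The Jacobian matrix `A = DF(c)`. -/
def A : Matrix (Fin d) (Fin d) ℝ :=
  Matrix.of fun i j => (fderiv ℝ P.drift c (EuclideanSpace.single j 1)) i

/-- The matrix `σ² = ∑_J J Jᵀ g^J(c)`. -/
def sigma2 : Matrix (Fin d) (Fin d) ℝ :=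
  ∑ J ∈ P.jumps, P.g J c • Matrix.vecMulVec (fun i => (J i : ℝ)) (fun i => (J i : ℝ))

/-- The solution `Σ` of `A Σ + Σ Aᵀ + σ² = 0`. -/
def Sig : Matrix (Fin d) (Fin d) ℝ := lyapunovSol (P.A c) (P.sigma2 c)

/-- `Λ = ∑_J g^J(c) |J|² = Tr σ²`. -/
def Lam : ℝ := (P.sigma2 c).trace

/-- `α₁ = ½ λ_min(Σ^{-1/2} σ² Σ^{-1/2})`. -/
def alpha1 : ℝ := lamMin (standardized (P.Sig c) (P.sigma2 c)) / 2

/-- `L₂ = max_J (sup_{|x - c| ≤ δ₀} ‖D²g^J(x)‖) / g^J(c)`. -/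
def L2 (δ₀ : ℝ) : ℝ :=
  ⨆ J : P.jumps, (⨆ x : Metric.closedBall c δ₀,
    ‖iteratedFDerivWithin ℝ 2 (P.g J.1) (Metric.closedBall c δ₀) x.1‖) / P.g J.1 c

/-- The general assumptions, for the point `c` and the radius `δ₀`: `c` is an equilibrium, it is
strongly stable, the rates are `C²` on the ball of radius `δ₀` and bounded below there by a fixed
positive proportion of their positive values at `c`, and every unit vector is a finite sum of
jumps. -/
structure Regular (δ₀ : ℝ) : Prop where
  radius_pos : 0 < δ₀
  equilibrium : P.drift c = 0
  stable : IsHurwitz (P.A c)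
  smooth : ∀ J ∈ P.jumps, ContDiffOn ℝ 2 (P.g J) (Metric.closedBall c δ₀)
  lower_bound : ∃ ε₀ : ℝ, 0 < ε₀ ∧ ∀ J ∈ P.jumps, 0 < ε₀ * P.g J c ∧
    ∀ x ∈ Metric.closedBall c δ₀, ε₀ * P.g J c ≤ P.g J x
  generate : ∀ j : Fin d, ∃ l : List (Fin d → ℤ), (∀ J ∈ l, J ∈ P.jumps) ∧
    Pi.single j 1 = l.sum

/-- Elementary (sequences of) processes, for the point `c` and the radius `δ₀`: `c` is a strongly
stable equilibrium, all rates are positive at `c`, all `±e⁽ʲ⁾` are jumps, the rates of all jumps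
other than the `e⁽ʲ⁾` are constant on the ball of radius `δ₀`, and those of the `e⁽ʲ⁾` are linear
(affine) there and at least half of their values at `c`. -/
structure Elementary (δ₀ : ℝ) : Prop where
  radius_pos : 0 < δ₀
  equilibrium : P.drift c = 0
  stable : IsHurwitz (P.A c)
  g_pos : ∀ J ∈ P.jumps, 0 < P.g J c
  unit_mem : ∀ j : Fin d, Pi.single j 1 ∈ P.jumps ∧ -Pi.single j 1 ∈ P.jumps
  const : ∀ J ∈ P.jumps, (∀ j : Fin d, J ≠ Pi.single j 1) →
    ∀ x ∈ Metric.closedBall c δ₀, P.g J x = P.g J c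
  linear : ∀ j : Fin d, ∃ (a : EuclideanSpace ℝ (Fin d) →L[ℝ] ℝ) (b : ℝ),
    ∀ x ∈ Metric.closedBall c δ₀, P.g (Pi.single j 1) x = a x + b
  half : ∀ j : Fin d, ∀ x ∈ Metric.closedBall c δ₀,
    P.g (Pi.single j 1) c / 2 ≤ P.g (Pi.single j 1) x

/-- The state space of the truncated process `X_n^δ`: the lattice points of the ball
`|X - n c|_Σ ≤ n δ`. -/
def states (n : ℕ) (δ : ℝ) : Finset (Fin d → ℤ) := latticeBall (P.Sig c) c n δ

open Classical in
/-- The rate `n g^J_δ(X / n)` of the jump `X → X + J` of the truncated process `X_n^δ`: jumps that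
start or end outside the ball are suppressed. -/
def truncRate (n : ℕ) (δ : ℝ) (J X : Fin d → ℤ) : ℝ :=
  if X ∈ P.states c n δ ∧ X + J ∈ P.states c n δ then
    n * P.g J ((n : ℝ)⁻¹ • intVec X)
  else 0

/-- The generator of `X_n^δ`. -/
def truncGenerator (n : ℕ) (δ : ℝ) (h : (Fin d → ℤ) → ℝ) (X : Fin d → ℤ) : ℝ :=
  ∑ J ∈ P.jumps, P.truncRate c n δ J X * (h (X + J) - h X)

/-- The `Q`-matrix of `X_n^δ` on its finite state space. -/
def qMatrix (n : ℕ) (δ : ℝ) : Matrix (P.states c n δ) (P.states c n δ) ℝ :=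
  Matrix.of fun X Y => P.truncGenerator c n δ (Pi.single Y.1 1) X.1

/-- The transition probabilities `P[X_n^δ(t) = Y | X_n^δ(0) = X]`. -/
def transition (n : ℕ) (δ t : ℝ) : Matrix (P.states c n δ) (P.states c n δ) ℝ :=
  NormedSpace.exp (t • P.qMatrix c n δ)

/-- `π` is an equilibrium distribution of `X_n^δ`: a probability distribution on the state space
that is invariant under the transition probabilities. -/
def IsEquilibrium (n : ℕ) (δ : ℝ) (π : PMF (Fin d → ℤ)) : Prop :=
  π.support ⊆ P.states c n δ ∧ ∀ t : ℝ, 0 ≤ t →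
    Matrix.vecMul (fun X : P.states c n δ => (π X.1).toReal) (P.transition c n δ t) =
      fun X : P.states c n δ => (π X.1).toReal

/-- The equilibrium distribution `Π_n^δ` of `X_n^δ` (a junk value if there is none). -/
def equilibriumDist (n : ℕ) (δ : ℝ) : PMF (Fin d → ℤ) :=
  Classical.epsilon fun π => P.IsEquilibrium c n δ π

end JumpProcess

end

/-! Both equilibrium laws are compared with one explicit reference, the discrete Gaussian weight
`ν(X) = exp(-q(X) / (2n))` with `q(X) = |X - nc|_Σ²`. It depends only on `c` and `Σ`, hence only on
`c`, `A`, `σ²`, so two chains that share these data are close to the same object. The common factor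
`n` in the rates does not affect stationarity and is dropped in `LatticeModel`.

Let `π` be stationary and `f = π / ν`. Testing stationarity against `log f` bounds the Dirichlet
energy of `√f` by the sum of `ν(X) r_J(X) (f(X + J) - f(X))`
(`IsStationaryLaw.entropy_dissipation`). Once the rates are linearised and summed by parts, this sum
is nearly zero (`abs_sum_affine_diff_le`): the terms of order one cancel because `F(c) = 0`, and the
next order is governed by a matrix that the Lyapunov equation makes antisymmetric, so it vanishes by
symmetry of mixed second differences. What is left is `1/n` times the variation of `f` weighted by
`1 + q/n`. Cauchy–Schwarz splits this into a small multiple of the energy, which is absorbed, and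
`n⁻²` times the second moment of `1 + q/n` under `π`. That moment is bounded by the test function
`q²` (`LatticeModel.exists_moment_le`); here the smallness condition on `δ` enters, through the
contraction of the drift on the whole ball. Hence the energy is `O(n⁻²)`
(`LatticeModel.exists_jumpEnergy_le`).

The Gaussian weight has a Poincaré inequality with constant of order `n` (`poincare_gaussWeight`),
obtained by joining a Poincaré inequality on a box of side of order `√n` to a Hardy inequality
outside. So `√π` is within `O(n^(-1/2))` in `ℓ²` of a multiple of `√ν`. Two unit vectors close to
one ray are close to each other, and the `ℓ¹` distance of the two laws is `O(n^(-1/2))`, without the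
logarithm (`LatticeModel.exists_sum_abs_sub_le`).

Uniqueness comes from the same estimate. Two different invariant laws of a finite chain yield two
invariant laws with disjoint supports, at `ℓ¹` distance 2, which is impossible for large `n` when a
model is compared with itself. No irreducibility argument is needed.

The elementary process (`exists_elementary`) is built by writing `σ²` as a positive combination of
integer rank one matrices `J Jᵀ` with weights symmetric in `J`, so that they produce no drift, while
keeping a weight of at least `λ_min(σ²)/4` on each `±e_j`. The linear drift `A(x - c)` is then put
into the rates of the `e_j`. -/

noncomputable section

/-! ### Quadratic forms -/

/-- The bilinear form `vᵀ Θ w`. -/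
def bform {d : ℕ} (Θ : Matrix (Fin d) (Fin d) ℝ) (v w : Fin d → ℝ) : ℝ := v ⬝ᵥ Θ.mulVec w

/-- The quadratic form `vᵀ Θ v`. -/
def qform {d : ℕ} (Θ : Matrix (Fin d) (Fin d) ℝ) (v : Fin d → ℝ) : ℝ := bform Θ v v

/-- An integer vector as a real vector. -/
def realVec {d : ℕ} (J : Fin d → ℤ) : Fin d → ℝ := fun i => (J i : ℝ)

/-- The deviation `X - n c`. -/
def devVec {d : ℕ} (c : Fin d → ℝ) (n : ℕ) (X : Fin d → ℤ) : Fin d → ℝ :=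
  fun i => (X i : ℝ) - n * c i

/-- The unnormalised discrete Gaussian weight `exp (-|X - n c|² / (2 n))`. -/
def gaussWeight {d : ℕ} (Θ : Matrix (Fin d) (Fin d) ℝ) (c : Fin d → ℝ) (n : ℕ)
    (X : Fin d → ℤ) : ℝ :=
  Real.exp (-(qform Θ (devVec c n X) / (2 * n)))

section QuadraticForms

variable {d : ℕ} {Θ : Matrix (Fin d) (Fin d) ℝ}

theorem bform_add_left (v w z : Fin d → ℝ) : bform Θ (v + w) z = bform Θ v z + bform Θ w z := by
  simp [bform, add_dotProduct]

theorem bform_add_right (v w z : Fin d → ℝ) : bform Θ v (w + z) = bform Θ v w + bform Θ v z := by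
  simp [bform, Matrix.mulVec_add, dotProduct_add]

theorem bform_smul_left (t : ℝ) (v w : Fin d → ℝ) : bform Θ (t • v) w = t * bform Θ v w := by
  simp [bform]

theorem bform_smul_right (t : ℝ) (v w : Fin d → ℝ) : bform Θ v (t • w) = t * bform Θ v w := by
  simp [bform, Matrix.mulVec_smul]

theorem bform_comm (hΘ : Θ.PosDef) (v w : Fin d → ℝ) : bform Θ v w = bform Θ w v := by
  have h : Θ.transpose = Θ := by simpa [Matrix.IsHermitian] using hΘ.1
  rw [bform, bform, Matrix.dotProduct_mulVec, ← Matrix.mulVec_transpose, h, dotProduct_comm]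

theorem qform_pos (hΘ : Θ.PosDef) {v : Fin d → ℝ} (hv : v ≠ 0) : 0 < qform Θ v := by
  simpa [qform, bform] using hΘ.dotProduct_mulVec_pos hv

theorem qform_nonneg (hΘ : Θ.PosDef) (v : Fin d → ℝ) : 0 ≤ qform Θ v := by
  simpa [qform, bform] using hΘ.posSemidef.dotProduct_mulVec_nonneg v

theorem qform_add (hΘ : Θ.PosDef) (v w : Fin d → ℝ) :
    qform Θ (v + w) = qform Θ v + 2 * bform Θ w v + qform Θ w := by
  simp only [qform, bform_add_left, bform_add_right, bform_comm hΘ v w]; ring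

theorem qform_smul (t : ℝ) (v : Fin d → ℝ) : qform Θ (t • v) = t ^ 2 * qform Θ v := by
  simp only [qform, bform_smul_left, bform_smul_right]; ring

theorem bform_sq_le (hΘ : Θ.PosDef) (v w : Fin d → ℝ) :
    bform Θ v w ^ 2 ≤ qform Θ v * qform Θ w := by
  by_cases hw : w = 0
  · subst hw; simp [bform, qform]
  have hq := qform_pos hΘ hw
  have h := qform_nonneg hΘ (qform Θ w • v + (-bform Θ v w) • w)
  rw [qform_add hΘ, qform_smul, qform_smul, bform_smul_left, bform_smul_right,
    bform_comm hΘ w v] at h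
  have : 0 ≤ qform Θ w * (qform Θ v * qform Θ w - bform Θ v w ^ 2) := by nlinarith
  nlinarith [(mul_nonneg_iff_of_pos_left hq).1 this]

theorem abs_bform_le (hΘ : Θ.PosDef) (v w : Fin d → ℝ) :
    |bform Θ v w| ≤ √(qform Θ v) * √(qform Θ w) := by
  rw [← Real.sqrt_mul (qform_nonneg hΘ v)]
  exact Real.abs_le_sqrt (bform_sq_le hΘ v w)

theorem sqrt_qform_add_le (hΘ : Θ.PosDef) (v w : Fin d → ℝ) :
    √(qform Θ (v + w)) ≤ √(qform Θ v) + √(qform Θ w) := by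
  apply Real.sqrt_le_iff.2 ⟨by positivity, ?_⟩
  rw [qform_add hΘ]
  have h1 := Real.sq_sqrt (qform_nonneg hΘ v)
  have h2 := Real.sq_sqrt (qform_nonneg hΘ w)
  have h3 := (abs_le.1 (abs_bform_le hΘ w v)).2
  nlinarith

theorem qform_add_le (hΘ : Θ.PosDef) (v w : Fin d → ℝ) :
    qform Θ (v + w) ≤ 2 * qform Θ v + 2 * qform Θ w := by
  have := qform_nonneg hΘ (v + (-1 : ℝ) • w)
  rw [qform_add hΘ, qform_smul, bform_smul_left] at this
  rw [qform_add hΘ]; linarith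

theorem qform_neg (v : Fin d → ℝ) : qform Θ (-v) = qform Θ v := by
  have := qform_smul (Θ := Θ) (-1) v; simpa using this

theorem devVec_add (c : Fin d → ℝ) (n : ℕ) (X a : Fin d → ℤ) :
    devVec c n (X + a) = devVec c n X + realVec a := by
  ext i; simp [devVec, realVec]; ring

theorem realVec_neg (a : Fin d → ℤ) : realVec (-a) = -realVec a := by
  ext i; simp [realVec]

theorem realVec_add (a b : Fin d → ℤ) : realVec (a + b) = realVec a + realVec b := by
  ext i; simp [realVec]

theorem gaussWeight_pos (c : Fin d → ℝ) (n : ℕ) (X : Fin d → ℤ) : 0 < gaussWeight Θ c n X :=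
  Real.exp_pos _

theorem gaussWeight_add (hΘ : Θ.PosDef) (c : Fin d → ℝ) {n : ℕ} (hn : 1 ≤ n)
    (X a : Fin d → ℤ) :
    gaussWeight Θ c n (X + a) = gaussWeight Θ c n X *
      Real.exp (-(bform Θ (realVec a) (devVec c n X) / n + qform Θ (realVec a) / (2 * n))) := by
  have : (0 : ℝ) < n := by exact_mod_cast hn
  rw [gaussWeight, gaussWeight, ← Real.exp_add, devVec_add, qform_add hΘ]
  congr 1
  field_simp
  ring

/-- The exponent in `gaussWeight_add` is bounded as long as `|X - n c| ≤ n R`. -/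
theorem abs_bform_div_le (hΘ : Θ.PosDef) (c : Fin d → ℝ) {n : ℕ} (hn : 1 ≤ n) {R : ℝ} (hR : 0 ≤ R)
    (X : Fin d → ℤ) (hX : qform Θ (devVec c n X) ≤ (n * R) ^ 2) (v : Fin d → ℝ) :
    |bform Θ v (devVec c n X) / n| ≤ √(qform Θ v) * R := by
  have hn' : (0 : ℝ) < n := by exact_mod_cast hn
  rw [abs_div, abs_of_pos hn', div_le_iff₀ hn']
  have h2 : √(qform Θ (devVec c n X)) ≤ n * R := Real.sqrt_le_iff.2 ⟨by positivity, hX⟩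
  calc _ ≤ √(qform Θ v) * √(qform Θ (devVec c n X)) := abs_bform_le hΘ _ _
    _ ≤ √(qform Θ v) * (n * R) := by gcongr
    _ = _ := by ring

theorem bform_div_sq_le (hΘ : Θ.PosDef) (c : Fin d → ℝ) {n : ℕ} (hn : 1 ≤ n)
    (X : Fin d → ℤ) (v : Fin d → ℝ) :
    (bform Θ v (devVec c n X) / n) ^ 2 ≤ qform Θ v * ((qform Θ (devVec c n X) / n) / n) := by
  have hn' : (0 : ℝ) < n := by exact_mod_cast hn
  calc _ = bform Θ v (devVec c n X) ^ 2 / n / n := by field_simp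
    _ ≤ (qform Θ v * qform Θ (devVec c n X)) / n / n := by gcongr; exact bform_sq_le hΘ _ _
    _ = _ := by ring

/-- On a ball of radius of order `n` the exponents met below are bounded but not small, so a
quadratic remainder is needed beyond `|z| ≤ 1`. There `z² ≥ 1`, and crude bounds suffice. -/
theorem abs_exp_sub_one_sub_le {z Z : ℝ} (hz : |z| ≤ Z) :
    |Real.exp z - 1 - z| ≤ (Real.exp Z + 2) * z ^ 2 := by
  rcases le_or_gt |z| 1 with h | h
  · have := Real.abs_exp_sub_one_sub_id_le h
    nlinarith [Real.exp_pos Z, sq_nonneg z]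
  · have h1 : Real.exp z ≤ Real.exp Z := Real.exp_le_exp.2 ((le_abs_self z).trans hz)
    have h2 : |z| ≤ z ^ 2 := by rw [← sq_abs]; nlinarith
    have h3 : 1 ≤ z ^ 2 := by linarith
    have h4 := Real.exp_pos z
    have h5 := Real.exp_pos Z
    have h6 := neg_abs_le z
    have h7 := le_abs_self z
    rw [abs_le]
    constructor <;> nlinarith

theorem gaussWeight_add_le (hΘ : Θ.PosDef) (c : Fin d → ℝ) {R : ℝ} (hR : 0 ≤ R)
    (a : Fin d → ℤ) : ∃ C : ℝ, 0 < C ∧ ∀ n : ℕ, 1 ≤ n → ∀ X,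
      qform Θ (devVec c n X) ≤ (n * R) ^ 2 →
      gaussWeight Θ c n (X + a) ≤ C * gaussWeight Θ c n X := by
  refine ⟨Real.exp (√(qform Θ (realVec a)) * R), Real.exp_pos _, fun n hn X hX => ?_⟩
  have hn' : (0 : ℝ) < n := by exact_mod_cast hn
  rw [gaussWeight_add hΘ c hn, mul_comm]
  gcongr
  · exact (gaussWeight_pos c n X).le
  · have h1 := (abs_le.1 (abs_bform_div_le hΘ c hn hR X hX (realVec a))).1
    have h2 : 0 ≤ qform Θ (realVec a) / (2 * n) := div_nonneg (qform_nonneg hΘ _) (by positivity)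
    linarith

/-- First order expansion of the exponential. By Cauchy–Schwarz the square of the linear term is at
most a constant times `q/n²`, and the quadratic term of the exponent is `O(1/n)`; this is why the
error has the form `(1 + q/n)/n`, a quantity whose moments under a stationary law can be controlled.
-/
theorem abs_gaussWeight_add_sub_le (hΘ : Θ.PosDef) (c : Fin d → ℝ) {R : ℝ} (hR : 0 ≤ R)
    (a : Fin d → ℤ) : ∃ C : ℝ, 0 < C ∧ ∀ n : ℕ, 1 ≤ n → ∀ X,
      qform Θ (devVec c n X) ≤ (n * R) ^ 2 →
      |gaussWeight Θ c n (X + a) -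
        gaussWeight Θ c n X * (1 - bform Θ (realVec a) (devVec c n X) / n)| ≤
      gaussWeight Θ c n X * (C * ((1 + qform Θ (devVec c n X) / n) / n)) := by
  set A := qform Θ (realVec a) with hA
  have hA0 : 0 ≤ A := qform_nonneg hΘ _
  set Z := √A * R + A with hZ
  refine ⟨(Real.exp Z + 2) * (2 * A + A ^ 2) + A + 1, by positivity, fun n hn X hX => ?_⟩
  have hn' : (1 : ℝ) ≤ n := by exact_mod_cast hn
  have hν := gaussWeight_pos (Θ := Θ) c n X
  rw [gaussWeight_add hΘ c hn, ← mul_sub, abs_mul, abs_of_pos hν]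
  refine mul_le_mul_of_nonneg_left ?_ hν.le
  set β := bform Θ (realVec a) (devVec c n X) / n with hβ
  set s := qform Θ (devVec c n X) / n with hs
  have hs0 : 0 ≤ s := div_nonneg (qform_nonneg hΘ _) (by positivity)
  have h1 : |β| ≤ √A * R := abs_bform_div_le hΘ c hn hR X hX (realVec a)
  have h2 : β ^ 2 ≤ A * (s / n) := bform_div_sq_le hΘ c hn X (realVec a)
  set t := A / (2 * n) with ht
  have ht0 : 0 ≤ t := by positivity
  have htn : t ≤ A / n := by rw [ht]; gcongr; linarith
  have htA : t ≤ A := htn.trans (div_le_self hA0 hn')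
  have hz : |-(β + t)| ≤ Z := by
    rw [abs_neg]
    calc _ ≤ |β| + |t| := abs_add_le _ _
      _ ≤ _ := by rw [abs_of_nonneg ht0]; linarith
  have h3 := abs_exp_sub_one_sub_le hz
  have h4 : (-(β + t)) ^ 2 ≤ (2 * A + A ^ 2) * ((1 + s) / n) := by
    have : t ^ 2 ≤ A ^ 2 * (1 / n) / 2 := by
      calc t ^ 2 = (A / (2 * n)) * t := by rw [ht]; ring
        _ ≤ (A / (2 * n)) * A := by gcongr
        _ = _ := by field_simp
    have h5 : (-(β + t)) ^ 2 ≤ 2 * β ^ 2 + 2 * t ^ 2 := by nlinarith [sq_nonneg (β - t)]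
    have h6 : 0 ≤ A * (1 / n : ℝ) := by positivity
    have h7 : 0 ≤ A ^ 2 * (s / n : ℝ) := by positivity
    calc _ ≤ 2 * (A * (s / n)) + 2 * (A ^ 2 * (1 / n) / 2) := by linarith
      _ ≤ 2 * (A * (s / n)) + A ^ 2 * (1 / n) + (2 * (A * (1 / n : ℝ)) + A ^ 2 * (s / n)) := by
        linarith
      _ = _ := by ring
  have h8 : A / n ≤ A * ((1 + s) / n) := by
    rw [mul_div_assoc']; gcongr; nlinarith
  have h9 : 0 ≤ (1 + s) / n := by positivity
  calc |Real.exp (-(β + t)) - (1 - β)| = |(Real.exp (-(β + t)) - 1 - -(β + t)) - t| := by ring_nf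
    _ ≤ |Real.exp (-(β + t)) - 1 - -(β + t)| + |t| := abs_sub _ _
    _ ≤ (Real.exp Z + 2) * ((2 * A + A ^ 2) * ((1 + s) / n)) + A * ((1 + s) / n) := by
      rw [abs_of_nonneg ht0]
      refine add_le_add (h3.trans ?_) (htn.trans h8)
      gcongr
    _ ≤ _ := by nlinarith

end QuadraticForms

/-! ### Decomposition of jumps into unit steps -/

section Paths

variable {d : ℕ}

/-- Every increment along `J` is a signed sum of increments along coordinate vectors; the matrix
`M = ∑ₖ σₖ e_{iₖ} pₖᵀ` of the starting points satisfies `M + Mᵀ = J Jᵀ - diag J`. -/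
def HasUnitSteps (J : Fin d → ℤ) : Prop :=
  ∃ (ι : Type) (_ : Fintype ι) (i : ι → Fin d) (σ : ι → ℝ) (p : ι → Fin d → ℤ),
    (∀ (f : (Fin d → ℤ) → ℝ) (X : Fin d → ℤ),
      f (X + J) - f X = ∑ k, σ k * (f (X + p k + Pi.single (i k) 1) - f (X + p k))) ∧
    (∀ a, ∑ k, (if i k = a then σ k else 0) = J a) ∧
    (∀ a b, ∑ k, (if i k = a then σ k * p k b else 0) + ∑ k, (if i k = b then σ k * p k a else 0) =
      (J a : ℝ) * J b - if a = b then (J a : ℝ) else 0)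

theorem HasUnitSteps.zero : HasUnitSteps (0 : Fin d → ℤ) :=
  ⟨Empty, inferInstance, Empty.elim, Empty.elim, Empty.elim, by simp, by simp, by simp⟩

theorem HasUnitSteps.single (j : Fin d) : HasUnitSteps (Pi.single j 1 : Fin d → ℤ) := by
  refine ⟨Unit, inferInstance, fun _ => j, fun _ => 1, fun _ => 0, by simp, fun a => ?_,
    fun a b => ?_⟩
  · by_cases h : j = a <;> simp [h, eq_comm]
  · by_cases h : j = a <;> by_cases h' : j = b <;> simp [Pi.single_apply, *, eq_comm]
    all_goals grind

theorem HasUnitSteps.neg_single (j : Fin d) : HasUnitSteps (-Pi.single j 1 : Fin d → ℤ) := by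
  -- A backward step is minus the forward step started at `-e_j`.
  refine ⟨Unit, inferInstance, fun _ => j, fun _ => -1, fun _ => -Pi.single j 1, by simp,
    fun a => ?_, fun a b => ?_⟩
  · by_cases h : j = a <;> simp [h, eq_comm]
  · by_cases h : j = a <;> by_cases h' : j = b <;> simp [Pi.single_apply, *, eq_comm]
    all_goals grind

/-- Concatenation of paths: the second path starts at `J`, so its starting points are `J + p'`. This
contributes the cross terms `J Kᵀ + K Jᵀ` that `(J + K)(J + K)ᵀ` requires. -/
theorem HasUnitSteps.add {J K : Fin d → ℤ} (hJ : HasUnitSteps J) (hK : HasUnitSteps K) :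
    HasUnitSteps (J + K) := by
  obtain ⟨ι, _, i, σ, p, h1, h2, h3⟩ := hJ
  obtain ⟨ι', _, i', σ', p', h1', h2', h3'⟩ := hK
  refine ⟨ι ⊕ ι', inferInstance, Sum.elim i i', Sum.elim σ σ', Sum.elim p fun k => J + p' k,
    fun f X => ?_, fun a => ?_, fun a b => ?_⟩
  · have := h1' f (X + J)
    simp only [Fintype.sum_sum_type, Sum.elim_inl, Sum.elim_inr, ← h1 f X, ← add_assoc, ← this]
    ring
  · rw [Fintype.sum_sum_type]
    exact (congrArg₂ (· + ·) (h2 a) (h2' a)).trans (by simp)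
  · have key : ∀ a b, ∑ k, (if i' k = a then σ' k * ((J b : ℝ) + p' k b) else 0) =
        K a * J b + ∑ k, (if i' k = a then σ' k * p' k b else 0) := by
      intro a b
      rw [← h2' a, Finset.sum_mul, ← Finset.sum_add_distrib]
      refine Finset.sum_congr rfl fun k _ => ?_
      split_ifs <;> ring
    have split : ∀ a b, ∑ k, (if Sum.elim i i' k = a then
        Sum.elim σ σ' k * (Sum.elim p (fun k => J + p' k) k b : ℤ) else 0) =
        ∑ k, (if i k = a then σ k * p k b else 0) +
        (K a * J b + ∑ k, (if i' k = a then σ' k * p' k b else 0)) := by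
      intro a b
      rw [Fintype.sum_sum_type, ← key a b]
      refine congrArg₂ (· + ·) rfl (Finset.sum_congr rfl fun k _ => ?_)
      simp only [Sum.elim_inr, Pi.add_apply, Int.cast_add]
    rw [split a b, split b a]
    simp only [Pi.add_apply, Int.cast_add]
    have e := h3 a b
    have e' := h3' a b
    split_ifs at * <;> linarith

theorem hasUnitSteps (J : Fin d → ℤ) : HasUnitSteps J := by
  have h1 : ∀ (j : Fin d) (k : ℤ), HasUnitSteps (Pi.single j k : Fin d → ℤ) := by
    intro j k
    induction k using Int.induction_on with
    | zero => simpa using HasUnitSteps.zero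
    | succ k ih => rw [Pi.single_add]; exact ih.add (.single j)
    | pred k ih => rw [Pi.single_sub, sub_eq_add_neg]; exact ih.add (.neg_single j)
  rw [← Finset.univ_sum_single J]
  exact Finset.sum_induction _ HasUnitSteps (fun _ _ => .add) .zero fun j _ => h1 j _

end Paths

end

noncomputable section

/-! ### Summation by parts on the lattice -/

section Sums

variable {d : ℕ}

theorem finite_support_shift {f : (Fin d → ℤ) → ℝ} (hf : f.support.Finite) (a : Fin d → ℤ) :
    (Function.support fun X => f (X + a)).Finite :=
  (hf.preimage (Equiv.addRight a).injective.injOn).subset fun X hX => by simpa using hX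

theorem summable_mul_shift {f : (Fin d → ℤ) → ℝ} (hf : f.support.Finite) (w : (Fin d → ℤ) → ℝ)
    (a : Fin d → ℤ) : Summable fun X => w X * f (X + a) :=
  summable_of_hasFiniteSupport <| (finite_support_shift hf a).subset fun X hX => by
    simp only [Function.mem_support, ne_eq, mul_eq_zero, not_or] at hX ⊢; exact hX.2

theorem finite_support_diff {f : (Fin d → ℤ) → ℝ} (hf : f.support.Finite) (a : Fin d → ℤ) :
    (Function.support fun X => f (X + a) - f X).Finite :=
  ((finite_support_shift hf a).union hf).subset (Function.support_sub _ _)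

theorem summable_mul_diff {f : (Fin d → ℤ) → ℝ} (hf : f.support.Finite) (w : (Fin d → ℤ) → ℝ)
    (a : Fin d → ℤ) : Summable fun X => w X * (f (X + a) - f X) :=
  summable_of_hasFiniteSupport <| (finite_support_diff hf a).subset fun X hX => by
    simp only [Function.mem_support, ne_eq, mul_eq_zero, not_or] at hX ⊢; exact hX.2

theorem tsum_shift (F : (Fin d → ℤ) → ℝ) (a : Fin d → ℤ) : ∑' X, F (X + a) = ∑' X, F X :=
  (Equiv.addRight a).tsum_eq F

/-- Summation by parts: a weighted sum of increments along jumps is a weighted sum of increments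
along coordinate vectors. -/
theorem tsum_mul_diff_eq {f : (Fin d → ℤ) → ℝ} (hf : f.support.Finite) (w : (Fin d → ℤ) → ℝ)
    {J : Fin d → ℤ} {ι : Type} [Fintype ι] {i : ι → Fin d} {σ : ι → ℝ} {p : ι → Fin d → ℤ}
    (h : ∀ X, f (X + J) - f X = ∑ k, σ k * (f (X + p k + Pi.single (i k) 1) - f (X + p k))) :
    ∑' X, w X * (f (X + J) - f X) =
      ∑ a, ∑' X, (∑ k, if i k = a then σ k * w (X - p k) else 0) *
        (f (X + Pi.single a 1) - f X) := by
  have e1 : ∀ k, ∑' X, w X * (σ k * (f (X + p k + Pi.single (i k) 1) - f (X + p k))) =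
      ∑' X, σ k * w (X - p k) * (f (X + Pi.single (i k) 1) - f X) := by
    intro k
    refine Eq.trans (tsum_congr fun X => ?_)
      (tsum_shift (fun X => σ k * w (X - p k) * (f (X + Pi.single (i k) 1) - f X)) (p k))
    simp only [add_sub_cancel_right]; ring
  have s1 : ∀ k, Summable fun X =>
      w X * (σ k * (f (X + p k + Pi.single (i k) 1) - f (X + p k))) := by
    intro k
    refine summable_of_hasFiniteSupport
      ((finite_support_shift (finite_support_diff hf (Pi.single (i k) 1)) (p k)).subset
        fun X hX => ?_)
    simp only [Function.mem_support, ne_eq, mul_eq_zero, not_or] at hX ⊢; exact hX.2.2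
  calc ∑' X, w X * (f (X + J) - f X)
      = ∑' X, ∑ k, w X * (σ k * (f (X + p k + Pi.single (i k) 1) - f (X + p k))) := by
        simp only [h, Finset.mul_sum]
    _ = ∑ k, ∑' X, σ k * w (X - p k) * (f (X + Pi.single (i k) 1) - f X) := by
        rw [Summable.tsum_finsetSum fun k _ => s1 k]
        exact Finset.sum_congr rfl fun k _ => e1 k
    _ = ∑ a, ∑ k, ∑' X, (if i k = a then σ k * w (X - p k) else 0) *
          (f (X + Pi.single a 1) - f X) := by
        rw [Finset.sum_comm]
        refine Finset.sum_congr rfl fun k _ => ?_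
        rw [Finset.sum_eq_single (i k)]
        · simp
        · intro b _ hb; simp [Ne.symm hb]
        · simp
    _ = _ := by
        refine Finset.sum_congr rfl fun a _ => ?_
        simp only [Finset.sum_mul]
        exact (Summable.tsum_finsetSum fun k _ => summable_mul_diff hf _ _).symm

/-- An antisymmetric combination of second differences vanishes. -/
theorem tsum_antisymm_diff {f : (Fin d → ℤ) → ℝ} (hf : f.support.Finite)
    (ν : (Fin d → ℤ) → ℝ) {K : Fin d → Fin d → ℝ} (hK : ∀ i j, K i j + K j i = 0) :
    ∑ i, ∑' X, (∑ j, K i j * (ν X - ν (X - Pi.single j 1))) *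
      (f (X + Pi.single i 1) - f X) = 0 := by
  set T : Fin d → Fin d → ℝ := fun i j => ∑' X, (ν X - ν (X - Pi.single j 1)) *
      (f (X + Pi.single i 1) - f X) with hT
  -- Moving the difference from `ν` onto `f` turns `T i j` into a mixed second difference of `f`,
  -- which is symmetric in `i` and `j`; its contraction with an antisymmetric matrix is zero.
  have hT2 : ∀ i j, T i j = -∑' X, ν X * (f (X + Pi.single i 1 + Pi.single j 1) -
      f (X + Pi.single j 1) - f (X + Pi.single i 1) + f X) := by
    intro i j
    have e : ∑' X, ν (X - Pi.single j 1) * (f (X + Pi.single i 1) - f X) =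
        ∑' X, ν X * (f (X + Pi.single i 1 + Pi.single j 1) - f (X + Pi.single j 1)) := by
      rw [← tsum_shift _ (Pi.single j 1)]
      refine tsum_congr fun X => ?_
      rw [add_sub_cancel_right, add_right_comm]
    have s1 := summable_mul_diff hf ν (Pi.single i 1)
    have s2 : Summable fun X => ν X *
        (f (X + Pi.single i 1 + Pi.single j 1) - f (X + Pi.single j 1)) := by
      have h := summable_mul_diff (finite_support_shift hf (Pi.single j 1)) ν (Pi.single i 1)
      exact h
    have e2 : T i j = ∑' X, ν X * (f (X + Pi.single i 1) - f X) -
        ∑' X, ν (X - Pi.single j 1) * (f (X + Pi.single i 1) - f X) := by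
      rw [hT, ← Summable.tsum_sub s1 (summable_mul_diff hf _ _)]
      exact tsum_congr fun X => by ring
    rw [e2, e, ← Summable.tsum_sub s1 s2, ← tsum_neg]
    exact tsum_congr fun X => by ring
  have hsymm : ∀ i j, T i j = T j i := by
    intro i j
    rw [hT2, hT2]
    congr 1
    refine tsum_congr fun X => ?_
    rw [add_right_comm]; ring
  have e : ∀ i, ∑' X, (∑ j, K i j * (ν X - ν (X - Pi.single j 1))) *
      (f (X + Pi.single i 1) - f X) = ∑ j, K i j * T i j := by
    intro i
    simp only [Finset.sum_mul, hT, ← tsum_mul_left]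
    rw [Summable.tsum_finsetSum fun k _ => summable_mul_diff hf _ _]
    simp only [mul_assoc]
  simp only [e]
  have h2 : ∑ i, ∑ j, K i j * T i j = -∑ i, ∑ j, K i j * T i j := by
    conv_lhs => rw [Finset.sum_comm]
    rw [← Finset.sum_neg_distrib]
    refine Finset.sum_congr rfl fun i _ => ?_
    rw [← Finset.sum_neg_distrib]
    refine Finset.sum_congr rfl fun j _ => ?_
    rw [hsymm j i, show K j i = -K i j by linarith [hK i j]]; ring
  linarith

end Sums

/-! ### The linearised generator applied to the Gaussian weight -/

section GaussDrift

variable {d : ℕ} {Θ : Matrix (Fin d) (Fin d) ℝ}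

theorem bform_realVec (v : Fin d → ℤ) (y : Fin d → ℝ) :
    bform Θ (realVec v) y = ∑ j, (v j : ℝ) * Θ.mulVec y j := rfl

/-- Expresses the gradients of the rates through the `Θ` form, so that its Cauchy–Schwarz inequality
applies to them as well. -/
theorem dotProduct_eq_bform (hΘ : Θ.PosDef) (u y : Fin d → ℝ) :
    u ⬝ᵥ y = bform Θ (Θ⁻¹.mulVec u) y := by
  rw [bform_comm hΘ, bform, Matrix.mulVec_mulVec,
    Matrix.mul_nonsing_inv _ ((Matrix.isUnit_iff_isUnit_det _).1 hΘ.isUnit),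
    Matrix.one_mulVec, dotProduct_comm]

theorem devVec_sub (c : Fin d → ℝ) (n : ℕ) (X a : Fin d → ℤ) :
    devVec c n (X - a) = devVec c n X - realVec a := by
  ext i; simp [devVec, realVec]; ring

/-- A discrete product rule. The shift by `-p` multiplies `ν` by about `1 + β` and changes the
affine rate `g + α` only by `κ/n`. Of the product, `g + α + gβ` is kept; the cross term `αβ` and
everything containing `κ/n` are of order `(1 + q/n)/n`. -/
theorem abs_gaussWeight_mul_affine_sub_le (hΘ : Θ.PosDef) (c : Fin d → ℝ) {R : ℝ} (hR : 0 ≤ R)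
    (p : Fin d → ℤ) (g : ℝ) (u : Fin d → ℝ) : ∃ C : ℝ, 0 < C ∧ ∀ n : ℕ, 1 ≤ n → ∀ X,
      qform Θ (devVec c n X) ≤ (n * R) ^ 2 →
      |gaussWeight Θ c n (X - p) * (g + (u ⬝ᵥ devVec c n (X - p)) / n) -
        gaussWeight Θ c n X * (g + (u ⬝ᵥ devVec c n X) / n +
          g * (bform Θ (realVec p) (devVec c n X) / n))| ≤
      gaussWeight Θ c n X * (C * ((1 + qform Θ (devVec c n X) / n) / n)) := by
  obtain ⟨C₁, hC₁, h₁⟩ := abs_gaussWeight_add_sub_le hΘ c hR (-p)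
  set v := Θ⁻¹.mulVec u with hv
  set P := qform Θ (realVec p) with hP
  set Q := qform Θ v with hQ
  have hP0 : 0 ≤ P := qform_nonneg hΘ _
  have hQ0 : 0 ≤ Q := qform_nonneg hΘ _
  set κ := u ⬝ᵥ realVec p with hκ
  refine ⟨C₁ * (|g| + √Q * R + |κ|) + (P + Q + |κ| * (1 + √P * R)) + 1, by positivity,
    fun n hn X hX => ?_⟩
  have hn' : (1 : ℝ) ≤ n := by exact_mod_cast hn
  have hν := gaussWeight_pos (Θ := Θ) c n X
  have h1 := h₁ n hn X hX
  rw [← sub_eq_add_neg, realVec_neg] at h1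
  set s := qform Θ (devVec c n X) / n with hs
  have hs0 : 0 ≤ s := div_nonneg (qform_nonneg hΘ _) (by positivity)
  set β := bform Θ (realVec p) (devVec c n X) / n with hβ
  set α := bform Θ v (devVec c n X) / n with hα
  have hα1 : |α| ≤ √Q * R := abs_bform_div_le hΘ c hn hR X hX v
  have hβ1 : |β| ≤ √P * R := abs_bform_div_le hΘ c hn hR X hX _
  have hα2 : α ^ 2 ≤ Q * (s / n) := bform_div_sq_le hΘ c hn X v
  have hβ2 : β ^ 2 ≤ P * (s / n) := bform_div_sq_le hΘ c hn X _
  have e1 : bform Θ (-realVec p) (devVec c n X) / n = -β := by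
    rw [hβ, show -realVec p = (-1 : ℝ) • realVec p by simp, bform_smul_left]; ring
  have e2 : (u ⬝ᵥ devVec c n (X - p)) / n = α - κ / n := by
    rw [devVec_sub, dotProduct_sub, dotProduct_eq_bform hΘ u (devVec c n X), sub_div]
  rw [e1] at h1
  rw [e2, dotProduct_eq_bform hΘ u (devVec c n X)]
  set ν := gaussWeight Θ c n X
  set ν' := gaussWeight Θ c n (X - p)
  set r := (1 + s) / n with hr
  have hr0 : 0 ≤ r := by positivity
  have hκn : |κ / n| ≤ |κ| * r := by
    rw [abs_div, Nat.abs_cast, hr, ← mul_div_assoc]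
    gcongr
    nlinarith [abs_nonneg κ]
  have hκn1 : |κ / n| ≤ |κ| := by
    rw [abs_div, Nat.abs_cast]; exact div_le_self (abs_nonneg _) hn'
  have hsr : s / n ≤ r := by rw [hr]; gcongr; linarith
  have hαβ : |α * β| ≤ (P + Q) * r := by
    rw [abs_mul]
    have := two_mul_le_add_sq |α| |β|
    rw [sq_abs, sq_abs] at this
    have h3 : Q * (s / n) ≤ Q * r := by gcongr
    have h4 : P * (s / n) ≤ P * r := by gcongr
    nlinarith [abs_nonneg α, abs_nonneg β, mul_nonneg (abs_nonneg α) (abs_nonneg β)]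
  have key : ν' * (g + (α - κ / n)) - ν * (g + α + g * β) =
      (ν' - ν * (1 - -β)) * (g + α - κ / n) + ν * (α * β - κ / n * (1 + β)) := by ring
  change |ν' * (g + (α - κ / n)) - ν * (g + α + g * β)| ≤ _
  rw [key]
  have b1 : |g + α - κ / n| ≤ |g| + √Q * R + |κ| :=
    (abs_sub _ _).trans (add_le_add ((abs_add_le _ _).trans (by linarith)) hκn1)
  have b2 : |α * β - κ / n * (1 + β)| ≤ (P + Q + |κ| * (1 + √P * R)) * r := by
    calc _ ≤ |α * β| + |κ / n * (1 + β)| := abs_sub _ _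
      _ ≤ (P + Q) * r + (|κ| * r) * (1 + √P * R) := by
        rw [abs_mul (κ / n)]
        gcongr
        calc |1 + β| ≤ |1| + |β| := abs_add_le _ _
          _ ≤ _ := by rw [abs_one]; linarith
      _ = _ := by ring
  calc _ ≤ |ν' - ν * (1 - -β)| * |g + α - κ / n| + ν * |α * β - κ / n * (1 + β)| := by
        refine (abs_add_le _ _).trans ?_
        rw [abs_mul, abs_mul, abs_of_pos hν]
    _ ≤ (ν * (C₁ * r)) * (|g| + √Q * R + |κ|) + ν * ((P + Q + |κ| * (1 + √P * R)) * r) := by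
        gcongr
    _ ≤ _ := by nlinarith [mul_nonneg hν.le hr0]

/-- The matrix `∑_J J u_Jᵀ`. -/
def jumpJacobian (jumps : Finset (Fin d → ℤ)) (u : (Fin d → ℤ) → Fin d → ℝ) :
    Matrix (Fin d) (Fin d) ℝ := Matrix.of fun i j => ∑ J ∈ jumps, (J i : ℝ) * u J j

/-- The matrix `∑_J g_J J Jᵀ`. -/
def jumpCovariance (jumps : Finset (Fin d → ℤ)) (g : (Fin d → ℤ) → ℝ) :
    Matrix (Fin d) (Fin d) ℝ := Matrix.of fun i j => ∑ J ∈ jumps, g J * (J i * J j)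

/-- A weak form of the statement that `ν` is almost stationary for the linearised chain. After
summation by parts the increment `f(X + e_a) - f(X)` carries, up to errors of order `ν (1 + q/n)/n`,
the weight `(ν/n) (K Θ y)_a`, where `y = X - nc` and `K` is the Jacobian times `Θ⁻¹` plus the
averaged matrices `M` of `HasUnitSteps`. Since `M + Mᵀ = J Jᵀ - diag J` and the diagonal part
averages to zero at equilibrium, `K + Kᵀ` is the left side of the Lyapunov equation. Thus `K` is
antisymmetric, and `tsum_antisymm_diff` removes the leading term. -/
theorem abs_sum_affine_diff_le (hΘ : Θ.PosDef) (c : Fin d → ℝ) {jumps : Finset (Fin d → ℤ)}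
    {g : (Fin d → ℤ) → ℝ} {u : (Fin d → ℤ) → Fin d → ℝ}
    (heq : ∀ i, ∑ J ∈ jumps, g J * (J i : ℝ) = 0)
    (hlyap : jumpJacobian jumps u * Θ⁻¹ + Θ⁻¹ * (jumpJacobian jumps u).transpose +
      jumpCovariance jumps g = 0) {R : ℝ} (hR : 0 ≤ R) :
    ∃ C : ℝ, 0 < C ∧ ∀ n : ℕ, 1 ≤ n → ∀ f : (Fin d → ℤ) → ℝ, f.support.Finite →
      (∀ X, f X ≠ 0 → qform Θ (devVec c n X) ≤ (n * R) ^ 2) →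
      |n * ∑ J ∈ jumps, ∑' X, gaussWeight Θ c n X * (g J + (u J ⬝ᵥ devVec c n X) / n) *
        (f (X + J) - f X)| ≤
      C * ∑ i, ∑' X, gaussWeight Θ c n X * (1 + qform Θ (devVec c n X) / n) *
        |f (X + Pi.single i 1) - f X| := by
  choose ι inst i σ p h1 h2 h3 using hasUnitSteps (d := d)
  obtain ⟨D, hD0, hD⟩ : ∃ D : ℝ, 0 ≤ D ∧ ∀ i : Fin d,
      √(qform Θ (realVec (Pi.single i 1))) ≤ D :=
    ⟨∑ i : Fin d, √(qform Θ (realVec (Pi.single i 1))),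
      Finset.sum_nonneg fun _ _ => Real.sqrt_nonneg _, fun i =>
      Finset.single_le_sum (f := fun i : Fin d => √(qform Θ (realVec (Pi.single i 1))))
        (fun _ _ => Real.sqrt_nonneg _) (Finset.mem_univ i)⟩
  -- An increment of `f` can be nonzero at a point one unit step outside the ball that carries `f`,
  -- so the expansions are needed up to radius `n(R + D)`.
  have hR' : 0 ≤ R + D := by positivity
  choose C₁ hC₁ hb₁ using fun (J : Fin d → ℤ) (k : ι J) =>
    abs_gaussWeight_mul_affine_sub_le hΘ c hR' (p J k) (g J) (u J)
  choose C₂ hC₂ hb₂ using fun j : Fin d =>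
    abs_gaussWeight_add_sub_le hΘ c hR' (-Pi.single j 1)
  set m : Fin d → Fin d → ℝ := fun a b =>
    ∑ J ∈ jumps, g J * ∑ k, (if i J k = a then σ J k * (p J k b : ℝ) else 0) with hm
  set K : Matrix (Fin d) (Fin d) ℝ := jumpJacobian jumps u * Θ⁻¹ + Matrix.of m with hK
  have hΘs : Θ.transpose = Θ := by simpa [Matrix.IsHermitian] using hΘ.1
  have hKanti : ∀ a b, K a b + K b a = 0 := by
    intro a b
    have e1 := congrFun (congrFun hlyap a) b
    have e2 : (jumpJacobian jumps u * Θ⁻¹) b a = (Θ⁻¹ * (jumpJacobian jumps u).transpose) a b := by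
      rw [← Matrix.transpose_apply (jumpJacobian jumps u * Θ⁻¹), Matrix.transpose_mul,
        Matrix.transpose_nonsing_inv, hΘs]
    have e3 : m a b + m b a = jumpCovariance jumps g a b := by
      have e4 : ∑ J ∈ jumps, g J * (if a = b then (J a : ℝ) else 0) = 0 := by
        by_cases hab : a = b
        · simpa [hab] using heq b
        · simp [hab]
      have e5 : m a b + m b a = ∑ J ∈ jumps, g J * ((J a : ℝ) * J b) -
          ∑ J ∈ jumps, g J * (if a = b then (J a : ℝ) else 0) := by
        rw [hm, ← Finset.sum_add_distrib, ← Finset.sum_sub_distrib]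
        exact Finset.sum_congr rfl fun J _ => by rw [← mul_add, h3 J a b]; ring
      rw [e5, e4, sub_zero]; rfl
    simp only [hK, Matrix.add_apply, Matrix.of_apply, Matrix.zero_apply] at e1 ⊢
    linarith
  refine ⟨∑ J ∈ jumps, ∑ k, |σ J k| * C₁ J k + ∑ a, ∑ j, |K a j| * C₂ j + 1, ?_,
    fun n hn f hf hfR => ?_⟩
  · have : 0 ≤ ∑ J ∈ jumps, ∑ k, |σ J k| * C₁ J k :=
      Finset.sum_nonneg fun J _ => Finset.sum_nonneg fun k _ =>
        mul_nonneg (abs_nonneg _) (hC₁ J k).le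
    have : 0 ≤ ∑ a, ∑ j, |K a j| * C₂ j :=
      Finset.sum_nonneg fun J _ => Finset.sum_nonneg fun k _ =>
        mul_nonneg (abs_nonneg _) (hC₂ k).le
    positivity
  set C := ∑ J ∈ jumps, ∑ k, |σ J k| * C₁ J k + ∑ a, ∑ j, |K a j| * C₂ j + 1 with hC
  have hn' : (1 : ℝ) ≤ n := by exact_mod_cast hn
  set ν := gaussWeight Θ c n with hν
  set y := devVec c n with hy
  set ℓ : (Fin d → ℤ) → (Fin d → ℤ) → ℝ := fun J X => ν X * (g J + (u J ⬝ᵥ y X) / n) with hℓ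
  set W : Fin d → (Fin d → ℤ) → ℝ := fun a X =>
    ∑ J ∈ jumps, ∑ k, (if i J k = a then σ J k * ℓ J (X - p J k) else 0) with hW
  -- `Z` contributes nothing in total, by antisymmetry of `K`. As `ν(X) - ν(X - e_j)` is about
  -- `-ν(X) (Θ y)_j / n`, adding it to `W` cancels the leading term of `W` pointwise.
  set Z : Fin d → (Fin d → ℤ) → ℝ := fun a X =>
    ∑ j, K a j * (ν X - ν (X - Pi.single j 1)) with hZ
  -- the weight of the increments along coordinate vectors
  have hpoint : ∀ a X, qform Θ (y X) ≤ (n * (R + D)) ^ 2 →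
      |W a X + Z a X| ≤ C * (ν X * ((1 + qform Θ (y X) / n) / n)) := by
    intro a X hX
    set r := (1 + qform Θ (y X) / n) / n with hr
    have hr0 : 0 ≤ r := by
      have := qform_nonneg hΘ (y X)
      positivity
    have hνpos : 0 < ν X := gaussWeight_pos c n X
    have main : ∑ J ∈ jumps, ∑ k, (if i J k = a then σ J k * (ν X * (g J + (u J ⬝ᵥ y X) / n +
        g J * (bform Θ (realVec (p J k)) (y X) / n))) else 0) =
        ∑ j, K a j * (ν X * (bform Θ (realVec (Pi.single j 1)) (y X) / n)) := by
      have e1 : ∀ j, bform Θ (realVec (Pi.single j 1)) (y X) = Θ.mulVec (y X) j := by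
        intro j
        rw [bform_realVec, Finset.sum_eq_single j] <;> simp +contextual
      have e2 : ∀ J, ∑ k, (if i J k = a then σ J k * (ν X * (g J + (u J ⬝ᵥ y X) / n +
          g J * (bform Θ (realVec (p J k)) (y X) / n))) else 0) =
          ν X * (g J * J a) + ν X / n * ((J a : ℝ) * (u J ⬝ᵥ y X)) + ν X / n *
            ∑ j, (g J * ∑ k, (if i J k = a then σ J k * (p J k j : ℝ) else 0)) *
              Θ.mulVec (y X) j := by
        intro J
        have e3 : ∑ j, (g J * ∑ k, (if i J k = a then σ J k * (p J k j : ℝ) else 0)) *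
              Θ.mulVec (y X) j = g J * ∑ k, (if i J k = a then σ J k *
                bform Θ (realVec (p J k)) (y X) else 0) := by
          simp only [mul_assoc, Finset.sum_mul, ← Finset.mul_sum]
          rw [Finset.sum_comm]
          congr 1
          refine Finset.sum_congr rfl fun k _ => ?_
          split_ifs
          · rw [bform_realVec, Finset.mul_sum]; exact Finset.sum_congr rfl fun j _ => by ring
          · simp
        rw [e3, ← h2 J a]
        simp only [Finset.mul_sum, Finset.sum_mul]
        simp only [← Finset.sum_add_distrib]
        refine Finset.sum_congr rfl fun k _ => ?_
        split_ifs
        · ring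
        · ring
      have e4 : ∑ J ∈ jumps, (J a : ℝ) * (u J ⬝ᵥ y X) = (jumpJacobian jumps u).mulVec (y X) a := by
        simp only [jumpJacobian, Matrix.mulVec, dotProduct, Matrix.of_apply, Finset.mul_sum,
          Finset.sum_mul]
        rw [Finset.sum_comm]
        exact Finset.sum_congr rfl fun _ _ => Finset.sum_congr rfl fun _ _ => by ring
      have e5 : ∑ J ∈ jumps, ∑ j, (g J * ∑ k, (if i J k = a then σ J k * (p J k j : ℝ) else 0)) *
              Θ.mulVec (y X) j = (Matrix.of m).mulVec (Θ.mulVec (y X)) a := by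
        rw [Finset.sum_comm]
        simp only [Matrix.mulVec, dotProduct, Matrix.of_apply, hm, Finset.sum_mul]
      have e6 : K.mulVec (Θ.mulVec (y X)) = (jumpJacobian jumps u).mulVec (y X) +
          (Matrix.of m).mulVec (Θ.mulVec (y X)) := by
        rw [hK, Matrix.add_mulVec, Matrix.mulVec_mulVec (y X), Matrix.mul_assoc,
          Matrix.nonsing_inv_mul _ ((Matrix.isUnit_iff_isUnit_det _).1 hΘ.isUnit), Matrix.mul_one]
      have e7 : ∑ j, K a j * (ν X * (bform Θ (realVec (Pi.single j 1)) (y X) / n)) =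
          ν X / n * K.mulVec (Θ.mulVec (y X)) a := by
        simp only [e1, Matrix.mulVec, dotProduct, Finset.mul_sum]
        exact Finset.sum_congr rfl fun _ _ => by
          simp only [Finset.sum_div, Finset.mul_sum]
          exact Finset.sum_congr rfl fun _ _ => by ring
      rw [e7, e6, Pi.add_apply, ← e4, ← e5, Finset.sum_congr rfl fun J _ => e2 J]
      simp only [Finset.sum_add_distrib, ← Finset.mul_sum]
      rw [heq a]; ring
    have hWb : |W a X - ∑ J ∈ jumps, ∑ k, (if i J k = a then σ J k * (ν X * (g J +
        (u J ⬝ᵥ y X) / n + g J * (bform Θ (realVec (p J k)) (y X) / n))) else 0)| ≤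
        (∑ J ∈ jumps, ∑ k, |σ J k| * C₁ J k) * (ν X * r) := by
      simp only [hW, Finset.sum_mul]
      rw [← Finset.sum_sub_distrib]
      refine (Finset.abs_sum_le_sum_abs _ _).trans (Finset.sum_le_sum fun J _ => ?_)
      rw [← Finset.sum_sub_distrib]
      refine (Finset.abs_sum_le_sum_abs _ _).trans (Finset.sum_le_sum fun k _ => ?_)
      split_ifs
      · rw [← mul_sub, abs_mul, mul_assoc]
        refine mul_le_mul_of_nonneg_left ?_ (abs_nonneg _)
        refine (hb₁ J k n hn X hX).trans (le_of_eq ?_)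
        ring
      · rw [sub_zero, abs_zero]
        exact mul_nonneg (mul_nonneg (abs_nonneg _) (hC₁ J k).le) (mul_nonneg hνpos.le hr0)
    have hZb : |Z a X + ∑ j, K a j * (ν X * (bform Θ (realVec (Pi.single j 1)) (y X) / n))| ≤
        (∑ a, ∑ j, |K a j| * C₂ j) * (ν X * r) := by
      refine le_trans ?_ (mul_le_mul_of_nonneg_right (Finset.single_le_sum
        (f := fun a => ∑ j, |K a j| * C₂ j) (fun a _ => Finset.sum_nonneg fun j _ =>
          mul_nonneg (abs_nonneg _) (hC₂ j).le) (Finset.mem_univ a))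
        (mul_nonneg hνpos.le hr0))
      simp only [hZ]
      rw [← Finset.sum_add_distrib, Finset.sum_mul]
      refine (Finset.abs_sum_le_sum_abs _ _).trans (Finset.sum_le_sum fun j _ => ?_)
      rw [← mul_add, abs_mul, mul_assoc]
      refine mul_le_mul_of_nonneg_left ?_ (abs_nonneg _)
      have h5 := hb₂ j n hn X hX
      rw [← sub_eq_add_neg, realVec_neg, show -realVec (Pi.single j 1 : Fin d → ℤ) =
        (-1 : ℝ) • realVec (Pi.single j 1 : Fin d → ℤ) by simp, bform_smul_left] at h5
      rw [abs_sub_comm] at h5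
      refine le_trans (le_of_eq ?_) (h5.trans (le_of_eq ?_))
      · congr 1; simp only [hν, hy]; ring
      · simp only [hν, hy, hr]; ring
    have : W a X + Z a X = (W a X - ∑ J ∈ jumps, ∑ k, (if i J k = a then σ J k * (ν X * (g J +
        (u J ⬝ᵥ y X) / n + g J * (bform Θ (realVec (p J k)) (y X) / n))) else 0)) +
        (Z a X + ∑ j, K a j * (ν X * (bform Θ (realVec (Pi.single j 1)) (y X) / n))) := by
      rw [main]; ring
    rw [this]
    refine (abs_add_le _ _).trans ((add_le_add hWb hZb).trans ?_)
    rw [hC]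
    nlinarith [mul_nonneg hνpos.le hr0]
  have hsum : ∑ J ∈ jumps, ∑' X, ν X * (g J + (u J ⬝ᵥ y X) / n) * (f (X + J) - f X) =
      ∑ a, ∑' X, (W a X + Z a X) * (f (X + Pi.single a 1) - f X) := by
    have e1 : ∀ J, ∑' X, ν X * (g J + (u J ⬝ᵥ y X) / n) * (f (X + J) - f X) = _ := fun J =>
      tsum_mul_diff_eq hf (ℓ J) (h1 J f)
    have e2 : ∑ a, ∑' X, (W a X + Z a X) * (f (X + Pi.single a 1) - f X) =
        ∑ a, ∑' X, W a X * (f (X + Pi.single a 1) - f X) := by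
      have e3 := tsum_antisymm_diff hf ν hKanti
      refine Eq.trans ?_ ((congrArg₂ (· + ·) rfl e3).trans (add_zero _))
      rw [← Finset.sum_add_distrib]
      refine Finset.sum_congr rfl fun a _ => ?_
      rw [← Summable.tsum_add (summable_mul_diff hf _ _) (summable_mul_diff hf _ _)]
      exact tsum_congr fun X => by rw [add_mul]
    rw [e2, Finset.sum_congr rfl fun J _ => e1 J, Finset.sum_comm]
    refine Finset.sum_congr rfl fun a _ => ?_
    simp only [hW, Finset.sum_mul (s := jumps)]
    exact (Summable.tsum_finsetSum fun k _ => summable_mul_diff hf _ _).symm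
  rw [hsum, Finset.mul_sum, Finset.mul_sum]
  refine (Finset.abs_sum_le_sum_abs _ _).trans (Finset.sum_le_sum fun a _ => ?_)
  rw [abs_mul, Nat.abs_cast]
  have hs := (summable_mul_diff hf (fun X => W a X + Z a X) (Pi.single a 1))
  have hs2 : Summable fun X => ν X * (1 + qform Θ (y X) / n) * |f (X + Pi.single a 1) - f X| :=
    summable_of_hasFiniteSupport <| (finite_support_diff hf (Pi.single a 1)).subset fun X hX => by
      simp only [Function.mem_support, ne_eq, mul_eq_zero, not_or, abs_eq_zero] at hX ⊢; exact hX.2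
  calc (n : ℝ) * |∑' X, (W a X + Z a X) * (f (X + Pi.single a 1) - f X)|
      ≤ n * ∑' X, |(W a X + Z a X) * (f (X + Pi.single a 1) - f X)| := by
        gcongr
        simpa only [Real.norm_eq_abs] using norm_tsum_le_tsum_norm hs.norm
    _ = ∑' X, n * |(W a X + Z a X) * (f (X + Pi.single a 1) - f X)| := tsum_mul_left.symm
    _ ≤ ∑' X, C * (ν X * (1 + qform Θ (y X) / n) * |f (X + Pi.single a 1) - f X|) := by
        refine Summable.tsum_le_tsum (fun X => ?_) (hs.abs.mul_left _) (hs2.mul_left _)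
        by_cases hX : f (X + Pi.single a 1) - f X = 0
        · simp [hX]
        have hXR : qform Θ (y X) ≤ (n * (R + D)) ^ 2 := by
          have hsq : √(qform Θ (y X)) ≤ n * (R + D) := by
            by_cases hX0 : f X = 0
            · have hX1 : f (X + Pi.single a 1) ≠ 0 := fun h => hX (by rw [h, hX0, sub_zero])
              have h6 : √(qform Θ (y (X + Pi.single a 1))) ≤ n * R :=
                Real.sqrt_le_iff.2 ⟨by positivity, hfR _ hX1⟩
              have h7 := sqrt_qform_add_le hΘ (y (X + Pi.single a 1))
                (-realVec (Pi.single a 1 : Fin d → ℤ))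
              rw [qform_neg] at h7
              have h8 : y X = y (X + Pi.single a 1) + -realVec (Pi.single a 1 : Fin d → ℤ) := by
                rw [hy, devVec_add]; abel
              rw [h8]
              nlinarith [hD a]
            · have h6 : √(qform Θ (y X)) ≤ n * R :=
                Real.sqrt_le_iff.2 ⟨by positivity, hfR _ hX0⟩
              nlinarith
          calc qform Θ (y X) = √(qform Θ (y X)) ^ 2 := (Real.sq_sqrt (qform_nonneg hΘ _)).symm
            _ ≤ _ := by gcongr
        rw [abs_mul, ← mul_assoc, ← mul_assoc]
        refine mul_le_mul_of_nonneg_right ?_ (abs_nonneg _)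
        calc (n : ℝ) * |W a X + Z a X|
            ≤ n * (C * (ν X * ((1 + qform Θ (y X) / n) / n))) := by
              gcongr; exact hpoint a X hXR
          _ = _ := by field_simp
    _ = _ := tsum_mul_left

end GaussDrift

end

noncomputable section

/-! ### A Hardy type inequality for the discrete Gaussian weight -/

section Hardy

variable {d : ℕ} {Θ : Matrix (Fin d) (Fin d) ℝ}

theorem sqrt_gaussWeight_add (hΘ : Θ.PosDef) (c : Fin d → ℝ) {n : ℕ} (hn : 1 ≤ n)
    (X a : Fin d → ℤ) :
    √(gaussWeight Θ c n (X + a)) = √(gaussWeight Θ c n X) *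
      Real.exp (-(bform Θ (realVec a) (devVec c n X) / n / 2 + qform Θ (realVec a) / (4 * n))) := by
  rw [gaussWeight_add hΘ c hn, Real.sqrt_mul (gaussWeight_pos c n X).le, ← Real.exp_half]
  congr 2
  ring

theorem two_add_sq_le_exp_add_exp_neg (x : ℝ) : 2 + x ^ 2 ≤ Real.exp x + Real.exp (-x) := by
  have h1 : (x / 2) ^ 2 ≤ Real.sinh (x / 2) ^ 2 := by
    rcases le_total 0 (x / 2) with h | h
    · have := Real.self_le_sinh_iff.2 h; nlinarith
    · have := Real.sinh_le_self_iff.2 h; nlinarith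
  have h2 := Real.cosh_two_mul (x / 2)
  rw [Real.cosh_sq, mul_div_cancel₀ x two_ne_zero, Real.cosh_eq] at h2
  linarith

/-- The ground state transform for the weight `√ν`. -/
theorem mul_sq_sub_ge (α β h h' : ℝ) :
    h ^ 2 * (α * β - α ^ 2) + h' ^ 2 * (α * β - β ^ 2) ≤ α * β * (h' - h) ^ 2 := by
  nlinarith [sq_nonneg (α * h - β * h')]

/-- The ground state transform with `ρ = √ν`: with `z = (Θ y)_i / n` and `t = Θ_ii / (4n)`, the
ratio `(ρ(X + e) + ρ(X - e)) / ρ(X)` exceeds 2 by at least `z²/8 - 2t`, because `exp x + exp(-x) ≥ 2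
+ x²`. The Dirichlet form therefore controls the mass wherever `|Θ y|²` is large compared with `n`.
-/
theorem hardy_gaussWeight (hΘ : Θ.PosDef) (c : Fin d → ℝ) {n : ℕ} (hn : 1 ≤ n) (i : Fin d)
    (hni : Θ i i ≤ 2 * n) {h : (Fin d → ℤ) → ℝ} (hh : h.support.Finite) :
    ∑' X, gaussWeight Θ c n X * (Θ.mulVec (devVec c n X) i) ^ 2 / (8 * n ^ 2) * h X ^ 2 ≤
      ∑' X, √(gaussWeight Θ c n X) * √(gaussWeight Θ c n (X + Pi.single i 1)) *
        (h (X + Pi.single i 1) - h X) ^ 2 +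
      ∑' X, Θ i i / (2 * n) * gaussWeight Θ c n X * h X ^ 2 := by
  have hn' : (0 : ℝ) < n := by exact_mod_cast hn
  set e : Fin d → ℤ := Pi.single i 1 with he
  set ρ : (Fin d → ℤ) → ℝ := fun X => √(gaussWeight Θ c n X) with hρ
  have hρ2 : ∀ X, gaussWeight Θ c n X = ρ X ^ 2 := fun X =>
    (Real.sq_sqrt (gaussWeight_pos c n X).le).symm
  have hh2 : (fun X => h X ^ 2).support.Finite := hh.subset fun X hX => by
    simpa using hX
  have sm : ∀ w : (Fin d → ℤ) → ℝ, Summable fun X => w X * h X ^ 2 := fun w => by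
    simpa using summable_mul_shift hh2 w 0
  have sD : Summable fun X => ρ X * ρ (X + e) * (h (X + e) - h X) ^ 2 :=
    summable_of_hasFiniteSupport <| (finite_support_diff hh e).subset fun X hX => by
      simp only [Function.mem_support, ne_eq, mul_eq_zero, not_or, pow_eq_zero_iff two_ne_zero]
        at hX ⊢; exact hX.2
  have e1 : bform Θ (realVec e) = fun y => Θ.mulVec y i := by
    funext y
    rw [he, bform_realVec, Finset.sum_eq_single i] <;> simp +contextual
  have e2 : qform Θ (realVec e) = Θ i i := by
    have : realVec e = Pi.single i 1 := by
      ext j; simp [realVec, he, Pi.single_apply]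
    rw [qform, e1, this]; simp
  have s1 : ∑' X, h (X + e) ^ 2 * (ρ X * ρ (X + e) - ρ (X + e) ^ 2) =
      ∑' X, (ρ (X - e) * ρ X - ρ X ^ 2) * h X ^ 2 := by
    refine Eq.trans (tsum_congr fun X => ?_)
      (tsum_shift (fun X => (ρ (X - e) * ρ X - ρ X ^ 2) * h X ^ 2) e)
    simp only [add_sub_cancel_right]; ring
  have s2 : Summable fun X => h (X + e) ^ 2 * (ρ X * ρ (X + e) - ρ (X + e) ^ 2) := by
    simpa only [mul_comm] using summable_mul_shift hh2 (fun X => ρ X * ρ (X + e) - ρ (X + e) ^ 2) e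
  have h1 : ∑' X, (ρ X * ρ (X + e) - ρ X ^ 2) * h X ^ 2 +
      ∑' X, (ρ (X - e) * ρ X - ρ X ^ 2) * h X ^ 2 ≤
      ∑' X, ρ X * ρ (X + e) * (h (X + e) - h X) ^ 2 := by
    rw [← s1, ← Summable.tsum_add (sm _) s2]
    refine Summable.tsum_le_tsum (fun X => ?_) ((sm _).add s2) sD
    have := mul_sq_sub_ge (ρ X) (ρ (X + e)) (h X) (h (X + e))
    linarith
  refine le_trans ?_ (add_le_add_left h1 _)
  rw [← Summable.tsum_add (sm _) (sm _), ← Summable.tsum_add ((sm _).add (sm _)) (sm _)]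
  refine Summable.tsum_le_tsum (fun X => ?_) (sm _) (((sm _).add (sm _)).add (sm _))
  rw [← add_mul, ← add_mul]
  refine mul_le_mul_of_nonneg_right ?_ (sq_nonneg _)
  have r1 := sqrt_gaussWeight_add hΘ c hn X e
  have r2 := sqrt_gaussWeight_add hΘ c hn X (-e)
  rw [← sub_eq_add_neg] at r2
  change ρ (X - e) = ρ X * _ at r2
  change ρ (X + e) = ρ X * _ at r1
  rw [realVec_neg, qform_neg, show -realVec e = (-1 : ℝ) • realVec e by simp, bform_smul_left,
    e1, e2] at r2
  rw [e1, e2] at r1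
  rw [r1, r2, hρ2]
  set z := Θ.mulVec (devVec c n X) i / n with hz
  set t := Θ i i / (4 * n) with ht
  have ht0 : 0 ≤ t := by
    have : 0 ≤ Θ i i := e2 ▸ qform_nonneg hΘ _
    positivity
  -- Then the factor `1 - t` keeps at least half of `(z/2)²`, which gives the `z²/8`.
  have ht1 : t ≤ 1 / 2 := by rw [ht, div_le_iff₀ (by positivity)]; linarith
  have x1 : Real.exp (-(z / 2 + t)) = Real.exp (-t) * Real.exp (-(z / 2)) := by
    rw [← Real.exp_add]; ring_nf
  have x2 : Real.exp (-(-1 * Θ.mulVec (devVec c n X) i / n / 2 + t)) =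
      Real.exp (-t) * Real.exp (z / 2) := by
    rw [← Real.exp_add, hz]; ring_nf
  rw [x1, x2]
  have y1 := two_add_sq_le_exp_add_exp_neg (z / 2)
  have y2 := Real.add_one_le_exp (-t)
  have y3 : 2 - 2 * t + z ^ 2 / 8 ≤ Real.exp (-t) * Real.exp (-(z / 2)) +
      Real.exp (-t) * Real.exp (z / 2) := by
    rw [← mul_add]
    calc 2 - 2 * t + z ^ 2 / 8 ≤ (1 - t) * (2 + (z / 2) ^ 2) := by nlinarith [sq_nonneg z]
      _ ≤ Real.exp (-t) * (2 + (z / 2) ^ 2) := by gcongr; linarith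
      _ ≤ _ := mul_le_mul_of_nonneg_left (by linarith) (Real.exp_pos _).le
  have y4 : ρ X ^ 2 * (Θ.mulVec (devVec c n X) i) ^ 2 / (8 * n ^ 2) = ρ X ^ 2 * (z ^ 2 / 8) := by
    rw [hz]; field_simp
  have y5 : Θ i i / (2 * n) * ρ X ^ 2 = ρ X ^ 2 * (2 * t) := by rw [ht]; field_simp; norm_num; ring
  rw [y4, y5]
  nlinarith [mul_le_mul_of_nonneg_left y3 (sq_nonneg (ρ X))]

end Hardy

/-! ### The Poincaré inequality on a box -/

section Box

variable {d : ℕ}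

/-- Telescoping from `s` to `t` and Cauchy–Schwarz. The condition on `r + 1` discards the increment
that leaves the interval. -/
theorem sq_sub_le_card_mul_sum_int (g : ℤ → ℝ) (a : ℤ) (m : ℕ) {s t : ℤ}
    (hs : s ∈ Finset.Ico a (a + m)) (ht : t ∈ Finset.Ico a (a + m)) :
    (g s - g t) ^ 2 ≤ m * ∑ r ∈ Finset.Ico a (a + m),
      if r + 1 ∈ Finset.Ico a (a + m) then (g (r + 1) - g r) ^ 2 else 0 := by
  wlog hst : s ≤ t generalizing s t
  · have := this ht hs (le_of_not_ge hst)
    rwa [sub_sq_comm] at this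
  rw [Finset.mem_Ico] at hs ht
  have tel : ∀ t, s ≤ t → g t - g s = ∑ r ∈ Finset.Ico s t, (g (r + 1) - g r) := by
    intro t h
    induction t, h using Int.leInduction with
    | base => simp
    | succ k hk ih =>
      rw [← Finset.insert_Ico_right_eq_Ico_add_one hk, Finset.sum_insert (by simp), ← ih]; ring
  rw [sub_sq_comm, tel t hst]
  refine sq_sum_le_card_mul_sum_sq.trans ?_
  have hcard : ((Finset.Ico s t).card : ℝ) ≤ m := by
    rw [Int.card_Ico]
    exact_mod_cast (show (t - s).toNat ≤ m by omega)
  refine mul_le_mul hcard ?_ (Finset.sum_nonneg fun _ _ => sq_nonneg _) (Nat.cast_nonneg _)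
  rw [← Finset.sum_filter]
  refine Finset.sum_le_sum_of_subset_of_nonneg (fun r hr => ?_) fun _ _ _ => sq_nonneg _
  simp only [Finset.mem_filter, Finset.mem_Ico] at hr ⊢
  omega

/-- The box of side `m` with lower corner `lo`. -/
def latticeBox (lo : Fin d → ℤ) (m : ℕ) : Finset (Fin d → ℤ) :=
  Fintype.piFinset fun i => Finset.Ico (lo i) (lo i + m)

theorem mem_latticeBox {lo : Fin d → ℤ} {m : ℕ} {x : Fin d → ℤ} :
    x ∈ latticeBox lo m ↔ ∀ i, x i ∈ Finset.Ico (lo i) (lo i + m) := Fintype.mem_piFinset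

theorem update_mem_latticeBox {lo : Fin d → ℤ} {m : ℕ} {x : Fin d → ℤ}
    (hx : x ∈ latticeBox lo m) {j : Fin d} {r : ℤ} (hr : r ∈ Finset.Ico (lo j) (lo j + m)) :
    Function.update x j r ∈ latticeBox lo m := by
  rw [mem_latticeBox] at hx ⊢
  intro i
  by_cases h : i = j
  · subst h; simpa using hr
  · simpa [h] using hx i

/-- Exchanging the coordinate `x j` with `r` is an involution of the product of the box with its
side. -/
theorem sum_update_latticeBox (lo : Fin d → ℤ) (m : ℕ) (j : Fin d) (G : (Fin d → ℤ) → ℝ) :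
    ∑ x ∈ latticeBox lo m, ∑ r ∈ Finset.Ico (lo j) (lo j + m), G (Function.update x j r) =
      m * ∑ x ∈ latticeBox lo m, G x := by
  have e : ∑ p ∈ latticeBox lo m ×ˢ Finset.Ico (lo j) (lo j + m), G (Function.update p.1 j p.2) =
      ∑ p ∈ latticeBox lo m ×ˢ Finset.Ico (lo j) (lo j + m), G p.1 := by
    refine Finset.sum_nbij' (fun p => (Function.update p.1 j p.2, p.1 j))
      (fun p => (Function.update p.1 j p.2, p.1 j)) ?_ ?_ ?_ ?_ ?_
    · intro p hp
      rw [Finset.mem_product] at hp ⊢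
      exact ⟨update_mem_latticeBox hp.1 hp.2, mem_latticeBox.1 hp.1 j⟩
    · intro p hp
      rw [Finset.mem_product] at hp ⊢
      exact ⟨update_mem_latticeBox hp.1 hp.2, mem_latticeBox.1 hp.1 j⟩
    · intro p _; simp
    · intro p _; simp
    · intro p _; rfl
  rw [Finset.sum_product] at e
  rw [e, Finset.sum_product, Finset.mul_sum]
  refine Finset.sum_congr rfl fun x _ => ?_
  simp

/-- The Dirichlet form of the box in direction `j`. -/
def boxDirichlet (lo : Fin d → ℤ) (m : ℕ) (g : (Fin d → ℤ) → ℝ) (j : Fin d) : ℝ :=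
  ∑ x ∈ latticeBox lo m,
    if x + Pi.single j 1 ∈ latticeBox lo m then (g (x + Pi.single j 1) - g x) ^ 2 else 0

theorem update_add_single (x : Fin d → ℤ) (j : Fin d) (r : ℤ) :
    Function.update x j r + Pi.single j 1 = Function.update x j (r + 1) := by
  ext i
  by_cases h : i = j
  · subst h; simp
  · simp [h]

theorem sum_sq_sub_update_le (lo : Fin d → ℤ) (m : ℕ) (g : (Fin d → ℤ) → ℝ) (j : Fin d) :
    ∑ x ∈ latticeBox lo m, ∑ y ∈ latticeBox lo m, (g x - g (Function.update x j (y j))) ^ 2 ≤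
      (latticeBox lo m).card * (m ^ 2 * boxDirichlet lo m g j) := by
  obtain ⟨F, hF⟩ : ∃ F : (Fin d → ℤ) → ℝ, ∀ z, F z =
      if z + Pi.single j 1 ∈ latticeBox lo m then (g (z + Pi.single j 1) - g z) ^ 2 else 0 :=
    ⟨_, fun _ => rfl⟩
  have hB : boxDirichlet lo m g j = ∑ x ∈ latticeBox lo m, F x :=
    Finset.sum_congr rfl fun x _ => (hF x).symm
  have h1 : ∀ x ∈ latticeBox lo m, ∀ y ∈ latticeBox lo m,
      (g x - g (Function.update x j (y j))) ^ 2 ≤ m * ∑ r ∈ Finset.Ico (lo j) (lo j + m),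
        F (Function.update x j r) := by
    intro x hx y hy
    have := sq_sub_le_card_mul_sum_int (fun r => g (Function.update x j r)) (lo j) m
      (mem_latticeBox.1 hx j) (mem_latticeBox.1 hy j)
    simp only [Function.update_eq_self] at this
    refine this.trans (mul_le_mul_of_nonneg_left (Finset.sum_le_sum fun r hr => ?_)
      (Nat.cast_nonneg m))
    rw [hF, update_add_single]
    by_cases h2 : r + 1 ∈ Finset.Ico (lo j) (lo j + m)
    · rw [if_pos h2, if_pos (update_mem_latticeBox hx h2)]
    · rw [if_neg h2]; split_ifs <;> positivity
  calc _ ≤ ∑ x ∈ latticeBox lo m, ∑ y ∈ latticeBox lo m, m * ∑ r ∈ Finset.Ico (lo j) (lo j + m),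
        F (Function.update x j r) :=
        Finset.sum_le_sum fun x hx => Finset.sum_le_sum fun y hy => h1 x hx y hy
    _ = (latticeBox lo m).card * (m * ∑ x ∈ latticeBox lo m,
        ∑ r ∈ Finset.Ico (lo j) (lo j + m), F (Function.update x j r)) := by
        simp only [Finset.sum_const, nsmul_eq_mul, Finset.mul_sum]
    _ = _ := by rw [sum_update_latticeBox lo m j F, hB]; ring

/-- The coordinates of `x` are replaced by those of `y` one at a time, and `(a + b)² ≤ 2a² + 2b²`
doubles the constant at each replacement. Swapping the coordinates in `T` between `x` and `y`
permutes the pairs, so each replacement costs as much as changing a single coordinate of `x`. -/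
theorem sum_sq_sub_piecewise_le (lo : Fin d → ℤ) (m : ℕ) (g : (Fin d → ℤ) → ℝ)
    (T : Finset (Fin d)) :
    ∑ x ∈ latticeBox lo m, ∑ y ∈ latticeBox lo m, (g x - g (T.piecewise y x)) ^ 2 ≤
      2 ^ T.card * ∑ j ∈ T, (latticeBox lo m).card * (m ^ 2 * boxDirichlet lo m g j) := by
  have hD : ∀ j, 0 ≤ boxDirichlet lo m g j := fun j =>
    Finset.sum_nonneg fun x _ => by split_ifs <;> positivity
  induction T using Finset.induction_on with
  | empty => simp
  | insert j T hj ih =>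
    have key : ∑ x ∈ latticeBox lo m, ∑ y ∈ latticeBox lo m,
        (g (T.piecewise y x) - g (Function.update (T.piecewise y x) j (y j))) ^ 2 =
        ∑ x ∈ latticeBox lo m, ∑ y ∈ latticeBox lo m,
          (g x - g (Function.update x j (y j))) ^ 2 := by
      have pm : ∀ x ∈ latticeBox lo m, ∀ y ∈ latticeBox lo m,
          T.piecewise y x ∈ latticeBox lo m := by
        intro x hx y hy
        rw [mem_latticeBox] at *
        intro i
        by_cases h : i ∈ T <;> simp only [Finset.piecewise, h, if_true, if_false]
        exacts [hy i, hx i]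
      rw [← Finset.sum_product', ← Finset.sum_product']
      refine Finset.sum_nbij' (fun p => (T.piecewise p.2 p.1, T.piecewise p.1 p.2))
        (fun p => (T.piecewise p.2 p.1, T.piecewise p.1 p.2)) ?_ ?_ ?_ ?_ ?_
      · intro p hp
        rw [Finset.mem_product] at hp ⊢
        exact ⟨pm _ hp.1 _ hp.2, pm _ hp.2 _ hp.1⟩
      · intro p hp
        rw [Finset.mem_product] at hp ⊢
        exact ⟨pm _ hp.1 _ hp.2, pm _ hp.2 _ hp.1⟩
      · intro p _
        ext i <;> by_cases h : i ∈ T <;> simp [h]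
      · intro p _
        ext i <;> by_cases h : i ∈ T <;> simp [h]
      · intro p _
        simp [hj]
    calc _ ≤ ∑ x ∈ latticeBox lo m, ∑ y ∈ latticeBox lo m, (2 * (g x - g (T.piecewise y x)) ^ 2 +
          2 * (g (T.piecewise y x) - g (Function.update (T.piecewise y x) j (y j))) ^ 2) := by
          refine Finset.sum_le_sum fun x _ => Finset.sum_le_sum fun y _ => ?_
          rw [Finset.piecewise_insert]
          nlinarith [sq_nonneg ((g x - g (T.piecewise y x)) - (g (T.piecewise y x) -
            g (Function.update (T.piecewise y x) j (y j))))]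
      _ = 2 * ∑ x ∈ latticeBox lo m, ∑ y ∈ latticeBox lo m, (g x - g (T.piecewise y x)) ^ 2 +
          2 * ∑ x ∈ latticeBox lo m, ∑ y ∈ latticeBox lo m,
            (g x - g (Function.update x j (y j))) ^ 2 := by
          rw [← key]; simp only [Finset.sum_add_distrib, Finset.mul_sum]
      _ ≤ 2 * (2 ^ T.card * ∑ j ∈ T, (latticeBox lo m).card * (m ^ 2 * boxDirichlet lo m g j)) +
          2 * (2 ^ T.card * ((latticeBox lo m).card * (m ^ 2 * boxDirichlet lo m g j))) := by
          gcongr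
          refine (sum_sq_sub_update_le lo m g j).trans ?_
          have := hD j
          exact le_mul_of_one_le_left (by positivity) (one_le_pow₀ (by norm_num))
      _ = _ := by rw [Finset.card_insert_of_notMem hj, Finset.sum_insert hj]; ring

/-- The Poincaré inequality for the uniform distribution on a box. -/
theorem poincare_latticeBox (lo : Fin d → ℤ) {m : ℕ} (hm : 1 ≤ m) (g : (Fin d → ℤ) → ℝ) :
    ∃ a : ℝ, a * (latticeBox lo m).card = ∑ x ∈ latticeBox lo m, g x ∧
      ∑ x ∈ latticeBox lo m, (g x - a) ^ 2 ≤ 2 ^ d * m ^ 2 * ∑ j, boxDirichlet lo m g j := by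
  obtain ⟨N, hN⟩ : ∃ N : ℝ, N = (latticeBox lo m).card := ⟨_, rfl⟩
  have hNpos : 0 < N := by
    rw [hN, Nat.cast_pos, Finset.card_pos]
    exact ⟨lo, mem_latticeBox.2 fun i => by rw [Finset.mem_Ico]; omega⟩
  refine ⟨(∑ x ∈ latticeBox lo m, g x) / N, by rw [← hN]; field_simp, ?_⟩
  -- With `a` the mean of `g`, Cauchy–Schwarz bounds the squared deviation by the average of `(g x -
  -- g y)²` over `y`.
  have h1 : ∀ x, (g x - (∑ x ∈ latticeBox lo m, g x) / N) ^ 2 ≤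
      (∑ y ∈ latticeBox lo m, (g x - g y) ^ 2) / N := by
    intro x
    have e : g x - (∑ x ∈ latticeBox lo m, g x) / N =
        (∑ y ∈ latticeBox lo m, (g x - g y)) / N := by
      rw [Finset.sum_sub_distrib, Finset.sum_const, nsmul_eq_mul, ← hN]; field_simp
    rw [e, div_pow, div_le_div_iff₀ (by positivity) hNpos]
    have := sq_sum_le_card_mul_sum_sq (s := latticeBox lo m) (f := fun y => g x - g y)
    rw [← hN] at this
    nlinarith
  have h2 := sum_sq_sub_piecewise_le lo m g Finset.univ
  simp only [Finset.piecewise_univ, Finset.card_univ, Fintype.card_fin, ← Finset.mul_sum, ← hN]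
    at h2
  calc _ ≤ ∑ x ∈ latticeBox lo m, (∑ y ∈ latticeBox lo m, (g x - g y) ^ 2) / N :=
        Finset.sum_le_sum fun x _ => h1 x
    _ = (∑ x ∈ latticeBox lo m, ∑ y ∈ latticeBox lo m, (g x - g y) ^ 2) / N := by
        rw [Finset.sum_div]
    _ ≤ (2 ^ d * (N * (m ^ 2 * ∑ j, boxDirichlet lo m g j))) / N := by gcongr
    _ = _ := by field_simp

end Box

end

noncomputable section

/-! ### Comparison of quadratic forms, lattice point counts and exponential tails. -/

section Comparison

variable {d : ℕ} {Θ : Matrix (Fin d) (Fin d) ℝ}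

theorem exists_sum_sq_le_qform (hΘ : Θ.PosDef) :
    ∃ B : ℝ, 0 < B ∧ ∀ v : Fin d → ℝ, ∑ i, v i ^ 2 ≤ B * qform Θ v := by
  refine ⟨∑ i, qform Θ (Θ⁻¹.mulVec (Pi.single i 1)) + 1, ?_, fun v => ?_⟩
  · have : 0 ≤ ∑ i, qform Θ (Θ⁻¹.mulVec (Pi.single i 1)) :=
      Finset.sum_nonneg fun i _ => qform_nonneg hΘ _
    positivity
  rw [add_mul, Finset.sum_mul, one_mul]
  refine le_add_of_le_of_nonneg (Finset.sum_le_sum fun i _ => ?_) (qform_nonneg hΘ v)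
  have h := bform_sq_le hΘ (Θ⁻¹.mulVec (Pi.single i 1)) v
  rw [← dotProduct_eq_bform hΘ] at h
  simpa using h

theorem exists_qform_le_sum_sq (Θ : Matrix (Fin d) (Fin d) ℝ) :
    ∃ M : ℝ, 0 < M ∧ ∀ v : Fin d → ℝ, qform Θ v ≤ M * ∑ i, v i ^ 2 := by
  refine ⟨∑ i, ∑ j, |Θ i j| + 1, ?_, fun v => ?_⟩
  · have : 0 ≤ ∑ i, ∑ j, |Θ i j| := Finset.sum_nonneg fun i _ => Finset.sum_nonneg fun j _ =>
      abs_nonneg _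
    positivity
  have h0 : 0 ≤ ∑ i, v i ^ 2 := Finset.sum_nonneg fun i _ => sq_nonneg _
  have hi : ∀ i, v i ^ 2 ≤ ∑ i, v i ^ 2 := fun i =>
    Finset.single_le_sum (f := fun i => v i ^ 2) (fun i _ => sq_nonneg _) (Finset.mem_univ i)
  rw [add_mul, one_mul]
  refine le_add_of_le_of_nonneg ?_ h0
  have e : qform Θ v = ∑ i, ∑ j, v i * (Θ i j * v j) := by
    simp only [qform, bform, dotProduct, Matrix.mulVec, Finset.mul_sum]
  rw [e, Finset.sum_mul]
  refine Finset.sum_le_sum fun i _ => ?_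
  rw [Finset.sum_mul]
  refine Finset.sum_le_sum fun j _ => ?_
  calc v i * (Θ i j * v j) ≤ |v i * (Θ i j * v j)| := le_abs_self _
    _ = |Θ i j| * (|v i| * |v j|) := by rw [abs_mul, abs_mul]; ring
    _ ≤ |Θ i j| * ∑ i, v i ^ 2 := by
      gcongr
      have := two_mul_le_add_sq |v i| |v j|
      rw [sq_abs, sq_abs] at this
      nlinarith [hi i, hi j]

/-- Converts the terms `(Θ y)_i²` supplied by the Hardy inequality into the squared distance from
the centre. -/
theorem qform_le_mul_sum_mulVec_sq (hΘ : Θ.PosDef) {B : ℝ}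
    (hB : ∀ v : Fin d → ℝ, ∑ i, v i ^ 2 ≤ B * qform Θ v) (v : Fin d → ℝ) :
    qform Θ v ≤ B * ∑ i, Θ.mulVec v i ^ 2 := by
  have h1 : qform Θ v ^ 2 ≤ (∑ i, v i ^ 2) * ∑ i, Θ.mulVec v i ^ 2 := by
    simpa only [qform, bform, dotProduct] using
      Finset.sum_mul_sq_le_sq_mul_sq Finset.univ v (Θ.mulVec v)
  have h2 : 0 ≤ ∑ i, Θ.mulVec v i ^ 2 := Finset.sum_nonneg fun i _ => sq_nonneg _
  by_cases hv : v = 0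
  · subst hv; simp [qform, bform]
  have h3 := qform_pos hΘ hv
  have h4 := mul_le_mul_of_nonneg_right (hB v) h2
  nlinarith

theorem exists_card_le (hΘ : Θ.PosDef) (c : Fin d → ℝ) {R : ℝ} (hR : 0 ≤ R) :
    ∃ C : ℝ, 0 < C ∧ ∀ n : ℕ, 1 ≤ n → ∀ S : Finset (Fin d → ℤ),
      (∀ X ∈ S, qform Θ (devVec c n X) ≤ (n * R) ^ 2) → (S.card : ℝ) ≤ C * n ^ d := by
  obtain ⟨B, hB0, hB⟩ := exists_sum_sq_le_qform hΘ
  refine ⟨(2 * (√B * R) + 1) ^ d, by positivity, fun n hn S hS => ?_⟩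
  have hn' : (1 : ℝ) ≤ n := by exact_mod_cast hn
  set r := n * (√B * R) with hr
  have hr0 : 0 ≤ r := by positivity
  have hsub : S ⊆ Fintype.piFinset fun i => Finset.Icc ⌈n * c i - r⌉ ⌊n * c i + r⌋ := by
    intro X hX
    rw [Fintype.mem_piFinset]
    intro i
    have h1 : devVec c n X i ^ 2 ≤ r ^ 2 := by
      calc devVec c n X i ^ 2 ≤ ∑ i, devVec c n X i ^ 2 :=
            Finset.single_le_sum (f := fun i => devVec c n X i ^ 2) (fun i _ => sq_nonneg _)
              (Finset.mem_univ i)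
        _ ≤ B * qform Θ (devVec c n X) := hB _
        _ ≤ B * (n * R) ^ 2 := by gcongr; exact hS X hX
        _ = √B ^ 2 * (n * R) ^ 2 := by rw [Real.sq_sqrt hB0.le]
        _ = r ^ 2 := by rw [hr]; ring
    have h2 := abs_le.1 (abs_le_of_sq_le_sq h1 hr0)
    simp only [devVec] at h2
    rw [Finset.mem_Icc]
    exact ⟨Int.ceil_le.2 (by linarith), Int.le_floor.2 (by linarith)⟩
  have hcard : ∀ i, ((Finset.Icc ⌈n * c i - r⌉ ⌊n * c i + r⌋).card : ℝ) ≤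
      (2 * (√B * R) + 1) * n := by
    intro i
    rw [Int.card_Icc]
    have h1 := Int.le_ceil (n * c i - r)
    have h2 := Int.floor_le (n * c i + r)
    have h3 : (((⌊n * c i + r⌋ + 1 - ⌈n * c i - r⌉).toNat : ℤ) : ℝ) ≤ 2 * r + 1 := by
      rw [Int.toNat_eq_max, Int.cast_max]
      refine max_le ?_ (by push_cast; positivity)
      push_cast; linarith
    rw [Int.cast_natCast] at h3
    rw [hr] at h3
    nlinarith
  calc (S.card : ℝ) ≤ (Fintype.piFinset fun i => Finset.Icc ⌈n * c i - r⌉ ⌊n * c i + r⌋).card := by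
        exact_mod_cast Finset.card_le_card hsub
    _ = ∏ i, ((Finset.Icc ⌈n * c i - r⌉ ⌊n * c i + r⌋).card : ℝ) := by
        rw [Fintype.card_piFinset]; push_cast; rfl
    _ ≤ ∏ i : Fin d, ((2 * (√B * R) + 1) * n) :=
        Finset.prod_le_prod (fun i _ => by positivity) fun i _ => hcard i
    _ = _ := by simp [mul_pow]

theorem exists_pow_mul_exp_neg_le {b : ℝ} (hb : 0 < b) (k : ℕ) :
    ∃ C : ℝ, 0 < C ∧ ∀ n : ℕ, (n : ℝ) ^ k * Real.exp (-(b * n)) ≤ C := by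
  refine ⟨(k.factorial : ℝ) / b ^ k, by positivity, fun n => ?_⟩
  have h := Real.pow_div_factorial_le_exp (b * n) (by positivity) k
  rw [Real.exp_neg, le_div_iff₀ (by positivity), ← div_eq_mul_inv, div_mul_eq_mul_div,
    div_le_iff₀ (Real.exp_pos _)]
  rw [div_le_iff₀ (by positivity), mul_pow] at h
  linarith

theorem gaussWeight_le_one (hΘ : Θ.PosDef) (c : Fin d → ℝ) (n : ℕ) (X : Fin d → ℤ) :
    gaussWeight Θ c n X ≤ 1 :=
  Real.exp_le_one_iff.2 (neg_nonpos.2 (div_nonneg (qform_nonneg hΘ _) (by positivity)))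

theorem exists_sqrt_qform_single_le (Θ : Matrix (Fin d) (Fin d) ℝ) : ∃ D : ℝ, 0 ≤ D ∧ ∀ i : Fin d,
    √(qform Θ (realVec (Pi.single i 1))) ≤ D :=
  ⟨∑ i : Fin d, √(qform Θ (realVec (Pi.single i 1))),
    Finset.sum_nonneg fun _ _ => Real.sqrt_nonneg _, fun i =>
    Finset.single_le_sum (f := fun i : Fin d => √(qform Θ (realVec (Pi.single i 1))))
      (fun _ _ => Real.sqrt_nonneg _) (Finset.mem_univ i)⟩

theorem sqrt_qform_devVec_le_of_add (hΘ : Θ.PosDef) (c : Fin d → ℝ) (n : ℕ)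
    (X a : Fin d → ℤ) :
    √(qform Θ (devVec c n X)) ≤ √(qform Θ (devVec c n (X + a))) + √(qform Θ (realVec a)) := by
  have h := sqrt_qform_add_le hΘ (devVec c n (X + a)) (-realVec a)
  rwa [qform_neg, devVec_add, add_neg_cancel_right, ← devVec_add] at h

theorem sqrt_qform_devVec_add_le (hΘ : Θ.PosDef) (c : Fin d → ℝ) (n : ℕ)
    (X a : Fin d → ℤ) :
    √(qform Θ (devVec c n (X + a))) ≤ √(qform Θ (devVec c n X)) + √(qform Θ (realVec a)) := by
  rw [devVec_add]; exact sqrt_qform_add_le hΘ _ _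

theorem qform_le_sq_iff (v : Fin d → ℝ) {r : ℝ} (hr : 0 ≤ r) :
    qform Θ v ≤ r ^ 2 ↔ √(qform Θ v) ≤ r := by
  rw [Real.sqrt_le_left hr]

end Comparison

/-! ### The Poincaré inequality for the discrete Gaussian weight -/

section Poincare

variable {d : ℕ} {Θ : Matrix (Fin d) (Fin d) ℝ}

/-- Truncating `g - a` to a ball costs only an exponentially small boundary term. -/
theorem exists_dirichlet_truncation_le (hΘ : Θ.PosDef) (c : Fin d → ℝ) {δ : ℝ} (hδ : 0 < δ) :
    ∃ C : ℝ, 0 < C ∧ ∃ N : ℕ, 1 ≤ N ∧ ∀ n : ℕ, N ≤ n → ∀ S : Finset (Fin d → ℤ),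
      (∀ X, X ∈ S ↔ qform Θ (devVec c n X) ≤ (n * δ) ^ 2) → ∀ g : (Fin d → ℤ) → ℝ,
      (∀ X, X ∉ S → g X = 0) → ∀ a : ℝ, ∀ h : (Fin d → ℤ) → ℝ,
      (∀ X ∈ S, h X = g X - a) → (∀ X, X ∉ S → h X = 0) → ∀ i : Fin d,
      ∑' X, √(gaussWeight Θ c n X) * √(gaussWeight Θ c n (X + Pi.single i 1)) *
        (h (X + Pi.single i 1) - h X) ^ 2 ≤
      C * ∑' X, gaussWeight Θ c n X * (g (X + Pi.single i 1) - g X) ^ 2 + a ^ 2 * C / n ^ 2 := by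
  obtain ⟨D, hD0, hD⟩ := exists_sqrt_qform_single_le Θ
  choose C₁ hC₁ hb₁ using fun i : Fin d =>
    gaussWeight_add_le hΘ c (show 0 ≤ δ + D by positivity) (Pi.single i 1)
  have hC₁s : ∀ i, C₁ i ≤ ∑ i, C₁ i := fun i =>
    Finset.single_le_sum (fun i _ => (hC₁ i).le) (Finset.mem_univ i)
  have hC₁0 : 0 ≤ ∑ i, C₁ i := Finset.sum_nonneg fun i _ => (hC₁ i).le
  set C' := 1 + ∑ i, C₁ i with hC'
  obtain ⟨Cc, hCc0, hCc⟩ := exists_card_le hΘ c hδ.le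
  -- The exponent `d` pays for the number of lattice points near the boundary, and the further 2
  -- leaves the factor `n⁻²`.
  obtain ⟨Ce, hCe0, hCe⟩ := exists_pow_mul_exp_neg_le (show 0 < δ ^ 2 / 8 by positivity) (d + 2)
  refine ⟨2 * C' + 4 * C' * Cc * Ce, by positivity, max 1 ⌈2 * D / δ⌉₊, le_max_left _ _,
    fun n hn S hS g hg a h hh hh0 i => ?_⟩
  have hn1 : 1 ≤ n := (le_max_left _ _).trans hn
  have hn' : (1 : ℝ) ≤ n := by exact_mod_cast hn1
  have hnD : D ≤ n * δ / 2 := by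
    have h1 : (⌈2 * D / δ⌉₊ : ℝ) ≤ n := by exact_mod_cast (le_max_right _ _).trans hn
    have h2 := (Nat.le_ceil (2 * D / δ)).trans h1
    rw [div_le_iff₀ hδ] at h2
    linarith
  set e : Fin d → ℤ := Pi.single i 1 with he
  set ν := gaussWeight Θ c n with hν
  have hνp : ∀ X, 0 < ν X := gaussWeight_pos c n
  set E := Real.exp (-(δ ^ 2 / 8 * n)) with hE
  have hE0 : 0 < E := Real.exp_pos _
  set T : Finset (Fin d → ℤ) := S ∪ S.image fun X => X - e with hT
  have hTmem : ∀ X, X ∈ T ↔ X ∈ S ∨ X + e ∈ S := by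
    intro X
    simp only [hT, Finset.mem_union, Finset.mem_image]
    refine or_congr Iff.rfl ⟨?_, fun hX => ⟨X + e, hX, by simp⟩⟩
    rintro ⟨Z, hZ, rfl⟩
    simpa using hZ
  have hTcard : (T.card : ℝ) ≤ 2 * (Cc * n ^ d) := by
    have h1 : T.card ≤ S.card + S.card :=
      (Finset.card_union_le _ _).trans (add_le_add le_rfl Finset.card_image_le)
    have h2 := hCc n hn1 S fun X hX => (hS X).1 hX
    have h3 : (T.card : ℝ) ≤ S.card + S.card := by exact_mod_cast h1
    linarith
  have gfin : g.support.Finite := S.finite_toSet.subset fun X hX => by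
    by_contra h'; exact hX (hg X h')
  have hfin : h.support.Finite := S.finite_toSet.subset fun X hX => by
    by_contra h'; exact hX (hh0 X h')
  have s1 : Summable fun X => √(ν X) * √(ν (X + e)) * (h (X + e) - h X) ^ 2 :=
    summable_of_hasFiniteSupport <| (finite_support_diff hfin e).subset fun X hX => by
      simp only [Function.mem_support, ne_eq, mul_eq_zero, not_or, pow_eq_zero_iff two_ne_zero]
        at hX ⊢; exact hX.2
  have s2 : Summable fun X => 2 * C' * (ν X * (g (X + e) - g X) ^ 2) :=
    summable_of_hasFiniteSupport <| (finite_support_diff gfin e).subset fun X hX => by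
      simp only [Function.mem_support, ne_eq, mul_eq_zero, not_or, pow_eq_zero_iff two_ne_zero]
        at hX ⊢; exact hX.2.2
  have s3 : Summable fun X => if X ∈ T then 2 * a ^ 2 * C' * E else 0 :=
    summable_of_hasFiniteSupport <| T.finite_toSet.subset fun X hX => by
      by_contra h'; exact hX (if_neg h')
  -- If both ends lie in `S`, the increments of `h` and `g` agree; if neither does, the left side
  -- vanishes. If exactly one does, the truncation adds a jump of height `|a|`, but then `X` is at
  -- distance at least `nδ/2` from the centre, where `ν ≤ E`.
  have hpt : ∀ X, √(ν X) * √(ν (X + e)) * (h (X + e) - h X) ^ 2 ≤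
      2 * C' * (ν X * (g (X + e) - g X) ^ 2) + if X ∈ T then 2 * a ^ 2 * C' * E else 0 := by
    intro X
    by_cases hX : X ∈ T
    swap
    · have hX' := hX
      rw [hTmem, not_or] at hX'
      rw [hh0 _ hX'.1, hh0 _ hX'.2, if_neg hX]
      have := (hνp X).le
      have : 0 ≤ C' := by positivity
      simp only [sub_self, ne_eq, OfNat.ofNat_ne_zero, not_false_eq_true, zero_pow, mul_zero,
        add_zero]
      positivity
    rw [if_pos hX]
    have hXq : √(qform Θ (devVec c n X)) ≤ n * δ + D := by
      rcases (hTmem X).1 hX with h1 | h1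
      · have := (qform_le_sq_iff _ (by positivity)).1 ((hS _).1 h1)
        linarith
      · have := (qform_le_sq_iff _ (by positivity)).1 ((hS _).1 h1)
        have h2 := sqrt_qform_devVec_le_of_add hΘ c n X e
        linarith [hD i]
    have hXr : qform Θ (devVec c n X) ≤ (n * (δ + D)) ^ 2 := by
      rw [qform_le_sq_iff _ (by positivity)]
      nlinarith
    have hρ : √(ν X) * √(ν (X + e)) ≤ C' * ν X := by
      have h1 := hb₁ i n hn1 X hXr
      have h2 := two_mul_le_add_sq (√(ν X)) (√(ν (X + e)))
      rw [Real.sq_sqrt (hνp _).le, Real.sq_sqrt (hνp _).le] at h2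
      have h3 := mul_le_mul_of_nonneg_right (hC₁s i) (hνp X).le
      change ν (X + e) ≤ C₁ i * ν X at h1
      rw [hC']
      nlinarith [(hνp X).le]
    have hC'0 : 0 ≤ C' := by positivity
    by_cases hboth : X ∈ S ∧ X + e ∈ S
    · rw [hh _ hboth.1, hh _ hboth.2, sub_sub_sub_cancel_right]
      have h1 : 0 ≤ 2 * a ^ 2 * C' * E := by positivity
      have h2 : 0 ≤ C' * ν X * (g (X + e) - g X) ^ 2 := by
        have := (hνp X).le; positivity
      have h3 := mul_le_mul_of_nonneg_right hρ (sq_nonneg (g (X + e) - g X))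
      linarith
    · have hsq : (h (X + e) - h X) ^ 2 ≤ 2 * (g (X + e) - g X) ^ 2 + 2 * a ^ 2 := by
        rcases (hTmem X).1 hX with h1 | h1
        · have h2 : X + e ∉ S := fun h2 => hboth ⟨h1, h2⟩
          rw [hh _ h1, hh0 _ h2, hg _ h2]
          nlinarith [sq_nonneg (g X + a)]
        · have h2 : X ∉ S := fun h2 => hboth ⟨h2, h1⟩
          rw [hh _ h1, hh0 _ h2, hg _ h2]
          nlinarith [sq_nonneg (g (X + e) + a)]
      have hlow : n * δ / 2 ≤ √(qform Θ (devVec c n X)) := by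
        by_cases h1 : X ∈ S
        · have h2 : X + e ∉ S := fun h2 => hboth ⟨h1, h2⟩
          rw [hS, qform_le_sq_iff _ (by positivity), not_le] at h2
          have h3 := sqrt_qform_devVec_add_le hΘ c n X e
          linarith [hD i]
        · rw [hS, qform_le_sq_iff _ (by positivity), not_le] at h1
          have : 0 ≤ n * δ := by positivity
          linarith
      have hνE : ν X ≤ E := by
        rw [hν, gaussWeight, hE]
        gcongr
        rw [le_div_iff₀ (by positivity)]
        have h1 := pow_le_pow_left₀ (by positivity) hlow 2
        rw [Real.sq_sqrt (qform_nonneg hΘ _)] at h1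
        nlinarith
      have hC'ν : 0 ≤ C' * ν X := mul_nonneg hC'0 (hνp X).le
      calc _ ≤ C' * ν X * (2 * (g (X + e) - g X) ^ 2 + 2 * a ^ 2) := by gcongr
        _ = 2 * C' * (ν X * (g (X + e) - g X) ^ 2) + 2 * a ^ 2 * C' * ν X := by ring
        _ ≤ _ := by gcongr
  have hE2 : (n : ℝ) ^ d * E ≤ Ce / n ^ 2 := by
    rw [le_div_iff₀ (by positivity)]
    have := hCe n
    rw [pow_add] at this
    linarith
  have hI0 : 0 ≤ ∑' X, ν X * (g (X + e) - g X) ^ 2 :=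
    tsum_nonneg fun X => mul_nonneg (hνp X).le (sq_nonneg _)
  calc _ ≤ ∑' X, (2 * C' * (ν X * (g (X + e) - g X) ^ 2) +
          if X ∈ T then 2 * a ^ 2 * C' * E else 0) := Summable.tsum_le_tsum hpt s1 (s2.add s3)
    _ = 2 * C' * ∑' X, ν X * (g (X + e) - g X) ^ 2 + T.card * (2 * a ^ 2 * C' * E) := by
        rw [Summable.tsum_add s2 s3, tsum_mul_left,
          tsum_eq_sum (s := T) fun X hX => if_neg hX]
        congr 1
        rw [Finset.sum_congr rfl fun X hX => if_pos hX]
        simp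
    _ ≤ 2 * C' * ∑' X, ν X * (g (X + e) - g X) ^ 2 +
          (2 * (Cc * n ^ d)) * (2 * a ^ 2 * C' * E) := by gcongr
    _ = 2 * C' * ∑' X, ν X * (g (X + e) - g X) ^ 2 + a ^ 2 * (4 * C' * Cc) * (n ^ d * E) := by
        ring
    _ ≤ 2 * C' * ∑' X, ν X * (g (X + e) - g X) ^ 2 + a ^ 2 * (4 * C' * Cc) * (Ce / n ^ 2) := by
        gcongr
    _ ≤ _ := by
        rw [add_mul]
        have h1 : 0 ≤ 4 * C' * Cc * Ce * ∑' X, ν X * (g (X + e) - g X) ^ 2 := by positivity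
        have h2 : 0 ≤ a ^ 2 * (2 * C') / (n : ℝ) ^ 2 := by positivity
        have h3 : a ^ 2 * (2 * C' + 4 * C' * Cc * Ce) / (n : ℝ) ^ 2 =
            a ^ 2 * (2 * C') / (n : ℝ) ^ 2 + a ^ 2 * (4 * C' * Cc) * (Ce / n ^ 2) := by ring
        linarith

-- The constant has order `n`, as for a Gaussian of variance of order `n`. In a box of side of order
-- `√(L n)` the weight is bounded below, so the uniform Poincaré inequality costs the square of the
-- side. Outside the box `|Θ y|²` is at least of order `L n`, and the Hardy inequality bounds the
-- mass by `n` times the energy plus a fraction of the whole sum; for large `L` this fraction is at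
-- most a half and is absorbed. The `1/n²` comes from cutting `g - a` off at the boundary of `S`.
set_option maxHeartbeats 1000000 in
theorem poincare_gaussWeight (hΘ : Θ.PosDef) (c : Fin d → ℝ) {δ : ℝ} (hδ : 0 < δ) :
    ∃ C : ℝ, 0 < C ∧ ∃ N : ℕ, 1 ≤ N ∧ ∀ n : ℕ, N ≤ n → ∀ S : Finset (Fin d → ℤ),
      (∀ X, X ∈ S ↔ qform Θ (devVec c n X) ≤ (n * δ) ^ 2) → ∀ g : (Fin d → ℤ) → ℝ,
      (∀ X, 0 ≤ g X) → (∀ X, X ∉ S → g X = 0) → ∑ X ∈ S, gaussWeight Θ c n X * g X ^ 2 ≤ 1 →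
      ∃ a : ℝ, 0 ≤ a ∧ ∑ X ∈ S, gaussWeight Θ c n X * (g X - a) ^ 2 ≤
        C * n * (∑ i, ∑' X, gaussWeight Θ c n X * (g (X + Pi.single i 1) - g X) ^ 2 +
          1 / n ^ 2) := by
  obtain ⟨B, hB0, hB⟩ := exists_sum_sq_le_qform hΘ
  obtain ⟨M, hM0, hM⟩ := exists_qform_le_sum_sq Θ
  obtain ⟨Ct, hCt0, Nt, hNt1, hCt⟩ := exists_dirichlet_truncation_le hΘ c hδ
  have hΘii : ∀ i, 0 ≤ Θ i i := fun i => hΘ.diag_pos.le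
  set tr := ∑ i, Θ i i with htr
  have htr0 : 0 ≤ tr := Finset.sum_nonneg fun i _ => hΘii i
  -- Chosen so that the curvature terms `Θ_ii / (2n)` of the Hardy inequality return at most half of
  -- `H`.
  set L := 8 * B ^ 2 * tr + 1 with hL
  have hL0 : 0 < L := by positivity
  -- `Q n` bounds the quadratic form on the box, so `ν ≥ exp(-Q/2)` there.
  set Q := M * (d * (2 * L + 8)) with hQ
  have hQ0 : 0 ≤ Q := by positivity
  set eQ := Real.exp (Q / 2) with heQ
  have heQ0 : 0 < eQ := Real.exp_pos _
  -- In the threshold, `n ≥ tr` supplies the hypothesis of the Hardy inequality, and `n ≥ Q / δ²`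
  -- places the box inside the ball.
  refine ⟨2 * (2 ^ d * (4 * (2 * L + 8)) * eQ) + 16 * B ^ 2 / L * (Ct + d * (eQ * Ct)),
    by positivity, max Nt (max ⌈tr⌉₊ ⌈Q / δ ^ 2⌉₊), hNt1.trans (le_max_left _ _),
    fun n hn S hS g hg0 hgS hg1 => ?_⟩
  have hnt : Nt ≤ n := (le_max_left _ _).trans hn
  have hn1 : 1 ≤ n := hNt1.trans hnt
  have hn' : (1 : ℝ) ≤ n := by exact_mod_cast hn1
  have hntr : tr ≤ n := (Nat.le_ceil tr).trans
    (by exact_mod_cast (le_max_left _ _).trans ((le_max_right _ _).trans hn))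
  have hnQ : Q / δ ^ 2 ≤ n := (Nat.le_ceil _).trans
    (by exact_mod_cast (le_max_right _ _).trans ((le_max_right _ _).trans hn))
  rw [div_le_iff₀ (by positivity)] at hnQ
  set ν := gaussWeight Θ c n with hν
  have hνp : ∀ X, 0 < ν X := gaussWeight_pos c n
  set y := devVec c n with hy
  set k := ⌈√(L * n)⌉₊ with hk
  have hk1 : √(L * n) ≤ k := Nat.le_ceil _
  have hk2 : (k : ℝ) ≤ √(L * n) + 1 := (Nat.ceil_lt_add_one (Real.sqrt_nonneg _)).le
  have hsq : √(L * n) ^ 2 = L * n := Real.sq_sqrt (by positivity)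
  have hk3 : ((k : ℝ) + 1) ^ 2 ≤ (2 * L + 8) * n := by
    have : ((k : ℝ) + 1) ^ 2 ≤ (√(L * n) + 2) ^ 2 :=
      pow_le_pow_left₀ (by positivity) (by linarith) 2
    nlinarith [sq_nonneg (√(L * n) - 2)]
  have hk4 : L * n ≤ (k : ℝ) ^ 2 := by
    rw [← hsq]; exact pow_le_pow_left₀ (Real.sqrt_nonneg _) hk1 2
  set lo : Fin d → ℤ := fun i => ⌊n * c i⌋ - k with hlo
  set K := latticeBox lo (2 * k + 1) with hK
  have hKin : ∀ X ∈ K, qform Θ (y X) ≤ Q * n := by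
    intro X hX
    rw [mem_latticeBox] at hX
    have h1 : ∀ i, y X i ^ 2 ≤ ((k : ℝ) + 1) ^ 2 := by
      intro i
      have h2 := Finset.mem_Ico.1 (hX i)
      simp only [hlo] at h2
      have h3 : (⌊n * c i⌋ : ℝ) - k ≤ X i := by exact_mod_cast h2.1
      have h4 : (X i : ℝ) ≤ ⌊n * c i⌋ + k := by
        have : X i ≤ ⌊n * c i⌋ + k := by push_cast at h2; omega
        exact_mod_cast this
      have h5 := Int.floor_le (n * c i)
      have h6 := Int.lt_floor_add_one (n * c i)
      refine sq_le_sq' ?_ ?_ <;> simp only [hy, devVec] <;> linarith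
    calc qform Θ (y X) ≤ M * ∑ i, y X i ^ 2 := hM _
      _ ≤ M * ∑ i : Fin d, (2 * L + 8) * n := by
        gcongr with i; exact (h1 i).trans hk3
      _ = Q * n := by rw [hQ]; simp; ring
  have hKout : ∀ X, X ∉ K → L * n ≤ B ^ 2 * ∑ i, Θ.mulVec (y X) i ^ 2 := by
    intro X hX
    rw [mem_latticeBox, not_forall] at hX
    obtain ⟨i, hi⟩ := hX
    rw [Finset.mem_Ico, not_and_or, not_le, not_lt] at hi
    have h1 : (k : ℝ) ^ 2 ≤ y X i ^ 2 := by
      have h5 := Int.floor_le (n * c i)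
      have h6 := Int.lt_floor_add_one (n * c i)
      rcases hi with h2 | h2
      · have h3 : (X i : ℝ) < ⌊n * c i⌋ - k := by simp only [hlo] at h2; exact_mod_cast h2
        rw [← sq_abs (y X i)]
        refine pow_le_pow_left₀ (by positivity) (le_trans ?_ (neg_le_abs _)) 2
        simp only [hy, devVec]; linarith
      · have h3 : (⌊n * c i⌋ : ℝ) + k + 1 ≤ X i := by
          have : ⌊n * c i⌋ + k + 1 ≤ X i := by simp only [hlo] at h2; push_cast at h2; omega
          exact_mod_cast this
        refine pow_le_pow_left₀ (by positivity) ?_ 2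
        simp only [hy, devVec]; linarith
    calc L * n ≤ y X i ^ 2 := hk4.trans h1
      _ ≤ ∑ i, y X i ^ 2 := Finset.single_le_sum (f := fun i => y X i ^ 2)
          (fun i _ => sq_nonneg _) (Finset.mem_univ i)
      _ ≤ B * qform Θ (y X) := hB _
      _ ≤ B * (B * ∑ i, Θ.mulVec (y X) i ^ 2) := by
          gcongr; exact qform_le_mul_sum_mulVec_sq hΘ hB _
      _ = _ := by ring
  have hKS : K ⊆ S := fun X hX => by
    rw [hS]
    refine (hKin X hX).trans ?_
    nlinarith
  have hKν : ∀ X ∈ K, 1 ≤ eQ * ν X := by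
    intro X hX
    rw [heQ, hν, gaussWeight, ← Real.exp_add, Real.one_le_exp_iff]
    have h1 := hKin X hX
    have : qform Θ (devVec c n X) / (2 * n) ≤ Q / 2 := by
      rw [div_le_iff₀ (by positivity)]; linarith
    linarith
  obtain ⟨a, ha1, ha2⟩ := poincare_latticeBox lo (show 1 ≤ 2 * k + 1 by omega) g
  rw [← hK] at ha1 ha2
  have hcard : (1 : ℝ) ≤ K.card := by
    have : K.Nonempty := ⟨lo, mem_latticeBox.2 fun i => by rw [Finset.mem_Ico]; omega⟩
    exact_mod_cast this.card_pos
  have ha0 : 0 ≤ a := by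
    have h1 : 0 ≤ a * K.card := ha1 ▸ Finset.sum_nonneg fun X _ => hg0 X
    exact nonneg_of_mul_nonneg_left h1 (by linarith)
  -- `a` is the mean of `g` over the box, where `ν` is bounded below, so the normalisation of `g`
  -- bounds it. This makes the truncation error, which is proportional to `a²`, of order `n⁻²`.
  have haQ : a ^ 2 ≤ eQ := by
    have h1 : ∑ X ∈ K, g X ^ 2 ≤ eQ := by
      calc ∑ X ∈ K, g X ^ 2 ≤ ∑ X ∈ K, eQ * (ν X * g X ^ 2) := by
            refine Finset.sum_le_sum fun X hX => ?_
            rw [← mul_assoc]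
            exact le_mul_of_one_le_left (sq_nonneg _) (hKν X hX)
        _ = eQ * ∑ X ∈ K, ν X * g X ^ 2 := by rw [Finset.mul_sum]
        _ ≤ eQ * ∑ X ∈ S, ν X * g X ^ 2 := by
            refine mul_le_mul_of_nonneg_left ?_ heQ0.le
            exact Finset.sum_le_sum_of_subset_of_nonneg hKS fun X _ _ =>
              mul_nonneg (hνp X).le (sq_nonneg _)
        _ ≤ eQ * 1 := by gcongr
        _ = eQ := mul_one _
    have h2 : (∑ X ∈ K, g X) ^ 2 ≤ K.card * ∑ X ∈ K, g X ^ 2 := sq_sum_le_card_mul_sum_sq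
    rw [← ha1, mul_pow, sq (K.card : ℝ), mul_left_comm] at h2
    have h3 := le_of_mul_le_mul_left h2 (by linarith)
    exact (le_mul_of_one_le_right (sq_nonneg a) hcard).trans (h3.trans h1)
  refine ⟨a, ha0, ?_⟩
  -- The Hardy inequality asks for finite support, so the constant is subtracted on `S` only.
  set h : (Fin d → ℤ) → ℝ := fun X => if X ∈ S then g X - a else 0 with hh
  have hhS : ∀ X ∈ S, h X = g X - a := fun X hX => if_pos hX
  have hhS0 : ∀ X, X ∉ S → h X = 0 := fun X hX => if_neg hX
  have hfin : h.support.Finite := S.finite_toSet.subset fun X hX => by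
    by_contra h'; exact hX (hhS0 X h')
  have gfin : g.support.Finite := S.finite_toSet.subset fun X hX => by
    by_contra h'; exact hX (hgS X h')
  set I : Fin d → ℝ := fun i => ∑' X, ν X * (g (X + Pi.single i 1) - g X) ^ 2 with hI
  have hI0 : ∀ i, 0 ≤ I i := fun i =>
    tsum_nonneg fun X => mul_nonneg (hνp X).le (sq_nonneg _)
  set H := ∑ X ∈ S, ν X * (g X - a) ^ 2 with hH
  have hsumI : 0 ≤ ∑ i, I i := Finset.sum_nonneg fun i _ => hI0 i
  -- the part inside the box
  have part1 : ∑ X ∈ K, ν X * (g X - a) ^ 2 ≤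
      2 ^ d * (4 * (2 * L + 8)) * eQ * n * ∑ i, I i := by
    have hbox : ∀ j, boxDirichlet lo (2 * k + 1) g j ≤ eQ * I j := by
      intro j
      have sI : Summable fun X => ν X * (g (X + Pi.single j 1) - g X) ^ 2 :=
        summable_of_hasFiniteSupport <| (finite_support_diff gfin _).subset fun X hX => by
          simp only [Function.mem_support, ne_eq, mul_eq_zero, not_or,
            pow_eq_zero_iff two_ne_zero] at hX ⊢; exact hX.2
      calc _ ≤ ∑ X ∈ K, eQ * (ν X * (g (X + Pi.single j 1) - g X) ^ 2) := by
            refine Finset.sum_le_sum fun X hX => ?_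
            have h1 := hKν X hX
            have h2 := sq_nonneg (g (X + Pi.single j 1) - g X)
            rw [← mul_assoc]
            split_ifs
            · exact le_mul_of_one_le_left h2 h1
            · exact mul_nonneg (zero_le_one.trans h1) h2
        _ = eQ * ∑ X ∈ K, ν X * (g (X + Pi.single j 1) - g X) ^ 2 := by rw [Finset.mul_sum]
        _ ≤ eQ * I j := by
            gcongr
            exact sI.sum_le_tsum _ fun X _ => mul_nonneg (hνp X).le (sq_nonneg _)
    have hm : (((2 * k + 1 : ℕ) : ℝ)) ^ 2 ≤ 4 * (2 * L + 8) * n := by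
      have : (((2 * k + 1 : ℕ) : ℝ)) ^ 2 ≤ (2 * ((k : ℝ) + 1)) ^ 2 := by
        gcongr; push_cast; linarith
      nlinarith
    calc _ ≤ ∑ X ∈ K, (g X - a) ^ 2 := by
          refine Finset.sum_le_sum fun X _ => ?_
          have := gaussWeight_le_one hΘ c n X
          exact mul_le_of_le_one_left (sq_nonneg _) this
      _ ≤ 2 ^ d * (((2 * k + 1 : ℕ) : ℝ)) ^ 2 * ∑ j, boxDirichlet lo (2 * k + 1) g j := ha2
      _ ≤ 2 ^ d * (4 * (2 * L + 8) * n) * ∑ j, eQ * I j := by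
          gcongr with j
          · exact Finset.sum_nonneg fun j _ => Finset.sum_nonneg fun X _ => by
              split_ifs <;> positivity
          · exact hbox j
      _ = _ := by rw [← Finset.mul_sum]; ring
  -- the part outside the box
  have part2 : ∑ X ∈ S \ K, ν X * (g X - a) ^ 2 ≤
      8 * n * B ^ 2 / L * ∑ i, (Ct * I i + eQ * Ct / n ^ 2) + 1 / 2 * H := by
    have hHi : ∀ i, ∑ X ∈ S, ν X * (Θ.mulVec (y X) i) ^ 2 / (8 * n ^ 2) * (g X - a) ^ 2 ≤
        (Ct * I i + eQ * Ct / n ^ 2) + Θ i i / (2 * n) * H := by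
      intro i
      have hΘi : Θ i i ≤ 2 * n := by
        have : Θ i i ≤ tr := Finset.single_le_sum (f := fun i => Θ i i) (fun i _ => hΘii i)
          (Finset.mem_univ i)
        linarith
      have h1 := hardy_gaussWeight hΘ c hn1 i hΘi hfin
      have h2 := hCt n hnt S hS g hgS a h hhS hhS0 i
      rw [tsum_eq_sum (s := S) (fun X hX => by rw [hhS0 X hX]; simp),
        tsum_eq_sum (s := S) (f := fun X => Θ i i / (2 * n) * gaussWeight Θ c n X * h X ^ 2)
          (fun X hX => by rw [hhS0 X hX]; simp)] at h1
      rw [Finset.sum_congr rfl fun X hX => by rw [hhS X hX]] at h1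
      rw [Finset.sum_congr (s₂ := S) (f := fun X => Θ i i / (2 * n) * gaussWeight Θ c n X * h X ^ 2)
        rfl fun X hX => by rw [hhS X hX]] at h1
      have h3 : ∑ X ∈ S, Θ i i / (2 * n) * gaussWeight Θ c n X * (g X - a) ^ 2 =
          Θ i i / (2 * n) * H := by
        rw [hH, Finset.mul_sum]; exact Finset.sum_congr rfl fun X _ => by rw [mul_assoc]
      rw [h3] at h1
      refine h1.trans (add_le_add (h2.trans (add_le_add le_rfl ?_)) le_rfl)
      gcongr
    have hX : ∀ X ∈ S \ K, ν X * (g X - a) ^ 2 ≤ 8 * n * B ^ 2 / L *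
        ∑ i, ν X * (Θ.mulVec (y X) i) ^ 2 / (8 * n ^ 2) * (g X - a) ^ 2 := by
      intro X hX
      have h1 := hKout X (Finset.mem_sdiff.1 hX).2
      have h2 : 0 ≤ ν X * (g X - a) ^ 2 := mul_nonneg (hνp X).le (sq_nonneg _)
      have h3 : 8 * n * B ^ 2 / L *
          ∑ i, ν X * (Θ.mulVec (y X) i) ^ 2 / (8 * n ^ 2) * (g X - a) ^ 2 =
          ν X * (g X - a) ^ 2 * ((B ^ 2 * ∑ i, Θ.mulVec (y X) i ^ 2) / (L * n)) := by
        simp only [Finset.mul_sum, Finset.sum_div]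
        refine Finset.sum_congr rfl fun i _ => ?_
        field_simp
      rw [h3]
      refine le_mul_of_one_le_right h2 ?_
      rwa [one_le_div (by positivity)]
    calc _ ≤ ∑ X ∈ S \ K, 8 * n * B ^ 2 / L *
          ∑ i, ν X * (Θ.mulVec (y X) i) ^ 2 / (8 * n ^ 2) * (g X - a) ^ 2 :=
          Finset.sum_le_sum hX
      _ ≤ ∑ X ∈ S, 8 * n * B ^ 2 / L *
          ∑ i, ν X * (Θ.mulVec (y X) i) ^ 2 / (8 * n ^ 2) * (g X - a) ^ 2 := by
          refine Finset.sum_le_sum_of_subset_of_nonneg Finset.sdiff_subset fun X _ _ => ?_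
          have := hνp X
          refine mul_nonneg (by positivity) (Finset.sum_nonneg fun i _ => by positivity)
      _ = 8 * n * B ^ 2 / L *
          ∑ i, ∑ X ∈ S, ν X * (Θ.mulVec (y X) i) ^ 2 / (8 * n ^ 2) * (g X - a) ^ 2 := by
          rw [← Finset.mul_sum, Finset.sum_comm]
      _ ≤ 8 * n * B ^ 2 / L * ∑ i, ((Ct * I i + eQ * Ct / n ^ 2) + Θ i i / (2 * n) * H) := by
          gcongr with i; exact hHi i
      _ = 8 * n * B ^ 2 / L * ∑ i, (Ct * I i + eQ * Ct / n ^ 2) +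
          4 * B ^ 2 * tr / L * H := by
          rw [Finset.sum_add_distrib, mul_add, ← Finset.sum_mul, ← Finset.sum_div, ← htr]
          congr 1
          field_simp
          ring
      _ ≤ _ := by
          have hH0 : 0 ≤ H := Finset.sum_nonneg fun X _ => mul_nonneg (hνp X).le (sq_nonneg _)
          have hq : 4 * B ^ 2 * tr / L ≤ 1 / 2 := by
            rw [div_le_iff₀ hL0, hL]; nlinarith
          exact add_le_add le_rfl (mul_le_mul_of_nonneg_right hq hH0)
  have hsplit : H = ∑ X ∈ S \ K, ν X * (g X - a) ^ 2 + ∑ X ∈ K, ν X * (g X - a) ^ 2 :=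
    (Finset.sum_sdiff hKS).symm
  have hfinal : H ≤ 2 * (2 ^ d * (4 * (2 * L + 8)) * eQ * n * ∑ i, I i) +
      2 * (8 * n * B ^ 2 / L * ∑ i, (Ct * I i + eQ * Ct / n ^ 2)) := by linarith
  refine hfinal.trans ?_
  rw [Finset.sum_add_distrib, ← Finset.mul_sum, Finset.sum_const, Finset.card_univ,
    Fintype.card_fin, nsmul_eq_mul]
  have e1 : 2 * (2 ^ d * (4 * (2 * L + 8)) * eQ * n * ∑ i, I i) +
      2 * (8 * n * B ^ 2 / L * (Ct * ∑ i, I i + d * (eQ * Ct / n ^ 2))) =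
      (2 * (2 ^ d * (4 * (2 * L + 8)) * eQ) + 16 * B ^ 2 / L * Ct) * n * ∑ i, I i +
      16 * B ^ 2 / L * (d * (eQ * Ct)) * n * (1 / n ^ 2) := by ring
  rw [e1]
  have p1 : 0 ≤ 16 * B ^ 2 / L * (d * (eQ * Ct)) * n * ∑ i, I i := by positivity
  have p2 : 0 ≤ (2 * (2 ^ d * (4 * (2 * L + 8)) * eQ) + 16 * B ^ 2 / L * Ct) * n *
      (1 / (n : ℝ) ^ 2) := by positivity
  linarith

end Poincare

end

noncomputable section

/-! ### Stationary laws of density dependent chains in a ball -/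

/-- The data of a density dependent chain near its equilibrium point, seen on the lattice: `g J` and
`u J` are the value and the gradient at `c` of the rate of the jump `J`, and `rate n J X` is its
value at `X / n`. -/
structure LatticeModel {d : ℕ} (Θ : Matrix (Fin d) (Fin d) ℝ) (c : Fin d → ℝ) (δ : ℝ)
    (jumps : Finset (Fin d → ℤ)) (g : (Fin d → ℤ) → ℝ) (u : (Fin d → ℤ) → Fin d → ℝ)
    (rate : ℕ → (Fin d → ℤ) → (Fin d → ℤ) → ℝ) : Prop where
  posDef : Θ.PosDef
  radius_pos : 0 < δ
  equilibrium : ∀ i, ∑ J ∈ jumps, g J * (J i : ℝ) = 0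
  lyapunov : jumpJacobian jumps u * Θ⁻¹ + Θ⁻¹ * (jumpJacobian jumps u).transpose +
    jumpCovariance jumps g = 0
  taylor : ∃ C : ℝ, 0 < C ∧ ∀ n : ℕ, 1 ≤ n → ∀ J ∈ jumps, ∀ X,
    qform Θ (devVec c n X) ≤ (n * δ) ^ 2 →
    |rate n J X - (g J + (u J ⬝ᵥ devVec c n X) / n)| ≤ C * (qform Θ (devVec c n X) / n / n)
  lower : ∃ ε : ℝ, 0 < ε ∧ ∀ n : ℕ, 1 ≤ n → ∀ J ∈ jumps, ∀ X,
    qform Θ (devVec c n X) ≤ (n * δ) ^ 2 → ε ≤ rate n J X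
  contraction : ∃ κ : ℝ, 0 < κ ∧ ∀ n : ℕ, 1 ≤ n → ∀ X,
    qform Θ (devVec c n X) ≤ (n * δ) ^ 2 →
    ∑ J ∈ jumps, rate n J X * bform Θ (realVec J) (devVec c n X) ≤
      -(κ * (qform Θ (devVec c n X) / n))
  generate : ∀ i : Fin d, ∃ l : List (Fin d → ℤ), (∀ J ∈ l, J ∈ jumps) ∧ Pi.single i 1 = l.sum

/-- `π` is a stationary probability vector of the chain with rates `r` on `S`, the jumps out of
`S` being suppressed. -/
structure IsStationaryLaw {d : ℕ} (jumps : Finset (Fin d → ℤ))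
    (r : (Fin d → ℤ) → (Fin d → ℤ) → ℝ) (S : Finset (Fin d → ℤ)) (π : (Fin d → ℤ) → ℝ) :
    Prop where
  nonneg : ∀ X, 0 ≤ π X
  support : ∀ X, X ∉ S → π X = 0
  mass : ∑ X ∈ S, π X = 1
  stationary : ∀ φ : (Fin d → ℤ) → ℝ,
    ∑ X ∈ S, π X * ∑ J ∈ jumps, (if X + J ∈ S then r J X * (φ (X + J) - φ X) else 0) = 0

/-- The density of `π` with respect to the Gaussian weight. -/
def gaussDensity {d : ℕ} (Θ : Matrix (Fin d) (Fin d) ℝ) (c : Fin d → ℝ) (n : ℕ)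
    (π : (Fin d → ℤ) → ℝ) (X : Fin d → ℤ) : ℝ := π X / gaussWeight Θ c n X

/-- The Dirichlet energy of `√(dπ/dν)` over the jumps `J` inside `S`. -/
def jumpEnergy {d : ℕ} (Θ : Matrix (Fin d) (Fin d) ℝ) (c : Fin d → ℝ) (n : ℕ)
    (S : Finset (Fin d → ℤ)) (π : (Fin d → ℤ) → ℝ) (J : Fin d → ℤ) : ℝ :=
  ∑ X ∈ S, if X + J ∈ S then gaussWeight Θ c n X *
    (√(gaussDensity Θ c n π (X + J)) - √(gaussDensity Θ c n π X)) ^ 2 else 0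

section Stationary

variable {d : ℕ} {Θ : Matrix (Fin d) (Fin d) ℝ} {c : Fin d → ℝ} {δ : ℝ}
  {jumps : Finset (Fin d → ℤ)} {g : (Fin d → ℤ) → ℝ} {u : (Fin d → ℤ) → Fin d → ℝ}
  {rate : ℕ → (Fin d → ℤ) → (Fin d → ℤ) → ℝ}

theorem LatticeModel.exists_affine_le (M : LatticeModel Θ c δ jumps g u rate) {R : ℝ}
    (hR : 0 ≤ R) : ∃ C : ℝ, 0 < C ∧ ∀ n : ℕ, 1 ≤ n → ∀ J ∈ jumps, ∀ X,
      qform Θ (devVec c n X) ≤ (n * R) ^ 2 → |g J + (u J ⬝ᵥ devVec c n X) / n| ≤ C := by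
  have h0 : ∀ J, 0 ≤ |g J| + √(qform Θ (Θ⁻¹.mulVec (u J))) * R := fun J => by positivity
  refine ⟨∑ J ∈ jumps, (|g J| + √(qform Θ (Θ⁻¹.mulVec (u J))) * R) + 1, ?_,
    fun n hn J hJ X hX => ?_⟩
  · have := Finset.sum_nonneg fun J (_ : J ∈ jumps) => h0 J
    positivity
  · have h1 := abs_bform_div_le M.posDef c hn hR X hX (Θ⁻¹.mulVec (u J))
    rw [← dotProduct_eq_bform M.posDef] at h1
    have h2 := Finset.single_le_sum (f := fun J => |g J| + √(qform Θ (Θ⁻¹.mulVec (u J))) * R)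
      (fun J _ => h0 J) hJ
    have h3 := abs_add_le (g J) ((u J ⬝ᵥ devVec c n X) / n)
    linarith

theorem LatticeModel.exists_rate_le (M : LatticeModel Θ c δ jumps g u rate) :
    ∃ G : ℝ, 0 < G ∧ ∀ n : ℕ, 1 ≤ n → ∀ J ∈ jumps, ∀ X,
      qform Θ (devVec c n X) ≤ (n * δ) ^ 2 → rate n J X ≤ G := by
  obtain ⟨C, hC0, hC⟩ := M.taylor
  obtain ⟨A, hA0, hA⟩ := M.exists_affine_le M.radius_pos.le
  refine ⟨A + C * δ ^ 2, by have := M.radius_pos; positivity, fun n hn J hJ X hX => ?_⟩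
  have hn' : (1 : ℝ) ≤ n := by exact_mod_cast hn
  have h1 := (abs_le.1 (hC n hn J hJ X hX)).2
  have h2 := (abs_le.1 (hA n hn J hJ X hX)).2
  have h3 : qform Θ (devVec c n X) / n / n ≤ δ ^ 2 := by
    rw [div_div, div_le_iff₀ (by positivity)]
    linarith
  have h4 := mul_le_mul_of_nonneg_left h3 hC0.le
  linarith

/-- The second moment bound, from the test function `|X - n c|⁴`. -/
theorem LatticeModel.exists_moment_le (M : LatticeModel Θ c δ jumps g u rate) :
    ∃ C : ℝ, 0 < C ∧ ∀ n : ℕ, 1 ≤ n → ∀ S : Finset (Fin d → ℤ),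
      (∀ X, X ∈ S ↔ qform Θ (devVec c n X) ≤ (n * δ) ^ 2) → ∀ π,
      IsStationaryLaw jumps (rate n) S π →
      ∑ X ∈ S, π X * (1 + qform Θ (devVec c n X) / n) ^ 2 ≤ C := by
  have hΘ := M.posDef
  obtain ⟨G, hG0, hG⟩ := M.exists_rate_le
  obtain ⟨ε, hε0, hε⟩ := M.lower
  obtain ⟨κ, hκ0, hκ⟩ := M.contraction
  set D := G * ∑ J ∈ jumps, (10 * qform Θ (realVec J) + 2 * qform Θ (realVec J) ^ 2) with hD
  have hD0 : 0 ≤ D := by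
    refine mul_nonneg hG0.le (Finset.sum_nonneg fun J _ => ?_)
    have := qform_nonneg hΘ (realVec J)
    positivity
  refine ⟨2 + 2 * ((D ^ 2 / (4 * κ) + D) / (3 * κ)), by positivity, fun n hn S hS π hπ => ?_⟩
  have hn' : (1 : ℝ) ≤ n := by exact_mod_cast hn
  set q := fun X => qform Θ (devVec c n X) with hq
  have hq0 : ∀ X, 0 ≤ q X := fun X => qform_nonneg hΘ _
  have hX : ∀ X ∈ S, ∑ J ∈ jumps,
      (if X + J ∈ S then rate n J X * (q (X + J) ^ 2 - q X ^ 2) else 0) ≤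
      n * (-(4 * κ * (q X / n) ^ 2) + D * (q X / n + 1)) := by
    intro X hXS
    have hXq := (hS X).1 hXS
    have h1 : ∀ J ∈ jumps, (if X + J ∈ S then rate n J X * (q (X + J) ^ 2 - q X ^ 2) else 0) ≤
        4 * q X * (rate n J X * bform Θ (realVec J) (devVec c n X)) +
        G * (10 * qform Θ (realVec J) + 2 * qform Θ (realVec J) ^ 2) * (q X + 1) := by
      intro J hJ
      have hr0 : 0 ≤ rate n J X := hε0.le.trans (hε n hn J hJ X hXq)
      have hrG := hG n hn J hJ X hXq
      -- A suppressed jump would leave the ball, that is, increase `q`; restoring it can only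
      -- increase the sum. The truncation therefore does no harm.
      have step1 : (if X + J ∈ S then rate n J X * (q (X + J) ^ 2 - q X ^ 2) else 0) ≤
          rate n J X * (q (X + J) ^ 2 - q X ^ 2) := by
        split_ifs with h
        · exact le_rfl
        · rw [hS, not_le] at h
          refine mul_nonneg hr0 (sub_nonneg.2 (pow_le_pow_left₀ (hq0 X) ?_ 2))
          exact hXq.trans h.le
      refine step1.trans ?_
      set b := bform Θ (realVec J) (devVec c n X) with hb
      set A := qform Θ (realVec J) with hA
      have hA0 : 0 ≤ A := qform_nonneg hΘ _
      have e1 : q (X + J) = q X + 2 * b + A := by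
        simp only [hq]; rw [devVec_add, qform_add hΘ]
      have hb2 : b ^ 2 ≤ A * q X := bform_sq_le hΘ _ _
      -- After summation over `J` the term `4 q b` is negative by contraction; since `b² ≤ A q`, the
      -- rest grows only linearly in `q`.
      have e2 : q (X + J) ^ 2 - q X ^ 2 = 4 * q X * b + (2 * q X * A + (2 * b + A) ^ 2) := by
        rw [e1]; ring
      have e3 : 2 * q X * A + (2 * b + A) ^ 2 ≤ (10 * A + 2 * A ^ 2) * (q X + 1) := by
        have := hq0 X
        nlinarith [sq_nonneg (2 * b - A), mul_nonneg hA0 this, mul_nonneg (sq_nonneg A) this]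
      have e4 : 0 ≤ (10 * A + 2 * A ^ 2) * (q X + 1) := by
        have := hq0 X; positivity
      rw [e2, mul_add]
      have e5 : rate n J X * (2 * q X * A + (2 * b + A) ^ 2) ≤
          G * ((10 * A + 2 * A ^ 2) * (q X + 1)) :=
        (mul_le_mul_of_nonneg_left e3 hr0).trans (mul_le_mul_of_nonneg_right hrG e4)
      linarith
    refine (Finset.sum_le_sum h1).trans ?_
    rw [Finset.sum_add_distrib, ← Finset.mul_sum, ← Finset.sum_mul, ← Finset.mul_sum, ← hD]
    have h2 := mul_le_mul_of_nonneg_left (hκ n hn X hXq)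
      (show 0 ≤ 4 * q X from mul_nonneg (by norm_num) (hq0 X))
    have h3 : D * (q X + 1) ≤ D * (n * (q X / n + 1)) := by
      gcongr
      rw [mul_add, mul_div_cancel₀ _ (by positivity)]
      linarith
    have h4 : 4 * q X * -(κ * (q X / n)) = -(n * (4 * κ * (q X / n) ^ 2)) := by field_simp
    change _ ≤ 4 * q X * -(κ * (q X / n)) at h2
    rw [h4] at h2
    linarith
  have h1 := hπ.stationary fun X => q X ^ 2
  have h2 : 0 ≤ (n : ℝ) * ∑ X ∈ S, π X * (-(4 * κ * (q X / n) ^ 2) + D * (q X / n + 1)) := by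
    rw [Finset.mul_sum]
    refine h1.ge.trans (Finset.sum_le_sum fun X hXS => ?_)
    have := mul_le_mul_of_nonneg_left (hX X hXS) (hπ.nonneg X)
    linarith
  have h3 : 0 ≤ ∑ X ∈ S, π X * (-(4 * κ * (q X / n) ^ 2) + D * (q X / n + 1)) :=
    nonneg_of_mul_nonneg_right h2 (by linarith)
  have h4 : ∑ X ∈ S, π X * (-(4 * κ * (q X / n) ^ 2) + D * (q X / n + 1)) ≤
      ∑ X ∈ S, (π X * (D ^ 2 / (4 * κ) + D) - 3 * κ * (π X * (q X / n) ^ 2)) := by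
    refine Finset.sum_le_sum fun X _ => ?_
    -- Young's inequality: one of the four `κ` absorbs the linear term, and three remain.
    have h5 : D * (q X / n) ≤ κ * (q X / n) ^ 2 + D ^ 2 / (4 * κ) := by
      rw [← sub_le_iff_le_add', le_div_iff₀ (by positivity)]
      nlinarith [sq_nonneg (2 * κ * (q X / n) - D)]
    have := mul_le_mul_of_nonneg_left h5 (hπ.nonneg X)
    nlinarith
  rw [Finset.sum_sub_distrib, ← Finset.sum_mul, hπ.mass, ← Finset.mul_sum, one_mul] at h4
  have h5 : ∑ X ∈ S, π X * (q X / n) ^ 2 ≤ (D ^ 2 / (4 * κ) + D) / (3 * κ) := by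
    rw [le_div_iff₀ (by positivity)]; linarith
  calc ∑ X ∈ S, π X * (1 + q X / n) ^ 2 ≤ ∑ X ∈ S, (2 * π X + 2 * (π X * (q X / n) ^ 2)) := by
        refine Finset.sum_le_sum fun X _ => ?_
        have := mul_le_mul_of_nonneg_left (show (1 + q X / n) ^ 2 ≤ 2 + 2 * (q X / n) ^ 2 by
          nlinarith [sq_nonneg (1 - q X / n)]) (hπ.nonneg X)
        linarith
    _ = 2 + 2 * ∑ X ∈ S, π X * (q X / n) ^ 2 := by
        rw [Finset.sum_add_distrib, ← Finset.mul_sum, ← Finset.mul_sum, hπ.mass]; ring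
    _ ≤ _ := by gcongr

/-- Transitions of positive rate lead from the support of a stationary law into its support. -/
theorem IsStationaryLaw.pos_of_rate_pos {r : (Fin d → ℤ) → (Fin d → ℤ) → ℝ}
    {S : Finset (Fin d → ℤ)} {π : (Fin d → ℤ) → ℝ} (hπ : IsStationaryLaw jumps r S π)
    (hr : ∀ J ∈ jumps, ∀ X ∈ S, 0 ≤ r J X) {X J : Fin d → ℤ} (hX : X ∈ S) (hXJ : X + J ∈ S)
    (hJ : J ∈ jumps) (hpos : 0 < π X) (hrpos : 0 < r J X) : 0 < π (X + J) := by
  classical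
  by_contra hcon
  have h0 : π (X + J) = 0 := le_antisymm (not_lt.1 hcon) (hπ.nonneg _)
  have hne : X ≠ X + J := fun h => by rw [← h] at h0; linarith
  -- With the indicator of a state of zero mass as test function, stationarity says that the total
  -- inflow into this state is zero, and the inflow is a sum of nonnegative terms.
  have hst := hπ.stationary (Pi.single (X + J) 1)
  have hterm : ∀ Z ∈ S, ∀ K ∈ jumps, 0 ≤ π Z * (if Z + K ∈ S then
      r K Z * ((Pi.single (X + J) 1 : (Fin d → ℤ) → ℝ) (Z + K) -
        (Pi.single (X + J) 1 : (Fin d → ℤ) → ℝ) Z) else 0) := by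
    intro Z hZ K hK
    by_cases hZX : Z = X + J
    · rw [hZX, h0, zero_mul]
    · refine mul_nonneg (hπ.nonneg Z) ?_
      split_ifs with h
      · refine mul_nonneg (hr K hK Z hZ) ?_
        rw [Pi.single_eq_of_ne hZX, sub_zero]
        by_cases h' : Z + K = X + J
        · rw [h', Pi.single_eq_same]; exact zero_le_one
        · rw [Pi.single_eq_of_ne h']
      · exact le_rfl
  simp only [Finset.mul_sum] at hst
  have h1 := (Finset.sum_eq_zero_iff_of_nonneg fun Z hZ =>
    Finset.sum_nonneg fun K hK => hterm Z hZ K hK).1 hst X hX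
  have h2 := (Finset.sum_eq_zero_iff_of_nonneg fun K hK => hterm X hX K hK).1 h1 J hJ
  rw [if_pos hXJ, Pi.single_eq_same, Pi.single_eq_of_ne hne, sub_zero, mul_one] at h2
  exact (mul_pos hpos hrpos).ne' h2

/-- The inequality `log t ≤ t - 1` is used at `t = √b / √a` instead of `b / a`; this retains the
square `(√b - √a)²` that becomes the Dirichlet energy. -/
theorem mul_log_sub_log_le {a b : ℝ} (ha : 0 < a) (hb : 0 < b) :
    a * (Real.log b - Real.log a) ≤ b - a - (√b - √a) ^ 2 := by
  have hsa := Real.sqrt_pos.2 ha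
  have hsb := Real.sqrt_pos.2 hb
  have h1 : Real.log b - Real.log a = 2 * Real.log (√b / √a) := by
    rw [Real.log_div hsb.ne' hsa.ne', Real.log_sqrt hb.le, Real.log_sqrt ha.le]; ring
  have h2 := Real.log_le_sub_one_of_pos (div_pos hsb hsa)
  have h3 : a * (√b / √a) = √a * √b := by
    rw [mul_div_assoc', div_eq_iff hsa.ne', mul_right_comm, Real.mul_self_sqrt ha.le]
  have h4 := Real.sq_sqrt ha.le
  have h5 := Real.sq_sqrt hb.le
  rw [h1]
  have h6 := mul_le_mul_of_nonneg_left h2 ha.le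
  nlinarith

theorem gaussWeight_mul_gaussDensity (n : ℕ) (π : (Fin d → ℤ) → ℝ) (X : Fin d → ℤ) :
    gaussWeight Θ c n X * gaussDensity Θ c n π X = π X :=
  mul_div_cancel₀ _ (gaussWeight_pos c n X).ne'

/-- The entropy dissipation inequality: testing stationarity against `log (dπ/dν)` bounds the
Dirichlet energy of `√(dπ/dν)`. -/
theorem IsStationaryLaw.entropy_dissipation {r : (Fin d → ℤ) → (Fin d → ℤ) → ℝ}
    {S : Finset (Fin d → ℤ)} {π : (Fin d → ℤ) → ℝ} (hπ : IsStationaryLaw jumps r S π)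
    (hr : ∀ J ∈ jumps, ∀ X ∈ S, 0 ≤ r J X) (n : ℕ) :
    ∑ X ∈ S, ∑ J ∈ jumps, (if X + J ∈ S then gaussWeight Θ c n X * r J X *
      (√(gaussDensity Θ c n π (X + J)) - √(gaussDensity Θ c n π X)) ^ 2 else 0) ≤
    ∑ X ∈ S, ∑ J ∈ jumps, (if X + J ∈ S then gaussWeight Θ c n X * r J X *
      (gaussDensity Θ c n π (X + J) - gaussDensity Θ c n π X) else 0) := by
  set f := gaussDensity Θ c n π with hf
  have hf0 : ∀ X, 0 ≤ f X := fun X => div_nonneg (hπ.nonneg X) (gaussWeight_pos c n X).le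
  have hst := hπ.stationary fun X => Real.log (f X)
  rw [← sub_nonneg, ← Finset.sum_sub_distrib, ← hst]
  refine Finset.sum_le_sum fun X hX => ?_
  rw [← Finset.sum_sub_distrib, Finset.mul_sum]
  refine Finset.sum_le_sum fun J hJ => ?_
  split_ifs with hXJ
  swap
  · simp
  have hν := gaussWeight_pos (Θ := Θ) c n X
  have e : π X = gaussWeight Θ c n X * f X := (gaussWeight_mul_gaussDensity n π X).symm
  rcases (hr J hJ X hX).eq_or_lt with h0 | h0
  · rw [← h0]; simp
  -- If `f X = 0`, the two energy terms coincide and the logarithms carry the factor `π X = 0`. If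
  -- `f X > 0`, positivity propagates along the jump, so the default value `Real.log 0 = 0`, which
  -- would spoil the inequality, does not occur at `X + J`.
  rcases (hf0 X).eq_or_lt with h1 | h1
  · rw [e, ← h1, Real.sqrt_zero, sub_zero, sub_zero, Real.sq_sqrt (hf0 _)]; simp
  have hπX : 0 < π X := e ▸ mul_pos hν h1
  have h2 : 0 < f (X + J) :=
    div_pos (hπ.pos_of_rate_pos hr hX hXJ hJ hπX h0) (gaussWeight_pos c n _)
  have h3 := mul_log_sub_log_le h1 h2
  have h4 := mul_le_mul_of_nonneg_left h3 (mul_pos hν h0).le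
  rw [e]
  linarith

end Stationary

end

noncomputable section

/-! ### Mass near the boundary, and energies along jumps and along coordinate vectors. -/

section Fisher

variable {d : ℕ} {Θ : Matrix (Fin d) (Fin d) ℝ} {c : Fin d → ℝ} {δ : ℝ}
  {jumps : Finset (Fin d → ℤ)} {g : (Fin d → ℤ) → ℝ} {u : (Fin d → ℤ) → Fin d → ℝ}
  {rate : ℕ → (Fin d → ℤ) → (Fin d → ℤ) → ℝ}

/-- The mass of `π` outside the ball of radius `n δ / 2`. -/
def outerMass (Θ : Matrix (Fin d) (Fin d) ℝ) (c : Fin d → ℝ) (δ : ℝ) (n : ℕ)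
    (π : (Fin d → ℤ) → ℝ) (X : Fin d → ℤ) : ℝ :=
  if n * δ / 2 ≤ √(qform Θ (devVec c n X)) then π X else 0

theorem outerMass_nonneg {n : ℕ} {π : (Fin d → ℤ) → ℝ} (hπ : ∀ X, 0 ≤ π X) (X : Fin d → ℤ) :
    0 ≤ outerMass Θ c δ n π X := by
  rw [outerMass]; split_ifs <;> simp [hπ]

/-- Chebyshev's inequality with the second moment of `1 + q/n`: outside the half ball `q/n ≥ nδ²/4`.
The resulting order `n⁻²` is that of the energy itself, so boundary effects cost nothing. -/
theorem LatticeModel.exists_outerMass_le (M : LatticeModel Θ c δ jumps g u rate) :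
    ∃ C : ℝ, 0 < C ∧ ∀ n : ℕ, 1 ≤ n → ∀ S : Finset (Fin d → ℤ),
      (∀ X, X ∈ S ↔ qform Θ (devVec c n X) ≤ (n * δ) ^ 2) → ∀ π,
      IsStationaryLaw jumps (rate n) S π → ∑' X, outerMass Θ c δ n π X ≤ C / n ^ 2 := by
  obtain ⟨C, hC0, hC⟩ := M.exists_moment_le
  have hδ := M.radius_pos
  refine ⟨16 / δ ^ 4 * C, by positivity, fun n hn S hS π hπ => ?_⟩
  have hn' : (1 : ℝ) ≤ n := by exact_mod_cast hn
  rw [tsum_eq_sum (s := S) fun X hX => by rw [outerMass, hπ.support X hX, ite_self]]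
  have h1 := hC n hn S hS π hπ
  calc ∑ X ∈ S, outerMass Θ c δ n π X ≤
      ∑ X ∈ S, 16 / δ ^ 4 / n ^ 2 * (π X * (1 + qform Θ (devVec c n X) / n) ^ 2) := by
        refine Finset.sum_le_sum fun X _ => ?_
        rw [outerMass]
        have hq := qform_nonneg M.posDef (devVec c n X)
        have hp := hπ.nonneg X
        split_ifs with h
        · have h2 := pow_le_pow_left₀ (by positivity) h 2
          rw [Real.sq_sqrt hq] at h2
          have h3 : n * δ ^ 2 / 4 ≤ 1 + qform Θ (devVec c n X) / n := by
            have : n * δ ^ 2 / 4 ≤ qform Θ (devVec c n X) / n := by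
              rw [le_div_iff₀ (by positivity)]; linarith
            linarith
          have h4 := pow_le_pow_left₀ (by positivity) h3 2
          have h5 : 1 ≤ 16 / δ ^ 4 / n ^ 2 * (1 + qform Θ (devVec c n X) / n) ^ 2 := by
            calc (1 : ℝ) = 16 / δ ^ 4 / n ^ 2 * (n * δ ^ 2 / 4) ^ 2 := by field_simp; norm_num
              _ ≤ _ := by gcongr
          calc π X = 1 * π X := (one_mul _).symm
            _ ≤ (16 / δ ^ 4 / n ^ 2 * (1 + qform Θ (devVec c n X) / n) ^ 2) * π X := by gcongr
            _ = _ := by ring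
        · positivity
    _ = 16 / δ ^ 4 / n ^ 2 * ∑ X ∈ S, π X * (1 + qform Θ (devVec c n X) / n) ^ 2 := by
        rw [Finset.mul_sum]
    _ ≤ 16 / δ ^ 4 / n ^ 2 * C := by gcongr
    _ = _ := by ring

/-- Young's inequality for `|y - x| (y + x)`. It trades the variation of `f` for the energy of `√f`
and a moment; the free parameter `t` is later a small multiple of `n`. -/
theorem mul_abs_sq_sub_sq_le {x y w t : ℝ} (hx : 0 ≤ x) (hy : 0 ≤ y) (ht : 0 < t) :
    w * |y ^ 2 - x ^ 2| ≤ t * (y - x) ^ 2 + w ^ 2 * (x ^ 2 + y ^ 2) / (2 * t) := by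
  have e : |y ^ 2 - x ^ 2| = |y - x| * (y + x) := by
    rw [show y ^ 2 - x ^ 2 = (y - x) * (y + x) by ring, abs_mul, abs_of_nonneg (add_nonneg hy hx)]
  rw [e, ← sub_le_iff_le_add', le_div_iff₀ (by positivity), ← sq_abs (y - x)]
  nlinarith [sq_nonneg (2 * t * |y - x| - w * (y + x)), mul_nonneg (sq_nonneg w)
    (sq_nonneg (y - x))]

theorem exists_gaussWeight_le_shift (hΘ : Θ.PosDef) (c : Fin d → ℝ) {δ : ℝ} (hδ : 0 ≤ δ)
    (a : Fin d → ℤ) :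
    ∃ C : ℝ, 0 < C ∧ ∀ n : ℕ, 1 ≤ n → ∀ X, qform Θ (devVec c n (X + a)) ≤ (n * δ) ^ 2 →
      gaussWeight Θ c n X ≤ C * gaussWeight Θ c n (X + a) := by
  obtain ⟨C, hC0, hC⟩ := gaussWeight_add_le hΘ c hδ (-a)
  exact ⟨C, hC0, fun n hn X hX => by simpa using hC n hn (X + a) hX⟩

theorem exists_weighted_le_shift (hΘ : Θ.PosDef) (c : Fin d → ℝ) {δ : ℝ} (hδ : 0 ≤ δ)
    (a : Fin d → ℤ) :
    ∃ C : ℝ, 0 < C ∧ ∀ n : ℕ, 1 ≤ n → ∀ X, qform Θ (devVec c n (X + a)) ≤ (n * δ) ^ 2 →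
      gaussWeight Θ c n X * (1 + qform Θ (devVec c n X) / n) ^ 2 ≤
        C * (gaussWeight Θ c n (X + a) * (1 + qform Θ (devVec c n (X + a)) / n) ^ 2) := by
  obtain ⟨C, hC0, hC⟩ := exists_gaussWeight_le_shift hΘ c hδ a
  set A := qform Θ (realVec a) with hA
  have hA0 : 0 ≤ A := qform_nonneg hΘ _
  refine ⟨C * (2 + 2 * A) ^ 2, by positivity, fun n hn X hX => ?_⟩
  have hn' : (1 : ℝ) ≤ n := by exact_mod_cast hn
  have h1 : qform Θ (devVec c n X) ≤ 2 * qform Θ (devVec c n (X + a)) + 2 * A := by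
    have h := qform_add_le hΘ (devVec c n (X + a)) (-realVec a)
    rwa [qform_neg, devVec_add, add_neg_cancel_right, ← devVec_add] at h
  have hq := qform_nonneg hΘ (devVec c n X)
  have hq' := qform_nonneg hΘ (devVec c n (X + a))
  have h2 : 1 + qform Θ (devVec c n X) / n ≤
      (2 + 2 * A) * (1 + qform Θ (devVec c n (X + a)) / n) := by
    have h3 : qform Θ (devVec c n X) / n ≤ 2 * (qform Θ (devVec c n (X + a)) / n) + 2 * A := by
      calc _ ≤ (2 * qform Θ (devVec c n (X + a)) + 2 * A) / n := by gcongr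
        _ = 2 * (qform Θ (devVec c n (X + a)) / n) + 2 * A / n := by ring
        _ ≤ _ := by gcongr; exact div_le_self (by positivity) hn'
    have h4 : 0 ≤ qform Θ (devVec c n (X + a)) / n := by positivity
    nlinarith [mul_nonneg hA0 h4]
  have hν := gaussWeight_pos (Θ := Θ) c n (X + a)
  calc _ ≤ (C * gaussWeight Θ c n (X + a)) *
        ((2 + 2 * A) * (1 + qform Θ (devVec c n (X + a)) / n)) ^ 2 := by
        gcongr
        exact hC n hn X hX
    _ = _ := by ring

theorem jumpEnergy_nonneg (n : ℕ) (S : Finset (Fin d → ℤ)) (π : (Fin d → ℤ) → ℝ)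
    (J : Fin d → ℤ) : 0 ≤ jumpEnergy Θ c n S π J :=
  Finset.sum_nonneg fun X _ => by
    have := (gaussWeight_pos (Θ := Θ) c n X).le
    split_ifs <;> positivity

/-- The energy along a composition of jumps is controlled by the energy along the jumps. -/
theorem exists_list_energy_le (hΘ : Θ.PosDef) (hδ : 0 < δ) (c : Fin d → ℝ) (l : List (Fin d → ℤ))
    (hl : ∀ J ∈ l, J ∈ jumps) : ∃ C ρ : ℝ, 0 ≤ C ∧ 0 ≤ ρ ∧ ∀ n : ℕ, 1 ≤ n →
      ∀ S : Finset (Fin d → ℤ), (∀ X, X ∈ S ↔ qform Θ (devVec c n X) ≤ (n * δ) ^ 2) →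
      ∀ π : (Fin d → ℤ) → ℝ,
      ∑ X ∈ S with √(qform Θ (devVec c n X)) + ρ ≤ n * δ, gaussWeight Θ c n X *
        (√(gaussDensity Θ c n π (X + l.sum)) - √(gaussDensity Θ c n π X)) ^ 2 ≤
      C * ∑ J ∈ jumps, jumpEnergy Θ c n S π J := by
  classical
  induction l with
  | nil => exact ⟨0, 0, le_rfl, le_rfl, fun n _ S _ π => by simp⟩
  | cons J l ih =>
    obtain ⟨C, ρ, hC, hρ, h⟩ := ih fun K hK => hl K (List.mem_cons_of_mem _ hK)
    have hJ : J ∈ jumps := hl J List.mem_cons_self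
    obtain ⟨C₁, hC₁, h₁⟩ := exists_gaussWeight_le_shift hΘ c hδ.le J
    -- The margin `ρ` adds up the lengths of the jumps, so that the whole path stays in the ball.
    refine ⟨2 + 2 * C₁ * C, ρ + √(qform Θ (realVec J)), by positivity, by positivity,
      fun n hn S hS π => ?_⟩
    have ih := h n hn S hS π
    set s := fun X => √(gaussDensity Θ c n π X) with hs
    set ν := gaussWeight Θ c n with hν
    have hνp : ∀ X, 0 < ν X := gaussWeight_pos c n
    set T := S.filter fun X => √(qform Θ (devVec c n X)) + (ρ + √(qform Θ (realVec J))) ≤ n * δ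
      with hT
    set T' := S.filter fun X => √(qform Θ (devVec c n X)) + ρ ≤ n * δ with hT'
    have hmem : ∀ X ∈ T, X ∈ S ∧ X + J ∈ T' := by
      intro X hX
      obtain ⟨h2, h3⟩ := Finset.mem_filter.1 hX
      have h4 := sqrt_qform_devVec_add_le hΘ c n X J
      refine ⟨h2, Finset.mem_filter.2 ⟨?_, by linarith⟩⟩
      rw [hS, qform_le_sq_iff _ (by positivity)]
      linarith
    have hT'S : ∀ X ∈ T', X ∈ S := fun X hX => (Finset.mem_filter.1 hX).1
    have hpt : ∀ X ∈ T, ν X * (s (X + (J :: l).sum) - s X) ^ 2 ≤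
        2 * (if X + J ∈ S then ν X * (s (X + J) - s X) ^ 2 else 0) +
        2 * C₁ * (ν (X + J) * (s (X + J + l.sum) - s (X + J)) ^ 2) := by
      intro X hX
      obtain ⟨h2, h3⟩ := hmem X hX
      rw [if_pos (hT'S _ h3), List.sum_cons, ← add_assoc]
      have h4 := h₁ n hn X ((hS _).1 (hT'S _ h3))
      have h5 : (s (X + J + l.sum) - s X) ^ 2 ≤ 2 * (s (X + J) - s X) ^ 2 +
          2 * (s (X + J + l.sum) - s (X + J)) ^ 2 := by
        nlinarith [sq_nonneg ((s (X + J + l.sum) - s (X + J)) - (s (X + J) - s X))]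
      calc _ ≤ ν X * (2 * (s (X + J) - s X) ^ 2 + 2 * (s (X + J + l.sum) - s (X + J)) ^ 2) :=
            mul_le_mul_of_nonneg_left h5 (hνp X).le
        _ = 2 * (ν X * (s (X + J) - s X) ^ 2) +
            2 * ν X * (s (X + J + l.sum) - s (X + J)) ^ 2 := by ring
        _ ≤ 2 * (ν X * (s (X + J) - s X) ^ 2) +
            2 * (C₁ * ν (X + J)) * (s (X + J + l.sum) - s (X + J)) ^ 2 := by gcongr
        _ = _ := by ring
    have hshift : ∑ X ∈ T, ν (X + J) * (s (X + J + l.sum) - s (X + J)) ^ 2 ≤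
        ∑ X ∈ T', ν X * (s (X + l.sum) - s X) ^ 2 := by
      rw [← Finset.sum_image (f := fun X => ν X * (s (X + l.sum) - s X) ^ 2) (g := fun X => X + J)
        fun X _ Z _ hXZ => add_right_cancel hXZ]
      refine Finset.sum_le_sum_of_subset_of_nonneg (fun X hX => ?_) fun X _ _ =>
        mul_nonneg (hνp X).le (sq_nonneg _)
      obtain ⟨Z, hZ, rfl⟩ := Finset.mem_image.1 hX
      exact (hmem Z hZ).2
    have hE : ∑ X ∈ T, (if X + J ∈ S then ν X * (s (X + J) - s X) ^ 2 else 0) ≤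
        ∑ J ∈ jumps, jumpEnergy Θ c n S π J := by
      refine le_trans ?_ (Finset.single_le_sum (fun K _ => jumpEnergy_nonneg n S π K) hJ)
      refine Finset.sum_le_sum_of_subset_of_nonneg (Finset.filter_subset _ _) fun X _ _ => ?_
      have := (hνp X).le
      split_ifs <;> positivity
    calc _ ≤ ∑ X ∈ T, (2 * (if X + J ∈ S then ν X * (s (X + J) - s X) ^ 2 else 0) +
          2 * C₁ * (ν (X + J) * (s (X + J + l.sum) - s (X + J)) ^ 2)) := Finset.sum_le_sum hpt
      _ = 2 * ∑ X ∈ T, (if X + J ∈ S then ν X * (s (X + J) - s X) ^ 2 else 0) +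
          2 * C₁ * ∑ X ∈ T, ν (X + J) * (s (X + J + l.sum) - s (X + J)) ^ 2 := by
          rw [Finset.sum_add_distrib, Finset.mul_sum, Finset.mul_sum]
      _ ≤ 2 * ∑ J ∈ jumps, jumpEnergy Θ c n S π J +
          2 * C₁ * (C * ∑ J ∈ jumps, jumpEnergy Θ c n S π J) := by
          gcongr
          exact hshift.trans ih
      _ = _ := by ring

theorem gaussDensity_nonneg {n : ℕ} {π : (Fin d → ℤ) → ℝ} (hπ : ∀ X, 0 ≤ π X) (X : Fin d → ℤ) :
    0 ≤ gaussDensity Θ c n π X := div_nonneg (hπ X) (gaussWeight_pos c n X).le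

theorem finite_support_gaussDensity {n : ℕ} {π : (Fin d → ℤ) → ℝ} {S : Finset (Fin d → ℤ)}
    (hπ : ∀ X, X ∉ S → π X = 0) : (gaussDensity Θ c n π).support.Finite :=
  S.finite_toSet.subset fun X hX => by
    by_contra h; exact hX (by rw [gaussDensity, hπ X h, zero_div])

theorem summable_outerMass {n : ℕ} {π : (Fin d → ℤ) → ℝ} {S : Finset (Fin d → ℤ)}
    (hπ : ∀ X, X ∉ S → π X = 0) (a : Fin d → ℤ) :
    Summable fun X => outerMass Θ c δ n π (X + a) := by
  have h : (outerMass Θ c δ n π).support.Finite := S.finite_toSet.subset fun X hX => by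
    by_contra h; exact hX (by rw [outerMass, hπ X h, ite_self])
  exact summable_of_hasFiniteSupport (finite_support_shift h a)

/-- Near the boundary of the ball only the outer mass matters. -/
theorem exists_boundary_le (hΘ : Θ.PosDef) (hδ : 0 < δ) (c : Fin d → ℝ) (a : Fin d → ℤ) {ρ : ℝ} :
    ∃ C : ℝ, 0 < C ∧ ∀ᶠ n : ℕ in atTop, ∀ S : Finset (Fin d → ℤ),
      (∀ X, X ∈ S ↔ qform Θ (devVec c n X) ≤ (n * δ) ^ 2) → ∀ π : (Fin d → ℤ) → ℝ,
      (∀ X, 0 ≤ π X) → (∀ X, X ∉ S → π X = 0) → ∀ X,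
      ¬ (X ∈ S ∧ √(qform Θ (devVec c n X)) + ρ ≤ n * δ ∧ X + a ∈ S) →
      gaussWeight Θ c n X * (gaussDensity Θ c n π X + gaussDensity Θ c n π (X + a)) ≤
        C * (outerMass Θ c δ n π X + outerMass Θ c δ n π (X + a)) := by
  obtain ⟨C, hC0, hC⟩ := exists_gaussWeight_le_shift hΘ c hδ.le a
  set A := √(qform Θ (realVec a)) with hA
  refine ⟨1 + C, by positivity, ?_⟩
  -- For such `n` a point within `|ρ| + A` of the boundary, and its translate by `a`, are at
  -- distance at least `nδ/2` from the centre.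
  filter_upwards [eventually_ge_atTop 1, eventually_ge_atTop ⌈2 * (|ρ| + 2 * A) / δ⌉₊] with
    n hn hn2 S hS π hπ0 hπS X hX
  have hn2' : |ρ| + 2 * A ≤ n * δ / 2 := by
    have h2 := (Nat.le_ceil (2 * (|ρ| + 2 * A) / δ)).trans (Nat.cast_le (α := ℝ).2 hn2)
    rw [div_le_iff₀ hδ] at h2
    linarith
  have hρ := le_abs_self ρ
  have hρ0 := abs_nonneg ρ
  have hA0 : 0 ≤ A := Real.sqrt_nonneg _
  have hnδ : 0 ≤ n * δ := by positivity
  have hS' : ∀ X, X ∈ S ↔ √(qform Θ (devVec c n X)) ≤ n * δ := fun X => by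
    rw [hS, qform_le_sq_iff _ hnδ]
  have t1 := sqrt_qform_devVec_add_le hΘ c n X a
  have t2 := sqrt_qform_devVec_le_of_add hΘ c n X a
  rw [← hA] at t1 t2
  have hτ1 := outerMass_nonneg (Θ := Θ) (c := c) (δ := δ) (n := n) hπ0 X
  have hτ2 := outerMass_nonneg (Θ := Θ) (c := c) (δ := δ) (n := n) hπ0 (X + a)
  have hfar : n * δ - |ρ| - A ≤ √(qform Θ (devVec c n X)) := by
    by_contra hlt
    rw [not_le] at hlt
    exact hX ⟨(hS' X).2 (by linarith), by linarith, (hS' _).2 (by linarith)⟩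
  have b1 : π X ≤ outerMass Θ c δ n π X := by
    rw [outerMass, if_pos (by linarith)]
  have b2 : π (X + a) ≤ outerMass Θ c δ n π (X + a) := by
    rw [outerMass, if_pos (by linarith)]
  rw [mul_add, gaussWeight_mul_gaussDensity]
  have b3 : gaussWeight Θ c n X * gaussDensity Θ c n π (X + a) ≤ C * π (X + a) := by
    by_cases h : X + a ∈ S
    · rw [← gaussWeight_mul_gaussDensity (Θ := Θ) (c := c) n π (X + a), ← mul_assoc]
      exact mul_le_mul_of_nonneg_right (hC n hn X ((hS _).1 h)) (gaussDensity_nonneg hπ0 _)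
    · rw [gaussDensity, hπS _ h]; simp
  have b4 := mul_le_mul_of_nonneg_left b2 hC0.le
  nlinarith

/-- The Dirichlet energy along coordinate vectors is controlled by the energy along jumps. -/
theorem LatticeModel.exists_coordinate_energy_le (M : LatticeModel Θ c δ jumps g u rate)
    (i : Fin d) : ∃ C : ℝ, 0 < C ∧ ∀ᶠ n : ℕ in atTop, ∀ S : Finset (Fin d → ℤ),
      (∀ X, X ∈ S ↔ qform Θ (devVec c n X) ≤ (n * δ) ^ 2) → ∀ π,
      IsStationaryLaw jumps (rate n) S π →
      ∑' X, gaussWeight Θ c n X * (√(gaussDensity Θ c n π (X + Pi.single i 1)) -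
        √(gaussDensity Θ c n π X)) ^ 2 ≤
      C * (∑ J ∈ jumps, jumpEnergy Θ c n S π J + 1 / n ^ 2) := by
  classical
  obtain ⟨l, hl, hli⟩ := M.generate i
  obtain ⟨C₁, ρ, hC₁, hρ, h₁⟩ := exists_list_energy_le M.posDef M.radius_pos c l hl
  obtain ⟨C₂, hC₂, h₂⟩ := exists_boundary_le M.posDef M.radius_pos c (Pi.single i 1) (ρ := ρ)
  obtain ⟨C₃, hC₃, h₃⟩ := M.exists_outerMass_le
  refine ⟨C₁ + 2 * C₂ * C₃, by positivity, ?_⟩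
  filter_upwards [h₂, eventually_ge_atTop 1] with n h₂ hn S hS π hπ
  have h1 := h₁ n hn S hS π
  rw [← hli] at h1
  have h2 := h₂ S hS π hπ.nonneg hπ.support
  have h3 := h₃ n hn S hS π hπ
  set e : Fin d → ℤ := Pi.single i 1 with he
  set f := gaussDensity Θ c n π with hf
  have hf0 : ∀ X, 0 ≤ f X := gaussDensity_nonneg hπ.nonneg
  have hffin : f.support.Finite := finite_support_gaussDensity hπ.support
  set ν := gaussWeight Θ c n with hν
  have hνp : ∀ X, 0 < ν X := gaussWeight_pos c n
  set τ := outerMass Θ c δ n π with hτ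
  set T := S.filter fun X => √(qform Θ (devVec c n X)) + ρ ≤ n * δ with hT
  have hsfin : (fun X => √(f X)).support.Finite := hffin.subset fun X hX => by
    intro h0; exact hX (by simp only [h0, Real.sqrt_zero])
  have s0 : Summable fun X => ν X * (√(f (X + e)) - √(f X)) ^ 2 :=
    summable_of_hasFiniteSupport <| (finite_support_diff hsfin e).subset fun X hX => by
      simp only [Function.mem_support, ne_eq, mul_eq_zero, not_or, pow_eq_zero_iff two_ne_zero]
        at hX ⊢; exact hX.2
  have s1 : Summable fun X => if X ∈ T then ν X * (√(f (X + e)) - √(f X)) ^ 2 else 0 :=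
    summable_of_hasFiniteSupport <| T.finite_toSet.subset fun X hX => by
      by_contra h'; exact hX (if_neg h')
  have s2 : Summable τ := by simpa using summable_outerMass (Θ := Θ) (c := c) (δ := δ) (n := n) hπ.support 0
  have s3 : Summable fun X => τ (X + e) := summable_outerMass hπ.support e
  -- On `T` the path of jumps that composes `e_i` stays in `S`. Elsewhere the square is at most `f X
  -- + f (X + e)`, which the outer mass pays for.
  have hpt : ∀ X, ν X * (√(f (X + e)) - √(f X)) ^ 2 ≤
      (if X ∈ T then ν X * (√(f (X + e)) - √(f X)) ^ 2 else 0) + C₂ * (τ X + τ (X + e)) := by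
    intro X
    have hτ0 : 0 ≤ C₂ * (τ X + τ (X + e)) :=
      mul_nonneg hC₂.le (add_nonneg (outerMass_nonneg hπ.nonneg _) (outerMass_nonneg hπ.nonneg _))
    split_ifs with hX
    · linarith
    · rw [zero_add]
      refine le_trans ?_ (h2 X fun hX' => hX (Finset.mem_filter.2 ⟨hX'.1, hX'.2.1⟩))
      refine mul_le_mul_of_nonneg_left ?_ (hνp X).le
      have e1 := Real.sq_sqrt (hf0 X)
      have e2 := Real.sq_sqrt (hf0 (X + e))
      nlinarith [mul_nonneg (Real.sqrt_nonneg (f X)) (Real.sqrt_nonneg (f (X + e)))]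
  have hE0 : 0 ≤ ∑ J ∈ jumps, jumpEnergy Θ c n S π J :=
    Finset.sum_nonneg fun J _ => jumpEnergy_nonneg n S π J
  calc _ ≤ ∑' X, ((if X ∈ T then ν X * (√(f (X + e)) - √(f X)) ^ 2 else 0) +
        C₂ * (τ X + τ (X + e))) :=
        Summable.tsum_le_tsum hpt s0 (s1.add ((s2.add s3).mul_left _))
    _ = ∑ X ∈ T, ν X * (√(f (X + e)) - √(f X)) ^ 2 + C₂ * (∑' X, τ X + ∑' X, τ X) := by
        rw [Summable.tsum_add s1 ((s2.add s3).mul_left _), tsum_mul_left, Summable.tsum_add s2 s3,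
          tsum_shift τ e, tsum_eq_sum (s := T) fun X hX => if_neg hX]
        congr 1
        exact Finset.sum_congr rfl fun X hX => if_pos hX
    _ ≤ C₁ * ∑ J ∈ jumps, jumpEnergy Θ c n S π J + C₂ * (C₃ / n ^ 2 + C₃ / n ^ 2) := by gcongr
    _ ≤ _ := by
        have p1 : 0 ≤ 2 * C₂ * C₃ * ∑ J ∈ jumps, jumpEnergy Θ c n S π J := by positivity
        have p2 : 0 ≤ C₁ * (1 / (n : ℝ) ^ 2) := by positivity
        have p3 : C₂ * (C₃ / (n : ℝ) ^ 2 + C₃ / n ^ 2) = 2 * C₂ * C₃ * (1 / (n : ℝ) ^ 2) := by ring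
        rw [p3]
        linarith

end Fisher

end

noncomputable section

/-! ### Weighted variation of the density, and linearisation of the rates. -/

section FisherBound

variable {d : ℕ} {Θ : Matrix (Fin d) (Fin d) ℝ} {c : Fin d → ℝ} {δ : ℝ}
  {jumps : Finset (Fin d → ℤ)} {g : (Fin d → ℤ) → ℝ} {u : (Fin d → ℤ) → Fin d → ℝ}
  {rate : ℕ → (Fin d → ℤ) → (Fin d → ℤ) → ℝ}

theorem summable_ite_of_nonneg {α : Type*} {F : α → ℝ} (hF : Summable F) (hF0 : ∀ x, 0 ≤ F x)
    (p : α → Prop) [DecidablePred p] : Summable fun x => if p x then F x else 0 :=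
  Summable.of_nonneg_of_le (fun x => by split_ifs <;> simp [hF0])
    (fun x => by split_ifs <;> simp [hF0]) hF

open Classical in
/-- The weighted variation of the density is controlled by the energy of its square root. -/
theorem LatticeModel.exists_variation_le (M : LatticeModel Θ c δ jumps g u rate)
    (a : Fin d → ℤ) : ∃ C : ℝ, 0 < C ∧ ∀ n : ℕ, 1 ≤ n → ∀ S : Finset (Fin d → ℤ),
      (∀ X, X ∈ S ↔ qform Θ (devVec c n X) ≤ (n * δ) ^ 2) → ∀ π,
      IsStationaryLaw jumps (rate n) S π → ∀ (p : (Fin d → ℤ) → Prop) (t : ℝ), 0 < t →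
      ∑' X, (if p X then gaussWeight Θ c n X * (1 + qform Θ (devVec c n X) / n) *
        |gaussDensity Θ c n π (X + a) - gaussDensity Θ c n π X| else 0) ≤
      t * ∑' X, (if p X then gaussWeight Θ c n X * (√(gaussDensity Θ c n π (X + a)) -
        √(gaussDensity Θ c n π X)) ^ 2 else 0) + C / t := by
  obtain ⟨C₁, hC₁, h₁⟩ := M.exists_moment_le
  obtain ⟨C₂, hC₂, h₂⟩ := exists_weighted_le_shift M.posDef c M.radius_pos.le a
  refine ⟨(C₁ + C₂ * C₁) / 2, by positivity, fun n hn S hS π hπ p t ht => ?_⟩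
  have h1 := h₁ n hn S hS π hπ
  set f := gaussDensity Θ c n π with hf
  set ν := gaussWeight Θ c n with hν
  set w := fun X => 1 + qform Θ (devVec c n X) / n with hw
  have hf0 : ∀ X, 0 ≤ f X := gaussDensity_nonneg hπ.nonneg
  have hfz : ∀ X, X ∉ S → f X = 0 := fun X hX => by rw [hf, gaussDensity, hπ.support X hX, zero_div]
  have hffin : f.support.Finite := finite_support_gaussDensity hπ.support
  have hνp : ∀ X, 0 < ν X := gaussWeight_pos c n
  have hw0 : ∀ X, 0 ≤ w X := fun X => by
    have := qform_nonneg M.posDef (devVec c n X)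
    positivity
  have hsfin : (fun X => √(f X)).support.Finite := hffin.subset fun X hX => by
    intro h0; exact hX (by simp only [h0, Real.sqrt_zero])
  have s0 : Summable fun X => ν X * w X * |f (X + a) - f X| :=
    (summable_mul_diff hffin (fun X => ν X * w X) a).abs.congr fun X => by
      rw [abs_mul, abs_of_nonneg (mul_nonneg (hνp X).le (hw0 X))]
  have s1 : Summable fun X => ν X * (√(f (X + a)) - √(f X)) ^ 2 :=
    summable_of_hasFiniteSupport <| (finite_support_diff hsfin a).subset fun X hX => by
      simp only [Function.mem_support, ne_eq, mul_eq_zero, not_or, pow_eq_zero_iff two_ne_zero]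
        at hX ⊢; exact hX.2
  have s2 : Summable fun X => ν X * w X ^ 2 * f X := by
    simpa using summable_mul_shift hffin (fun X => ν X * w X ^ 2) 0
  have s3 : Summable fun X => ν X * w X ^ 2 * f (X + a) :=
    summable_mul_shift hffin (fun X => ν X * w X ^ 2) a
  have s4 : Summable fun X => ν (X + a) * w (X + a) ^ 2 * f (X + a) :=
    (Equiv.addRight a).summable_iff.2 s2
  have m2 : ∑' X, ν X * w X ^ 2 * f X ≤ C₁ := by
    refine le_trans (le_of_eq ?_) h1
    rw [tsum_eq_sum (s := S) fun X hX => by rw [hfz X hX, mul_zero]]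
    refine Finset.sum_congr rfl fun X _ => ?_
    rw [← gaussWeight_mul_gaussDensity (Θ := Θ) (c := c) n π X]
    ring
  -- The weight is moved from `X` to `X + a`, so that the moment bound covers the shifted density.
  have m3 : ∑' X, ν X * w X ^ 2 * f (X + a) ≤ C₂ * C₁ := by
    calc ∑' X, ν X * w X ^ 2 * f (X + a) ≤
        ∑' X, C₂ * (ν (X + a) * w (X + a) ^ 2 * f (X + a)) := by
          refine Summable.tsum_le_tsum (fun X => ?_) s3 (s4.mul_left _)
          by_cases h : X + a ∈ S
          · have := mul_le_mul_of_nonneg_right (h₂ n hn X ((hS _).1 h)) (hf0 (X + a))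
            linarith
          · rw [hfz _ h]; simp
      _ = C₂ * ∑' X, ν X * w X ^ 2 * f X := by
          rw [tsum_mul_left, tsum_shift (fun X => ν X * w X ^ 2 * f X) a]
      _ ≤ C₂ * C₁ := by gcongr
  have n1 : ∀ X, 0 ≤ ν X * (√(f (X + a)) - √(f X)) ^ 2 := fun X =>
    mul_nonneg (hνp X).le (sq_nonneg _)
  have n2 : ∀ X, 0 ≤ ν X * w X ^ 2 * f X := fun X =>
    mul_nonneg (mul_nonneg (hνp X).le (sq_nonneg _)) (hf0 X)
  have n3 : ∀ X, 0 ≤ ν X * w X ^ 2 * f (X + a) := fun X =>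
    mul_nonneg (mul_nonneg (hνp X).le (sq_nonneg _)) (hf0 _)
  have s5 := summable_ite_of_nonneg s1 n1 p
  have hpt : ∀ X, (if p X then ν X * w X * |f (X + a) - f X| else 0) ≤
      t * (if p X then ν X * (√(f (X + a)) - √(f X)) ^ 2 else 0) +
      1 / (2 * t) * (ν X * w X ^ 2 * f X + ν X * w X ^ 2 * f (X + a)) := by
    intro X
    split_ifs
    · have h := mul_abs_sq_sub_sq_le (w := w X) (Real.sqrt_nonneg (f X))
        (Real.sqrt_nonneg (f (X + a))) ht
      rw [Real.sq_sqrt (hf0 _), Real.sq_sqrt (hf0 _)] at h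
      have h' := mul_le_mul_of_nonneg_left h (hνp X).le
      calc _ = ν X * (w X * |f (X + a) - f X|) := by ring
        _ ≤ _ := h'
        _ = _ := by ring
    · have := n2 X; have := n3 X
      positivity
  calc _ ≤ ∑' X, (t * (if p X then ν X * (√(f (X + a)) - √(f X)) ^ 2 else 0) +
      1 / (2 * t) * (ν X * w X ^ 2 * f X + ν X * w X ^ 2 * f (X + a))) :=
        Summable.tsum_le_tsum hpt
          (summable_ite_of_nonneg s0
            (fun X => mul_nonneg (mul_nonneg (hνp X).le (hw0 X)) (abs_nonneg _)) p)
          ((s5.mul_left t).add ((s2.add s3).mul_left _))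
    _ = t * ∑' X, (if p X then ν X * (√(f (X + a)) - √(f X)) ^ 2 else 0) +
        1 / (2 * t) * (∑' X, ν X * w X ^ 2 * f X + ∑' X, ν X * w X ^ 2 * f (X + a)) := by
        rw [Summable.tsum_add (s5.mul_left t) ((s2.add s3).mul_left _), tsum_mul_left,
          tsum_mul_left, Summable.tsum_add s2 s3]
    _ ≤ t * ∑' X, (if p X then ν X * (√(f (X + a)) - √(f X)) ^ 2 else 0) +
        1 / (2 * t) * (C₁ + C₂ * C₁) := by gcongr
    _ = _ := by ring

open Classical in
/-- The rates of a single jump can be replaced by their linearisation, up to a small error. -/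
theorem LatticeModel.exists_linearisation_le (M : LatticeModel Θ c δ jumps g u rate)
    {J : Fin d → ℤ} (hJ : J ∈ jumps) : ∃ C : ℝ, 0 < C ∧ ∀ᶠ n : ℕ in atTop,
      ∀ S : Finset (Fin d → ℤ), (∀ X, X ∈ S ↔ qform Θ (devVec c n X) ≤ (n * δ) ^ 2) → ∀ π,
      IsStationaryLaw jumps (rate n) S π →
      ∑ X ∈ S, (if X + J ∈ S then gaussWeight Θ c n X * rate n J X *
        (gaussDensity Θ c n π (X + J) - gaussDensity Θ c n π X) else 0) ≤
      ∑' X, gaussWeight Θ c n X * (g J + (u J ⬝ᵥ devVec c n X) / n) *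
        (gaussDensity Θ c n π (X + J) - gaussDensity Θ c n π X) +
      C * (1 / n ^ 2 + 1 / n * ∑' X, (if X ∈ S ∧ X + J ∈ S then gaussWeight Θ c n X *
        (1 + qform Θ (devVec c n X) / n) *
          |gaussDensity Θ c n π (X + J) - gaussDensity Θ c n π X| else 0)) := by
  have hδ := M.radius_pos
  have hΘ := M.posDef
  set R := δ + √(qform Θ (realVec J)) with hR
  have hR0 : 0 ≤ R := by positivity
  obtain ⟨C₁, hC₁, h₁⟩ := exists_boundary_le hΘ hδ c J (ρ := 0)
  obtain ⟨C₂, hC₂, h₂⟩ := M.exists_affine_le hR0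
  obtain ⟨C₃, hC₃, h₃⟩ := M.exists_outerMass_le
  obtain ⟨C₄, hC₄, h₄⟩ := M.taylor
  refine ⟨C₂ * C₁ * (2 * C₃) + C₄, by positivity, ?_⟩
  filter_upwards [h₁, eventually_ge_atTop 1] with n h₁ hn S hS π hπ
  have hn' : (1 : ℝ) ≤ n := by exact_mod_cast hn
  have h1 := h₁ S hS π hπ.nonneg hπ.support
  have h3 := h₃ n hn S hS π hπ
  set f := gaussDensity Θ c n π with hf
  set ν := gaussWeight Θ c n with hν
  set w := fun X => 1 + qform Θ (devVec c n X) / n with hw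
  set ℓ := fun X => g J + (u J ⬝ᵥ devVec c n X) / n with hℓ
  set τ := outerMass Θ c δ n π with hτ
  have hf0 : ∀ X, 0 ≤ f X := gaussDensity_nonneg hπ.nonneg
  have hfz : ∀ X, X ∉ S → f X = 0 := fun X hX => by rw [hf, gaussDensity, hπ.support X hX, zero_div]
  have hffin : f.support.Finite := finite_support_gaussDensity hπ.support
  have hνp : ∀ X, 0 < ν X := gaussWeight_pos c n
  have hw0 : ∀ X, 0 ≤ w X := fun X => by
    have := qform_nonneg hΘ (devVec c n X)
    positivity
  have hτ0 : ∀ X, 0 ≤ τ X := outerMass_nonneg hπ.nonneg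
  have hS' : ∀ X, X ∈ S ↔ √(qform Θ (devVec c n X)) ≤ n * δ := fun X => by
    rw [hS, qform_le_sq_iff _ (by positivity)]
  have s1 : Summable fun X => ν X * ℓ X * (f (X + J) - f X) :=
    summable_mul_diff hffin (fun X => ν X * ℓ X) J
  have s2 : Summable τ := by
    simpa using summable_outerMass (Θ := Θ) (c := c) (δ := δ) (n := n) hπ.support 0
  have s3 : Summable fun X => τ (X + J) := summable_outerMass hπ.support J
  have s4 : Summable fun X => if X ∈ S ∧ X + J ∈ S then ν X * w X * |f (X + J) - f X| else 0 :=
    summable_ite_of_nonneg ((summable_mul_diff hffin (fun X => ν X * w X) J).abs.congr fun X => by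
      rw [abs_mul, abs_of_nonneg (mul_nonneg (hνp X).le (hw0 X))])
      (fun X => mul_nonneg (mul_nonneg (hνp X).le (hw0 X)) (abs_nonneg _)) _
  have s5 : Summable fun X => if X ∈ S ∧ X + J ∈ S then
      ν X * rate n J X * (f (X + J) - f X) else 0 :=
    summable_of_hasFiniteSupport <| S.finite_toSet.subset fun X hX => by
      by_contra h; exact hX (if_neg fun h' => h h'.1)
  -- For jumps inside `S` the Taylor error is at most `C₄ w / n`. The linearised sum runs over all
  -- `X`; its additional terms involve only the density near the boundary and are bounded by the
  -- outer mass.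
  have hpt : ∀ X, (if X ∈ S ∧ X + J ∈ S then ν X * rate n J X * (f (X + J) - f X) else 0) ≤
      ν X * ℓ X * (f (X + J) - f X) + (C₂ * C₁ * (τ X + τ (X + J)) +
      C₄ / n * (if X ∈ S ∧ X + J ∈ S then ν X * w X * |f (X + J) - f X| else 0)) := by
    intro X
    split_ifs with h
    · have e1 := h₄ n hn J hJ X ((hS X).1 h.1)
      have e2 : C₄ * (qform Θ (devVec c n X) / n / n) ≤ C₄ / n * w X := by
        rw [div_mul_eq_mul_div, mul_div_assoc]
        gcongr
        simp only [hw]; linarith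
      have e3 : (rate n J X - ℓ X) * (f (X + J) - f X) ≤ C₄ / n * w X * |f (X + J) - f X| := by
        refine (le_abs_self _).trans ?_
        rw [abs_mul]
        exact mul_le_mul_of_nonneg_right (e1.trans e2) (abs_nonneg _)
      have e4 := mul_le_mul_of_nonneg_left e3 (hνp X).le
      have e5 : 0 ≤ C₂ * C₁ * (τ X + τ (X + J)) :=
        mul_nonneg (by positivity) (add_nonneg (hτ0 _) (hτ0 _))
      linarith
    · have e1 := h1 X fun h' => h ⟨h'.1, h'.2.2⟩
      have e2 : |ℓ X * (f (X + J) - f X)| ≤ C₂ * (f X + f (X + J)) := by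
        by_cases h0 : f X = 0 ∧ f (X + J) = 0
        · rw [h0.1, h0.2]; simp
        · have hq : qform Θ (devVec c n X) ≤ (n * R) ^ 2 := by
            rw [qform_le_sq_iff _ (by positivity)]
            have hA0 : 0 ≤ √(qform Θ (realVec J)) := Real.sqrt_nonneg _
            have hA1 : √(qform Θ (realVec J)) ≤ n * √(qform Θ (realVec J)) :=
              le_mul_of_one_le_left hA0 hn'
            rw [hR, mul_add]
            by_cases hX : X ∈ S
            · linarith [(hS' X).1 hX]
            · have hXJ : X + J ∈ S := by
                by_contra hXJ; exact h0 ⟨hfz _ hX, hfz _ hXJ⟩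
              have := sqrt_qform_devVec_le_of_add hΘ c n X J
              linarith [(hS' _).1 hXJ]
          rw [abs_mul]
          refine mul_le_mul (h₂ n hn J hJ X hq) ?_ (abs_nonneg _) hC₂.le
          rw [abs_le]
          constructor <;> linarith [hf0 X, hf0 (X + J)]
      have e3 := mul_le_mul_of_nonneg_left ((abs_le.1 e2).1) (hνp X).le
      have e4 := mul_le_mul_of_nonneg_left e1 hC₂.le
      rw [mul_zero, add_zero]
      linarith
  calc _ = ∑' X, (if X ∈ S ∧ X + J ∈ S then ν X * rate n J X * (f (X + J) - f X) else 0) := by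
        rw [tsum_eq_sum (s := S) fun X hX => if_neg fun h => hX h.1]
        exact Finset.sum_congr rfl fun X hX => by simp only [hX, true_and]
    _ ≤ ∑' X, (ν X * ℓ X * (f (X + J) - f X) + (C₂ * C₁ * (τ X + τ (X + J)) +
      C₄ / n * (if X ∈ S ∧ X + J ∈ S then ν X * w X * |f (X + J) - f X| else 0))) :=
        Summable.tsum_le_tsum hpt s5
          (s1.add (((s2.add s3).mul_left _).add (s4.mul_left _)))
    _ = ∑' X, ν X * ℓ X * (f (X + J) - f X) + (C₂ * C₁ * (∑' X, τ X + ∑' X, τ X) +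
      C₄ / n * ∑' X, (if X ∈ S ∧ X + J ∈ S then ν X * w X * |f (X + J) - f X| else 0)) := by
        rw [Summable.tsum_add s1 (((s2.add s3).mul_left _).add (s4.mul_left _)),
          Summable.tsum_add ((s2.add s3).mul_left _) (s4.mul_left _), tsum_mul_left,
          tsum_mul_left, Summable.tsum_add s2 s3, tsum_shift τ J]
    _ ≤ _ := by
        set E := ∑' X, (if X ∈ S ∧ X + J ∈ S then ν X * w X * |f (X + J) - f X| else 0) with hE
        have hE0 : 0 ≤ E := tsum_nonneg fun X => by
          split_ifs
          · exact mul_nonneg (mul_nonneg (hνp X).le (hw0 X)) (abs_nonneg _)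
          · exact le_rfl
        have p1 : C₂ * C₁ * (∑' X, τ X + ∑' X, τ X) ≤ C₂ * C₁ * (2 * C₃) * (1 / n ^ 2) := by
          calc _ ≤ C₂ * C₁ * (C₃ / n ^ 2 + C₃ / n ^ 2) := by gcongr
            _ = _ := by ring
        have p2 : 0 ≤ C₄ * (1 / (n : ℝ) ^ 2) := by positivity
        have p3 : 0 ≤ C₂ * C₁ * (2 * C₃) * (1 / n * E) := by positivity
        have p4 : C₄ / n * E = C₄ * (1 / n * E) := by ring
        rw [p4]
        linarith

theorem jumpEnergy_eq_tsum (n : ℕ) (S : Finset (Fin d → ℤ)) (π : (Fin d → ℤ) → ℝ)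
    (J : Fin d → ℤ) [DecidablePred fun X => X ∈ S ∧ X + J ∈ S] :
    jumpEnergy Θ c n S π J = ∑' X, (if X ∈ S ∧ X + J ∈ S then gaussWeight Θ c n X *
      (√(gaussDensity Θ c n π (X + J)) - √(gaussDensity Θ c n π X)) ^ 2 else 0) := by
  rw [tsum_eq_sum (s := S) fun X hX => if_neg fun h => hX h.1, jumpEnergy]
  refine Finset.sum_congr rfl fun X hX => ?_
  by_cases h : X + J ∈ S
  · rw [if_pos h, if_pos ⟨hX, h⟩]
  · rw [if_neg h, if_neg fun h' => h h'.2]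

end FisherBound

end

noncomputable section

/-! ### The energy bound, and the distance between stationary laws. -/

section Comparison

variable {d : ℕ} {Θ : Matrix (Fin d) (Fin d) ℝ} {c : Fin d → ℝ} {δ : ℝ}
  {jumps : Finset (Fin d → ℤ)} {g : (Fin d → ℤ) → ℝ} {u : (Fin d → ℤ) → Fin d → ℝ}
  {rate : ℕ → (Fin d → ℤ) → (Fin d → ℤ) → ℝ}

open Classical in
/-- The Fisher information of a stationary law relative to the Gaussian weight. -/
theorem LatticeModel.exists_jumpEnergy_le (M : LatticeModel Θ c δ jumps g u rate) :
    ∃ C : ℝ, 0 < C ∧ ∀ᶠ n : ℕ in atTop, ∀ S : Finset (Fin d → ℤ),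
      (∀ X, X ∈ S ↔ qform Θ (devVec c n X) ≤ (n * δ) ^ 2) → ∀ π,
      IsStationaryLaw jumps (rate n) S π →
      ∑ J ∈ jumps, jumpEnergy Θ c n S π J ≤ C * (1 / n ^ 2) := by
  obtain ⟨ε, hε, hlow⟩ := M.lower
  obtain ⟨C₀, hC₀, h₀⟩ := abs_sum_affine_diff_le M.posDef c M.equilibrium M.lyapunov
    M.radius_pos.le
  choose! A hA hlin using fun J hJ => M.exists_linearisation_le (J := J) hJ
  choose K hK hvar using M.exists_variation_le
  choose D hD hcoord using M.exists_coordinate_energy_le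
  set L := C₀ * ∑ i, D i + ∑ J ∈ jumps, A J + 1 with hL
  have hsD : 0 ≤ ∑ i, D i := Finset.sum_nonneg fun i _ => (hD i).le
  have hsA : 0 ≤ ∑ J ∈ jumps, A J := Finset.sum_nonneg fun J hJ => (hA J hJ).le
  have hsK : 0 ≤ ∑ i : Fin d, K (Pi.single i 1) := Finset.sum_nonneg fun i _ => (hK _).le
  have hsAK : 0 ≤ ∑ J ∈ jumps, A J * K J :=
    Finset.sum_nonneg fun J hJ => mul_nonneg (hA J hJ).le (hK J).le
  have hL0 : 0 < L := by positivity
  -- The variation bound is used with `t = ηn`. Together with the prefactor `1/n`, the energy then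
  -- reappears on the right with coefficient at most `ηL = ε/2`, half of that on the left, and the
  -- moment terms are of order `n⁻²`.
  set η := ε / (2 * L) with hη
  have hη0 : 0 < η := by positivity
  set B := C₀ * (η * ∑ i, D i + (∑ i : Fin d, K (Pi.single i 1)) / η) +
    (∑ J ∈ jumps, A J + (∑ J ∈ jumps, A J * K J) / η) with hB
  have hB0 : 0 ≤ B := by positivity
  refine ⟨2 * B / ε + 1, by positivity, ?_⟩
  filter_upwards [eventually_ge_atTop 1, (Filter.eventually_all_finset jumps).2 hlin,
    Filter.eventually_all.2 hcoord] with n hn hlin hcoord S hS π hπ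
  have hn' : (1 : ℝ) ≤ n := by exact_mod_cast hn
  have hn0 : (0 : ℝ) < n := by linarith
  set E := ∑ J ∈ jumps, jumpEnergy Θ c n S π J with hE
  have hE0 : 0 ≤ E := Finset.sum_nonneg fun J _ => jumpEnergy_nonneg n S π J
  set f := gaussDensity Θ c n π with hf
  set ν := gaussWeight Θ c n with hν
  have hffin : f.support.Finite := finite_support_gaussDensity hπ.support
  have hfz : ∀ X, X ∉ S → f X = 0 := fun X hX => by rw [hf, gaussDensity, hπ.support X hX, zero_div]
  have ht : 0 < η * n := by positivity
  have hr : ∀ J ∈ jumps, ∀ X ∈ S, 0 ≤ rate n J X := fun J hJ X hX =>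
    hε.le.trans (hlow n hn J hJ X ((hS X).1 hX))
  have e1 := hπ.entropy_dissipation (Θ := Θ) (c := c) hr n
  have e2 : ε * E ≤ ∑ X ∈ S, ∑ J ∈ jumps, (if X + J ∈ S then ν X * rate n J X *
      (√(f (X + J)) - √(f X)) ^ 2 else 0) := by
    rw [hE, Finset.mul_sum, Finset.sum_comm]
    refine Finset.sum_le_sum fun J hJ => ?_
    rw [jumpEnergy, Finset.mul_sum]
    refine Finset.sum_le_sum fun X hX => ?_
    have hνp := gaussWeight_pos (Θ := Θ) c n X
    split_ifs
    · have := mul_le_mul_of_nonneg_left (hlow n hn J hJ X ((hS X).1 hX))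
        (mul_nonneg hνp.le (sq_nonneg (√(f (X + J)) - √(f X))))
      linarith
    · simp
  rw [Finset.sum_comm (s := S) (t := jumps) (f := fun X J => if X + J ∈ S then
      ν X * rate n J X * (f (X + J) - f X) else 0)] at e1
  have e3 : ∑ J ∈ jumps, ∑' X, ν X * (g J + (u J ⬝ᵥ devVec c n X) / n) * (f (X + J) - f X) ≤
      C₀ * (η * (∑ i, D i) * (E + 1 / n ^ 2) +
        (∑ i : Fin d, K (Pi.single i 1)) / η * (1 / n ^ 2)) := by
    have h1 := (abs_le.1 (h₀ n hn f hffin fun X hX => (hS X).1 (by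
      by_contra h; exact hX (hfz X h)))).2
    have h2 : ∑ i : Fin d, ∑' X, ν X * (1 + qform Θ (devVec c n X) / n) *
        |f (X + Pi.single i 1) - f X| ≤
        ∑ i : Fin d, (η * n * (D i * (E + 1 / n ^ 2)) + K (Pi.single i 1) / (η * n)) := by
      refine Finset.sum_le_sum fun i _ => ?_
      have h3 := hvar (Pi.single i 1) n hn S hS π hπ (fun _ => True) (η * n) ht
      simp only [if_true] at h3
      refine h3.trans ?_
      gcongr
      exact hcoord i S hS π hπ
    have h4 : ∑ i : Fin d, (η * n * (D i * (E + 1 / n ^ 2)) + K (Pi.single i 1) / (η * n)) =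
        n * (η * (∑ i, D i) * (E + 1 / n ^ 2) +
        (∑ i : Fin d, K (Pi.single i 1)) / η * (1 / n ^ 2)) := by
      rw [Finset.sum_add_distrib, ← Finset.mul_sum, ← Finset.sum_mul, ← Finset.sum_div]
      field_simp
    rw [h4] at h2
    have h5 := h1.trans (mul_le_mul_of_nonneg_left h2 hC₀.le)
    rw [mul_left_comm] at h5
    exact le_of_mul_le_mul_left h5 hn0
  have e4 : ∑ J ∈ jumps, A J * (1 / n ^ 2 + 1 / n * ∑' X, (if X ∈ S ∧ X + J ∈ S then ν X *
      (1 + qform Θ (devVec c n X) / n) * |f (X + J) - f X| else 0)) ≤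
      (∑ J ∈ jumps, A J) * (1 / n ^ 2 + η * E) + (∑ J ∈ jumps, A J * K J) / η * (1 / n ^ 2) := by
    rw [Finset.sum_mul, Finset.sum_div, Finset.sum_mul, ← Finset.sum_add_distrib]
    refine Finset.sum_le_sum fun J hJ => ?_
    have h1 : ∑' X, (if X ∈ S ∧ X + J ∈ S then ν X * (1 + qform Θ (devVec c n X) / n) *
        |f (X + J) - f X| else 0) ≤ η * n * jumpEnergy Θ c n S π J + K J / (η * n) := by
      rw [jumpEnergy_eq_tsum]
      convert hvar J n hn S hS π hπ (fun X => X ∈ S ∧ X + J ∈ S) (η * n) ht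
    have h2 : jumpEnergy Θ c n S π J ≤ E :=
      Finset.single_le_sum (fun K _ => jumpEnergy_nonneg n S π K) hJ
    have h3 := h1.trans (add_le_add_left (mul_le_mul_of_nonneg_left h2 ht.le) _)
    have h4 : 1 / (n : ℝ) * (η * n * E + K J / (η * n)) = η * E + K J / η * (1 / n ^ 2) := by
      field_simp
    have h5 := mul_le_mul_of_nonneg_left h3 (show 0 ≤ 1 / (n : ℝ) by positivity)
    rw [h4] at h5
    have h6 := mul_le_mul_of_nonneg_left h5 (hA J hJ).le
    have h7 : A J * (η * E + K J / η * (1 / n ^ 2)) =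
      A J * (η * E) + A J * K J / η * (1 / n ^ 2) := by ring
    rw [h7] at h6
    rw [mul_add, mul_add]
    linarith
  have e5 := Finset.sum_le_sum fun J hJ => hlin J hJ S hS π hπ
  rw [Finset.sum_add_distrib] at e5
  have e6 : ε * E ≤ η * (L - 1) * E + B * (1 / n ^ 2) := by
    have h := e2.trans (e1.trans (e5.trans (add_le_add e3 e4)))
    refine h.trans (le_of_eq ?_)
    rw [hB, hL]
    ring
  have e7 : η * (L - 1) * E ≤ ε / 2 * E := by
    have h : η * L = ε / 2 := by rw [hη]; field_simp
    have := mul_nonneg hη0.le hE0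
    have h' : η * (L - 1) * E = η * L * E - η * E := by ring
    rw [h', h]
    linarith
  have e8 : ε / 2 * E ≤ B * (1 / n ^ 2) := by linarith
  have e9 : E ≤ 2 * B / ε * (1 / n ^ 2) := by
    rw [div_mul_eq_mul_div, le_div_iff₀ hε]
    linarith
  have : 0 ≤ 1 / (n : ℝ) ^ 2 := by positivity
  linarith

/-- The square root of a stationary law is close to a multiple of the root of the Gaussian
weight. -/
theorem LatticeModel.exists_sqrt_close (M : LatticeModel Θ c δ jumps g u rate) :
    ∃ C : ℝ, 0 < C ∧ ∀ᶠ n : ℕ in atTop, ∀ S : Finset (Fin d → ℤ),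
      (∀ X, X ∈ S ↔ qform Θ (devVec c n X) ≤ (n * δ) ^ 2) → ∀ π,
      IsStationaryLaw jumps (rate n) S π →
      ∃ a : ℝ, 0 ≤ a ∧ ∑ X ∈ S, (√(π X) - a * √(gaussWeight Θ c n X)) ^ 2 ≤ C / n := by
  obtain ⟨C₁, hC₁, h₁⟩ := M.exists_jumpEnergy_le
  choose D hD hcoord using M.exists_coordinate_energy_le
  obtain ⟨C₂, hC₂, N, hN, h₂⟩ := poincare_gaussWeight M.posDef c M.radius_pos
  have hsD : 0 ≤ ∑ i, D i := Finset.sum_nonneg fun i _ => (hD i).le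
  refine ⟨C₂ * ((∑ i, D i) * (C₁ + 1) + 1), by positivity, ?_⟩
  filter_upwards [eventually_ge_atTop N, h₁, Filter.eventually_all.2 hcoord] with
    n hn h₁ hcoord S hS π hπ
  have hn' : (1 : ℝ) ≤ n := by exact_mod_cast hN.trans hn
  have hf0 : ∀ X, 0 ≤ gaussDensity Θ c n π X := gaussDensity_nonneg hπ.nonneg
  have hνp : ∀ X, 0 < gaussWeight Θ c n X := gaussWeight_pos c n
  obtain ⟨a, ha, h⟩ := h₂ n hn S hS (fun X => √(gaussDensity Θ c n π X))
    (fun X => Real.sqrt_nonneg _)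
    (fun X hX => by simp only [gaussDensity, hπ.support X hX, zero_div, Real.sqrt_zero])
    (by
      simp only [Real.sq_sqrt (hf0 _), gaussWeight_mul_gaussDensity]
      exact hπ.mass.le)
  refine ⟨a, ha, ?_⟩
  have h1 := h₁ S hS π hπ
  have h2 : ∑ i : Fin d, ∑' X, gaussWeight Θ c n X *
      (√(gaussDensity Θ c n π (X + Pi.single i 1)) - √(gaussDensity Θ c n π X)) ^ 2 ≤
      (∑ i, D i) * (C₁ + 1) * (1 / n ^ 2) := by
    rw [mul_assoc, Finset.sum_mul]
    refine Finset.sum_le_sum fun i _ => (hcoord i S hS π hπ).trans ?_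
    refine mul_le_mul_of_nonneg_left ?_ (hD i).le
    linarith
  calc ∑ X ∈ S, (√(π X) - a * √(gaussWeight Θ c n X)) ^ 2 =
      ∑ X ∈ S, gaussWeight Θ c n X * (√(gaussDensity Θ c n π X) - a) ^ 2 := by
        refine Finset.sum_congr rfl fun X _ => ?_
        rw [← gaussWeight_mul_gaussDensity (Θ := Θ) (c := c) n π X, Real.sqrt_mul (hνp X).le,
          mul_comm a, ← mul_sub, mul_pow, Real.sq_sqrt (hνp X).le]
    _ ≤ _ := h
    _ ≤ C₂ * n * ((∑ i, D i) * (C₁ + 1) * (1 / n ^ 2) + 1 / n ^ 2) := by gcongr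
    _ = _ := by field_simp

/-- Both `a‖v‖` and `b‖v‖` are close to 1, hence to each other. The common direction `v` need not be
normalised, so the partition function of the Gaussian weight is never computed. -/
theorem norm_sub_le_of_close {E : Type*} [NormedAddCommGroup E] [NormedSpace ℝ E] {x y v : E}
    (hx : ‖x‖ = 1) (hy : ‖y‖ = 1) {a b κ κ' : ℝ} (ha : 0 ≤ a) (hb : 0 ≤ b)
    (hxa : ‖x - a • v‖ ≤ κ) (hyb : ‖y - b • v‖ ≤ κ') : ‖x - y‖ ≤ 2 * (κ + κ') := by
  have h1 := (abs_norm_sub_norm_le x (a • v)).trans hxa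
  have h2 := (abs_norm_sub_norm_le y (b • v)).trans hyb
  rw [hx, norm_smul, Real.norm_eq_abs, abs_of_nonneg ha] at h1
  rw [hy, norm_smul, Real.norm_eq_abs, abs_of_nonneg hb] at h2
  have h3 : ‖a • v - b • v‖ ≤ κ + κ' := by
    rw [← sub_smul, norm_smul, Real.norm_eq_abs,
      show |a - b| * ‖v‖ = |a * ‖v‖ - b * ‖v‖| by rw [← sub_mul, abs_mul, abs_norm], abs_le]
    have := abs_le.1 h1
    have := abs_le.1 h2
    constructor <;> linarith
  have h4 : x - y = (x - a • v) + (a • v - b • v) + -(y - b • v) := by abel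
  rw [h4]
  refine (norm_add₃_le).trans ?_
  rw [norm_neg]
  linarith

/-- Factor `|π - π'| = |√π - √π'| (√π + √π')` and apply Cauchy–Schwarz: the roots are unit vectors,
so the second factor has norm at most 2. -/
theorem sum_abs_sub_le_of_sqrt_close {α : Type*} {S : Finset α} {π π' γ : α → ℝ}
    (hπ : ∀ x, 0 ≤ π x) (hπ' : ∀ x, 0 ≤ π' x) (h1 : ∑ x ∈ S, π x = 1) (h1' : ∑ x ∈ S, π' x = 1)
    {a b κ κ' : ℝ} (ha : 0 ≤ a) (hb : 0 ≤ b)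
    (hxa : ∑ x ∈ S, (√(π x) - a * γ x) ^ 2 ≤ κ) (hyb : ∑ x ∈ S, (√(π' x) - b * γ x) ^ 2 ≤ κ') :
    ∑ x ∈ S, |π x - π' x| ≤ 4 * (√κ + √κ') := by
  classical
  set x : EuclideanSpace ℝ S := WithLp.toLp 2 fun s => √(π s) with hx
  set y : EuclideanSpace ℝ S := WithLp.toLp 2 fun s => √(π' s) with hy
  set v : EuclideanSpace ℝ S := WithLp.toLp 2 fun s => γ s with hv
  have nx : ‖x‖ = 1 := by
    rw [EuclideanSpace.norm_eq, Real.sqrt_eq_one, ← h1, ← Finset.sum_coe_sort S]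
    refine Finset.sum_congr rfl fun s _ => ?_
    simp [hx, Real.sq_sqrt (hπ _)]
  have ny : ‖y‖ = 1 := by
    rw [EuclideanSpace.norm_eq, Real.sqrt_eq_one, ← h1', ← Finset.sum_coe_sort S]
    refine Finset.sum_congr rfl fun s _ => ?_
    simp [hy, Real.sq_sqrt (hπ' _)]
  have n1 : ‖x - a • v‖ ≤ √κ := by
    rw [EuclideanSpace.norm_eq]
    refine Real.sqrt_le_sqrt (le_trans (le_of_eq ?_) hxa)
    rw [← Finset.sum_coe_sort S]
    refine Finset.sum_congr rfl fun s _ => ?_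
    simp [hx, hv]
  have n2 : ‖y - b • v‖ ≤ √κ' := by
    rw [EuclideanSpace.norm_eq]
    refine Real.sqrt_le_sqrt (le_trans (le_of_eq ?_) hyb)
    rw [← Finset.sum_coe_sort S]
    refine Finset.sum_congr rfl fun s _ => ?_
    simp [hy, hv]
  have h := norm_sub_le_of_close nx ny ha hb n1 n2
  have hp : ‖x + y‖ ≤ 2 := (norm_add_le x y).trans (by rw [nx, ny]; norm_num)
  have e : ∑ s ∈ S, |π s - π' s| = ∑ s : S, |(x - y) s| * |(x + y) s| := by
    rw [← Finset.sum_coe_sort S]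
    refine Finset.sum_congr rfl fun s _ => ?_
    rw [← abs_mul]
    congr 1
    simp only [hx, hy, PiLp.sub_apply, PiLp.add_apply]
    nlinarith [Real.sq_sqrt (hπ s), Real.sq_sqrt (hπ' s)]
  have cs := Real.sum_mul_le_sqrt_mul_sqrt (Finset.univ : Finset S) (fun s => |(x - y) s|)
    fun s => |(x + y) s|
  have q1 : √(∑ s : S, |(x - y) s| ^ 2) = ‖x - y‖ := by rw [EuclideanSpace.norm_eq]; rfl
  have q2 : √(∑ s : S, |(x + y) s| ^ 2) = ‖x + y‖ := by rw [EuclideanSpace.norm_eq]; rfl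
  rw [q1, q2, ← e] at cs
  have := mul_le_mul_of_nonneg_left hp (norm_nonneg (x - y))
  linarith

/-- Stationary laws of two models with the same Gaussian approximation are close. -/
theorem LatticeModel.exists_sum_abs_sub_le (M : LatticeModel Θ c δ jumps g u rate)
    {jumps' : Finset (Fin d → ℤ)} {g' : (Fin d → ℤ) → ℝ} {u' : (Fin d → ℤ) → Fin d → ℝ}
    {rate' : ℕ → (Fin d → ℤ) → (Fin d → ℤ) → ℝ} (M' : LatticeModel Θ c δ jumps' g' u' rate') :
    ∃ C : ℝ, 0 < C ∧ ∀ᶠ n : ℕ in atTop, ∀ S : Finset (Fin d → ℤ),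
      (∀ X, X ∈ S ↔ qform Θ (devVec c n X) ≤ (n * δ) ^ 2) → ∀ π π',
      IsStationaryLaw jumps (rate n) S π → IsStationaryLaw jumps' (rate' n) S π' →
      ∑ X ∈ S, |π X - π' X| ≤ C / √n := by
  obtain ⟨C, hC, h⟩ := M.exists_sqrt_close
  obtain ⟨C', hC', h'⟩ := M'.exists_sqrt_close
  refine ⟨4 * (√C + √C'), by positivity, ?_⟩
  filter_upwards [h, h'] with n h h' S hS π π' hπ hπ'
  obtain ⟨a, ha, e⟩ := h S hS π hπ
  obtain ⟨b, hb, e'⟩ := h' S hS π' hπ'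
  refine (sum_abs_sub_le_of_sqrt_close hπ.nonneg hπ'.nonneg hπ.mass hπ'.mass ha hb e e').trans
    (le_of_eq ?_)
  rw [Real.sqrt_div' _ (Nat.cast_nonneg n), Real.sqrt_div' _ (Nat.cast_nonneg n)]
  ring

end Comparison

end

noncomputable section

/-! ### Finite Markov chains -/

section FiniteChain

variable {ι : Type*} [Fintype ι] [DecidableEq ι]

/-- The triangle inequality in the balance equation of each state shows that `|v| Q` has nonnegative
entries. These add up to zero because the rows of `Q` do, so they all vanish. Hence positive and
negative parts of invariant vectors are invariant. -/
theorem vecMul_abs_eq_zero {Q : Matrix ι ι ℝ} (hoff : ∀ x y, x ≠ y → 0 ≤ Q x y)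
    (hrow : ∀ x, ∑ y, Q x y = 0) {v : ι → ℝ} (hv : Matrix.vecMul v Q = 0) :
    Matrix.vecMul (fun x => |v x|) Q = 0 := by
  have hnn : ∀ y, 0 ≤ Matrix.vecMul (fun x => |v x|) Q y := by
    intro y
    have h1 : ∑ x, v x * Q x y = 0 := congrFun hv y
    change 0 ≤ ∑ x, |v x| * Q x y
    rw [← Finset.add_sum_erase _ _ (Finset.mem_univ y)] at h1 ⊢
    have hQ : Q y y ≤ 0 := by
      have h := hrow y
      rw [← Finset.add_sum_erase _ _ (Finset.mem_univ y)] at h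
      have : 0 ≤ ∑ x ∈ Finset.univ.erase y, Q y x :=
        Finset.sum_nonneg fun x hx => hoff y x (Finset.ne_of_mem_erase hx).symm
      linarith
    have h2 : |∑ x ∈ Finset.univ.erase y, v x * Q x y| ≤
        ∑ x ∈ Finset.univ.erase y, |v x| * Q x y := by
      refine (Finset.abs_sum_le_sum_abs _ _).trans (Finset.sum_le_sum fun x hx => ?_)
      rw [abs_mul, abs_of_nonneg (hoff x y (Finset.ne_of_mem_erase hx))]
    have h3 : |∑ x ∈ Finset.univ.erase y, v x * Q x y| = -(|v y| * Q y y) := by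
      rw [show ∑ x ∈ Finset.univ.erase y, v x * Q x y = -(v y * Q y y) by linarith, abs_neg,
        abs_mul, abs_of_nonpos hQ]
      ring
    linarith
  have hsum : ∑ y, Matrix.vecMul (fun x => |v x|) Q y = 0 := by
    change ∑ y, ∑ x, |v x| * Q x y = 0
    rw [Finset.sum_comm]
    exact Finset.sum_eq_zero fun x _ => by rw [← Finset.mul_sum, hrow, mul_zero]
  funext y
  exact (Finset.sum_eq_zero_iff_of_nonneg fun y _ => hnn y).1 hsum y (Finset.mem_univ y)

/-- A finite `Q`-matrix has an invariant probability vector. -/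
theorem exists_invariant_probability [Nonempty ι] {Q : Matrix ι ι ℝ}
    (hoff : ∀ x y, x ≠ y → 0 ≤ Q x y) (hrow : ∀ x, ∑ y, Q x y = 0) :
    ∃ v : ι → ℝ, (∀ x, 0 ≤ v x) ∧ ∑ x, v x = 1 ∧ Matrix.vecMul v Q = 0 := by
  have hdet : Q.det = 0 := by
    refine Matrix.exists_mulVec_eq_zero_iff.1 ⟨fun _ => 1, ?_, ?_⟩
    · intro h
      have := congrFun h (Classical.arbitrary ι)
      simp at this
    · funext x
      simpa [Matrix.mulVec, dotProduct] using hrow x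
  obtain ⟨v, hv0, hv⟩ := Matrix.exists_vecMul_eq_zero_iff.2 hdet
  have h := vecMul_abs_eq_zero hoff hrow hv
  have hm : 0 < ∑ x, |v x| := by
    obtain ⟨x, hx⟩ := Function.ne_iff.1 hv0
    exact Finset.sum_pos' (fun _ _ => abs_nonneg _) ⟨x, Finset.mem_univ x, abs_pos.2 hx⟩
  refine ⟨(∑ x, |v x|)⁻¹ • fun x => |v x|, fun x => ?_, ?_, ?_⟩
  · simp only [Pi.smul_apply, smul_eq_mul]; positivity
  · simp only [Pi.smul_apply, smul_eq_mul]
    rw [← Finset.mul_sum, inv_mul_cancel₀ hm.ne']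
  · rw [Matrix.smul_vecMul, h, smul_zero]

/-- Two different invariant probability vectors give rise to two with disjoint supports. -/
theorem exists_disjoint_invariant {Q : Matrix ι ι ℝ} (hoff : ∀ x y, x ≠ y → 0 ≤ Q x y)
    (hrow : ∀ x, ∑ y, Q x y = 0) {v v' : ι → ℝ} (hv : Matrix.vecMul v Q = 0)
    (hv' : Matrix.vecMul v' Q = 0) (h1 : ∑ x, v x = 1) (h1' : ∑ x, v' x = 1) (hne : v ≠ v') :
    ∃ w w' : ι → ℝ, (∀ x, 0 ≤ w x) ∧ (∀ x, 0 ≤ w' x) ∧ ∑ x, w x = 1 ∧ ∑ x, w' x = 1 ∧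
      Matrix.vecMul w Q = 0 ∧ Matrix.vecMul w' Q = 0 ∧ ∑ x, |w x - w' x| = 2 := by
  set z := v - v' with hz
  have hzQ : Matrix.vecMul z Q = 0 := by rw [hz, Matrix.sub_vecMul, hv, hv', sub_zero]
  have haQ := vecMul_abs_eq_zero hoff hrow hzQ
  have hz0 : ∑ x, z x = 0 := by
    simp only [hz, Pi.sub_apply, Finset.sum_sub_distrib, h1, h1', sub_self]
  have hm : 0 < ∑ x, |z x| := by
    obtain ⟨x, hx⟩ := Function.ne_iff.1 hne
    exact Finset.sum_pos' (fun _ _ => abs_nonneg _)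
      ⟨x, Finset.mem_univ x, abs_pos.2 (sub_ne_zero.2 hx)⟩
  set m := ∑ x, |z x| with hmdef
  -- These are the normalised positive and negative parts of `z`; they have equal mass because `z`
  -- sums to zero.
  refine ⟨m⁻¹ • ((fun x => |z x|) + z), m⁻¹ • ((fun x => |z x|) - z), fun x => ?_, fun x => ?_,
    ?_, ?_, ?_, ?_, ?_⟩
  · simp only [Pi.smul_apply, Pi.add_apply, smul_eq_mul]
    have := neg_abs_le (z x)
    exact mul_nonneg (by positivity) (by linarith)
  · simp only [Pi.smul_apply, Pi.sub_apply, smul_eq_mul]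
    have := le_abs_self (z x)
    exact mul_nonneg (by positivity) (by linarith)
  · simp only [Pi.smul_apply, Pi.add_apply, smul_eq_mul]
    rw [← Finset.mul_sum, Finset.sum_add_distrib, hz0, add_zero, inv_mul_cancel₀ hm.ne']
  · simp only [Pi.smul_apply, Pi.sub_apply, smul_eq_mul]
    rw [← Finset.mul_sum, Finset.sum_sub_distrib, hz0, sub_zero, inv_mul_cancel₀ hm.ne']
  · rw [Matrix.smul_vecMul, Matrix.add_vecMul, haQ, hzQ, add_zero, smul_zero]
  · rw [Matrix.smul_vecMul, Matrix.sub_vecMul, haQ, hzQ, sub_zero, smul_zero]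
  · have : ∀ x, |(m⁻¹ • ((fun x => |z x|) + z)) x - (m⁻¹ • ((fun x => |z x|) - z)) x| =
        2 * m⁻¹ * |z x| := by
      intro x
      simp only [Pi.smul_apply, Pi.sub_apply, Pi.add_apply, smul_eq_mul]
      rw [show m⁻¹ * (|z x| + z x) - m⁻¹ * (|z x| - z x) = 2 * m⁻¹ * z x by ring, abs_mul,
        abs_of_nonneg (show 0 ≤ 2 * m⁻¹ by positivity)]
    rw [Finset.sum_congr rfl fun x _ => this x, ← Finset.mul_sum, mul_assoc,
      inv_mul_cancel₀ hm.ne', mul_one]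

open scoped Matrix.Norms.Operator in
/-- A vector is invariant under `exp (t Q)` for `t ≥ 0` if and only if it is annihilated by `Q`. -/
theorem vecMul_exp_eq_self_iff (Q : Matrix ι ι ℝ) (v : ι → ℝ) :
    (∀ t : ℝ, 0 ≤ t → Matrix.vecMul v (NormedSpace.exp (t • Q)) = v) ↔ Matrix.vecMul v Q = 0 := by
  have hd : ∀ t : ℝ, HasDerivAt (fun s : ℝ => Matrix.vecMul v (NormedSpace.exp (s • Q)))
      (Matrix.vecMul v (Q * NormedSpace.exp (t • Q))) t := by
    intro t
    let L : Matrix ι ι ℝ →ₗ[ℝ] (ι → ℝ) :=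
      { toFun := fun B => Matrix.vecMul v B
        map_add' := fun B B' => Matrix.vecMul_add B B' v
        map_smul' := fun r B => by simp [Matrix.vecMul_smul] }
    exact (LinearMap.toContinuousLinearMap L).hasFDerivAt.comp_hasDerivAt t
      (hasDerivAt_exp_smul_const' Q t)
  constructor
  · intro h
    -- Invariance is known for `t ≥ 0` only, so the derivative at zero is taken from the right.
    have h1 := (hd 0).hasDerivWithinAt (s := Set.Ici 0)
    have h2 : HasDerivWithinAt (fun s : ℝ => Matrix.vecMul v (NormedSpace.exp (s • Q))) 0
        (Set.Ici 0) 0 :=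
      (hasDerivWithinAt_const (0 : ℝ) (Set.Ici 0) v).congr (fun s hs => h s hs) (h 0 le_rfl)
    have h3 := (uniqueDiffOn_Ici (0 : ℝ) 0 Set.self_mem_Ici).eq_deriv _ h1 h2
    simpa using h3
  · intro h t _
    have hd0 : ∀ t : ℝ, HasDerivAt (fun s : ℝ => Matrix.vecMul v (NormedSpace.exp (s • Q))) 0 t := by
      intro t
      have := hd t
      rwa [← Matrix.vecMul_vecMul, h, Matrix.zero_vecMul] at this
    have h1 := is_const_of_deriv_eq_zero (fun t => (hd0 t).differentiableAt)
      (fun t => (hd0 t).deriv) t 0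
    simpa using h1

end FiniteChain

/-! ### Equilibria of the truncated process as stationary laws on the state space. -/

namespace JumpProcess

variable {d : ℕ} (P : JumpProcess d) (c : EuclideanSpace ℝ (Fin d))

/-- The rate `g^J(X / n)`. -/
def latticeRate (n : ℕ) (J X : Fin d → ℤ) : ℝ := P.g J ((n : ℝ)⁻¹ • intVec X)

theorem truncGenerator_eq {n : ℕ} {δ : ℝ} (φ : (Fin d → ℤ) → ℝ) {X : Fin d → ℤ}
    (hX : X ∈ P.states c n δ) : P.truncGenerator c n δ φ X =
      n * ∑ J ∈ P.jumps, (if X + J ∈ P.states c n δ then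
        P.latticeRate n J X * (φ (X + J) - φ X) else 0) := by
  rw [truncGenerator, Finset.mul_sum]
  refine Finset.sum_congr rfl fun J _ => ?_
  rw [truncRate, latticeRate]
  by_cases h : X + J ∈ P.states c n δ
  · rw [if_pos ⟨hX, h⟩, if_pos h]; ring
  · rw [if_neg fun h' => h h'.2, if_neg h]; ring

theorem sum_qMatrix_mul {n : ℕ} {δ : ℝ} (φ : (Fin d → ℤ) → ℝ) (X : P.states c n δ) :
    ∑ Y, P.qMatrix c n δ X Y * φ Y = P.truncGenerator c n δ φ X := by
  simp only [qMatrix, Matrix.of_apply, truncGenerator, Finset.sum_mul]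
  rw [Finset.sum_comm]
  refine Finset.sum_congr rfl fun J _ => ?_
  by_cases h : X.1 + J ∈ P.states c n δ
  · have h1 : ∀ Z : P.states c n δ,
        ∑ Y : P.states c n δ, (Pi.single Y.1 1 : (Fin d → ℤ) → ℝ) Z.1 * φ Y = φ Z := by
      intro Z
      rw [Finset.sum_eq_single Z]
      · simp
      · intro Y _ hY
        rw [Pi.single_eq_of_ne fun h => hY (Subtype.ext h.symm), zero_mul]
      · intro h; exact absurd (Finset.mem_univ _) h
    have h2 := h1 ⟨_, h⟩
    have h3 := h1 X
    simp only at h2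
    rw [← h2, ← h3, ← Finset.sum_sub_distrib, Finset.mul_sum]
    refine Finset.sum_congr rfl fun Y _ => by ring
  · rw [truncRate, if_neg fun h' => h h'.2]
    simp

theorem qMatrix_row_sum {n : ℕ} {δ : ℝ} (X : P.states c n δ) :
    ∑ Y, P.qMatrix c n δ X Y = 0 := by
  have := P.sum_qMatrix_mul c (fun _ => 1) X
  simpa [truncGenerator] using this

theorem qMatrix_nonneg {n : ℕ} {δ : ℝ} (X Y : P.states c n δ) (h : X ≠ Y) :
    0 ≤ P.qMatrix c n δ X Y := by
  simp only [qMatrix, Matrix.of_apply, truncGenerator]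
  refine Finset.sum_nonneg fun J hJ => mul_nonneg ?_ ?_
  · rw [truncRate]
    split_ifs
    · exact mul_nonneg (Nat.cast_nonneg n) (P.g_nonneg J hJ _)
    · exact le_rfl
  · rw [Pi.single_eq_of_ne fun h' => h (Subtype.ext h'), sub_zero, Pi.single_apply]
    split_ifs <;> norm_num

theorem sum_mul_truncGenerator {n : ℕ} {δ : ℝ} (v : P.states c n δ → ℝ)
    (φ : (Fin d → ℤ) → ℝ) : ∑ X, v X * P.truncGenerator c n δ φ X =
      ∑ Y, Matrix.vecMul v (P.qMatrix c n δ) Y * φ Y := by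
  simp only [← sum_qMatrix_mul, Matrix.vecMul, dotProduct, Finset.sum_mul, Finset.mul_sum]
  rw [Finset.sum_comm]
  exact Finset.sum_congr rfl fun _ _ => Finset.sum_congr rfl fun _ _ => by ring

/-- Indicators of single states as test functions recover the balance equations; the time scale `n`
cancels. -/
theorem isStationaryLaw_iff {n : ℕ} (hn : 1 ≤ n) {δ : ℝ} {π : (Fin d → ℤ) → ℝ}
    (h0 : ∀ X, 0 ≤ π X) (hS : ∀ X, X ∉ P.states c n δ → π X = 0)
    (h1 : ∑ X ∈ P.states c n δ, π X = 1) :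
    IsStationaryLaw P.jumps (P.latticeRate n) (P.states c n δ) π ↔
      Matrix.vecMul (fun X : P.states c n δ => π X) (P.qMatrix c n δ) = 0 := by
  have hn' : (n : ℝ) ≠ 0 := by positivity
  have key : ∀ φ : (Fin d → ℤ) → ℝ, n * ∑ X ∈ P.states c n δ, π X * ∑ J ∈ P.jumps,
      (if X + J ∈ P.states c n δ then P.latticeRate n J X * (φ (X + J) - φ X) else 0) =
      ∑ Y, Matrix.vecMul (fun X : P.states c n δ => π X) (P.qMatrix c n δ) Y * φ Y := by
    intro φ
    rw [← sum_mul_truncGenerator, Finset.mul_sum, ← Finset.sum_coe_sort]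
    refine Finset.sum_congr rfl fun X _ => ?_
    rw [P.truncGenerator_eq c φ X.2]; ring
  constructor
  · intro h
    funext Y
    have h2 := key (Pi.single Y.1 1)
    rw [h.stationary, mul_zero, Finset.sum_eq_single Y] at h2
    · simpa using h2.symm
    · intro Z _ hZ
      rw [Pi.single_eq_of_ne fun h => hZ (Subtype.ext h), mul_zero]
    · intro h; exact absurd (Finset.mem_univ _) h
  · intro h
    refine ⟨h0, hS, h1, fun φ => ?_⟩
    have h2 := key φ
    rw [h] at h2
    simpa [hn'] using h2

theorem sum_toReal_eq_one {α : Type*} (p : PMF α) {S : Finset α} (hS : p.support ⊆ S) :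
    ∑ x ∈ S, (p x).toReal = 1 := by
  rw [← ENNReal.toReal_sum fun x _ => p.apply_ne_top x, ← ENNReal.toReal_one, ← p.tsum_coe]
  congr 1
  refine (tsum_eq_sum fun x hx => ?_).symm
  by_contra h
  exact hx (hS h)

theorem IsEquilibrium.apply_eq_zero {P : JumpProcess d} {c : EuclideanSpace ℝ (Fin d)} {n : ℕ}
    {δ : ℝ} {p : PMF (Fin d → ℤ)} (hp : P.IsEquilibrium c n δ p) {X : Fin d → ℤ}
    (hX : X ∉ P.states c n δ) : p X = 0 := by
  by_contra h
  exact hX (hp.1 h)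

theorem IsEquilibrium.isStationaryLaw {P : JumpProcess d} {c : EuclideanSpace ℝ (Fin d)} {n : ℕ}
    (hn : 1 ≤ n) {δ : ℝ} {p : PMF (Fin d → ℤ)} (hp : P.IsEquilibrium c n δ p) :
    IsStationaryLaw P.jumps (P.latticeRate n) (P.states c n δ) fun X => (p X).toReal := by
  refine (P.isStationaryLaw_iff c hn (fun X => ENNReal.toReal_nonneg)
    (fun X hX => by rw [hp.apply_eq_zero hX, ENNReal.toReal_zero])
    (sum_toReal_eq_one p hp.1)).2 ?_
  exact (vecMul_exp_eq_self_iff _ _).1 hp.2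

open Classical in
/-- A vector on the state space, extended by zero. -/
def extendZero {S : Finset (Fin d → ℤ)} (v : S → ℝ) (X : Fin d → ℤ) : ℝ :=
  if h : X ∈ S then v ⟨X, h⟩ else 0

theorem extendZero_coe {S : Finset (Fin d → ℤ)} (v : S → ℝ) (X : S) : extendZero v X = v X := by
  rw [extendZero, dif_pos X.2]

theorem isStationaryLaw_extendZero {n : ℕ} (hn : 1 ≤ n) {δ : ℝ} {v : P.states c n δ → ℝ}
    (h0 : ∀ X, 0 ≤ v X) (h1 : ∑ X, v X = 1) (hv : Matrix.vecMul v (P.qMatrix c n δ) = 0) :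
    IsStationaryLaw P.jumps (P.latticeRate n) (P.states c n δ) (extendZero v) := by
  refine (P.isStationaryLaw_iff c hn (fun X => ?_) (fun X hX => by rw [extendZero, dif_neg hX])
    ?_).2 ?_
  · rw [extendZero]; split_ifs <;> simp [h0]
  · rw [← Finset.sum_coe_sort]; simpa only [extendZero_coe] using h1
  · simpa only [extendZero_coe] using hv

/-- If any two stationary laws are closer than `2`, there is exactly one equilibrium. -/
theorem existsUnique_isEquilibrium {n : ℕ} (hn : 1 ≤ n) {δ : ℝ}
    (hne : (P.states c n δ).Nonempty)
    (H : ∀ π π', IsStationaryLaw P.jumps (P.latticeRate n) (P.states c n δ) π →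
      IsStationaryLaw P.jumps (P.latticeRate n) (P.states c n δ) π' →
      ∑ X ∈ P.states c n δ, |π X - π' X| < 2) :
    ∃! p : PMF (Fin d → ℤ), P.IsEquilibrium c n δ p := by
  classical
  have : Nonempty (P.states c n δ) := hne.to_subtype
  obtain ⟨v, hv0, hv1, hv⟩ := exists_invariant_probability
    (P.qMatrix_nonneg c (n := n) (δ := δ)) (P.qMatrix_row_sum c)
  have hlaw := P.isStationaryLaw_extendZero c hn hv0 hv1 hv
  have hsum : ∑ X ∈ P.states c n δ, ENNReal.ofReal (extendZero v X) = 1 := by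
    rw [← ENNReal.ofReal_sum_of_nonneg fun X _ => hlaw.nonneg X, hlaw.mass, ENNReal.ofReal_one]
  set p : PMF (Fin d → ℤ) := PMF.ofFinset (fun X => ENNReal.ofReal (extendZero v X))
    (P.states c n δ) hsum fun X hX => by rw [hlaw.support X hX, ENNReal.ofReal_zero] with hp
  have hpX : ∀ X, (p X).toReal = extendZero v X := fun X => by
    rw [hp, PMF.ofFinset_apply, ENNReal.toReal_ofReal (hlaw.nonneg X)]
  have hpe : P.IsEquilibrium c n δ p := by
    refine ⟨fun X hX => ?_, ?_⟩
    · by_contra h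
      refine hX ?_
      rw [hp, PMF.ofFinset_apply, hlaw.support X h, ENNReal.ofReal_zero]
    · refine (vecMul_exp_eq_self_iff _ _).2 ?_
      simpa only [hpX, extendZero_coe] using hv
  refine ⟨p, hpe, fun p' hp' => ?_⟩
  by_contra hcon
  have hl := hpe.isStationaryLaw hn
  have hl' := hp'.isStationaryLaw hn
  have hneq : (fun X : P.states c n δ => (p' X).toReal) ≠
      fun X : P.states c n δ => (p X).toReal := by
    intro h
    refine hcon (PMF.ext fun X => ?_)
    by_cases hX : X ∈ P.states c n δ
    · exact (ENNReal.toReal_eq_toReal_iff' (p'.apply_ne_top X) (p.apply_ne_top X)).1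
        (congrFun h ⟨X, hX⟩)
    · rw [hp'.apply_eq_zero hX, hpe.apply_eq_zero hX]
  -- The hypothesis `H` is applied not to the two given equilibria but to the laws at distance
  -- exactly 2 that their difference produces.
  obtain ⟨w, w', hw0, hw0', hw1, hw1', hw, hw', h2⟩ := exists_disjoint_invariant
    (P.qMatrix_nonneg c) (P.qMatrix_row_sum c)
    ((P.isStationaryLaw_iff c hn hl'.nonneg hl'.support hl'.mass).1 hl')
    ((P.isStationaryLaw_iff c hn hl.nonneg hl.support hl.mass).1 hl)
    ((Finset.sum_coe_sort _ _).trans hl'.mass) ((Finset.sum_coe_sort _ _).trans hl.mass) hneq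
  have h3 := H _ _ (P.isStationaryLaw_extendZero c hn hw0 hw1 hw)
    (P.isStationaryLaw_extendZero c hn hw0' hw1' hw')
  rw [← Finset.sum_coe_sort] at h3
  simp only [extendZero_coe, h2] at h3
  exact lt_irrefl _ h3

theorem IsEquilibrium.equilibriumDist {P : JumpProcess d} {c : EuclideanSpace ℝ (Fin d)} {n : ℕ}
    {δ : ℝ} (h : ∃ p : PMF (Fin d → ℤ), P.IsEquilibrium c n δ p) :
    P.IsEquilibrium c n δ (P.equilibriumDist c n δ) :=
  Classical.epsilon_spec h

end JumpProcess

theorem dTV_nonneg {α : Type*} (p q : PMF α) : 0 ≤ dTV p q :=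
  Real.iSup_nonneg fun _ => abs_nonneg _

theorem toReal_toOuterMeasure_eq {α : Type*} (p : PMF α) {S : Finset α} (hS : p.support ⊆ S)
    (B : Set α) : (p.toOuterMeasure B).toReal = ∑ x ∈ S, B.indicator (fun x => (p x).toReal) x := by
  rw [PMF.toOuterMeasure_apply, tsum_eq_sum (s := S), ENNReal.toReal_sum]
  · refine Finset.sum_congr rfl fun x _ => ?_
    by_cases hx : x ∈ B <;> simp [hx]
  · intro x _
    by_cases hx : x ∈ B <;> simp [hx, p.apply_ne_top]
  · intro x hx
    have : p x = 0 := by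
      by_contra h; exact hx (hS h)
    by_cases hx : x ∈ B <;> simp [hx, this]

theorem dTV_le_sum_abs_sub {α : Type*} {p q : PMF α} {S : Finset α} (hp : p.support ⊆ S)
    (hq : q.support ⊆ S) : dTV p q ≤ ∑ x ∈ S, |(p x).toReal - (q x).toReal| := by
  refine ciSup_le fun B => ?_
  rw [toReal_toOuterMeasure_eq p hp, toReal_toOuterMeasure_eq q hq, ← Finset.sum_sub_distrib]
  refine (Finset.abs_sum_le_sum_abs _ _).trans (Finset.sum_le_sum fun x _ => ?_)
  by_cases hx : x ∈ B <;> simp [hx]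

end

noncomputable section

/-! ### Extreme eigenvalues -/

section Eigenvalues

variable {d : ℕ} {M : Matrix (Fin d) (Fin d) ℝ}

theorem finite_spectrum_of_isHermitian (hM : M.IsHermitian) : (spectrum ℝ M).Finite := by
  rw [hM.spectrum_real_eq_range_eigenvalues]; exact Set.finite_range _

theorem lamMin_mul_le (hM : M.IsHermitian) (v : Fin d → ℝ) :
    lamMin M * (v ⬝ᵥ v) ≤ v ⬝ᵥ M.mulVec v := by
  have h : (M - algebraMap ℝ _ (lamMin M)).PosSemidef := by
    refine Matrix.posSemidef_iff_isHermitian_and_spectrum_nonneg.2 ⟨hM.sub ?_, ?_⟩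
    · rw [Algebra.algebraMap_eq_smul_one]
      simp [Matrix.IsHermitian]
    · rw [← spectrum.sub_singleton_eq]
      rintro _ ⟨x, hx, y, rfl, rfl⟩
      exact sub_nonneg.2 (csInf_le (finite_spectrum_of_isHermitian hM).bddBelow hx)
  have h2 := h.dotProduct_mulVec_nonneg v
  rw [star_trivial, Algebra.algebraMap_eq_smul_one, Matrix.sub_mulVec, Matrix.smul_mulVec,
    Matrix.one_mulVec, dotProduct_sub, dotProduct_smul, smul_eq_mul] at h2
  linarith

theorem le_lamMax_mul (hM : M.IsHermitian) (v : Fin d → ℝ) :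
    v ⬝ᵥ M.mulVec v ≤ lamMax M * (v ⬝ᵥ v) := by
  have h : (algebraMap ℝ _ (lamMax M) - M).PosSemidef := by
    refine Matrix.posSemidef_iff_isHermitian_and_spectrum_nonneg.2 ⟨Matrix.IsHermitian.sub ?_ hM, ?_⟩
    · rw [Algebra.algebraMap_eq_smul_one]
      simp [Matrix.IsHermitian]
    · rw [← spectrum.singleton_sub_eq]
      rintro _ ⟨x, rfl, y, hy, rfl⟩
      exact sub_nonneg.2 (le_csSup (finite_spectrum_of_isHermitian hM).bddAbove hy)
  have h2 := h.dotProduct_mulVec_nonneg v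
  rw [star_trivial, Algebra.algebraMap_eq_smul_one, Matrix.sub_mulVec, Matrix.smul_mulVec,
    Matrix.one_mulVec, dotProduct_sub, dotProduct_smul, smul_eq_mul] at h2
  linarith

theorem lamMin_pos (hd : 1 ≤ d) (hM : M.PosDef) : 0 < lamMin M := by
  have : Nonempty (Fin d) := ⟨⟨0, hd⟩⟩
  have hne : (spectrum ℝ M).Nonempty := by
    rw [hM.1.spectrum_real_eq_range_eigenvalues]; exact Set.range_nonempty _
  have hmem := hne.csInf_mem (finite_spectrum_of_isHermitian hM.1)
  rw [hM.1.spectrum_real_eq_range_eigenvalues] at hmem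
  obtain ⟨i, hi⟩ := hmem
  rw [lamMin, hM.1.spectrum_real_eq_range_eigenvalues, ← hi]
  exact hM.eigenvalues_pos i

theorem lamMax_pos (hd : 1 ≤ d) (hM : M.PosDef) : 0 < lamMax M := by
  have hd' : Nonempty (Fin d) := ⟨⟨0, hd⟩⟩
  refine (hM.eigenvalues_pos hd'.some).trans_le
    (le_csSup (finite_spectrum_of_isHermitian hM.1).bddAbove ?_)
  rw [hM.1.spectrum_real_eq_range_eigenvalues]
  exact Set.mem_range_self _

theorem dotProduct_mulVec_symm (hM : M.IsHermitian) (v w : Fin d → ℝ) :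
    v ⬝ᵥ M.mulVec w = M.mulVec v ⬝ᵥ w := by
  have h : M.transpose = M := by simpa [Matrix.IsHermitian] using hM
  rw [Matrix.dotProduct_mulVec, ← Matrix.mulVec_transpose, h]

open scoped MatrixOrder in
/-- The symmetric square root of a positive definite matrix. -/
theorem exists_sqrt (hM : M.PosDef) : ∃ T : Matrix (Fin d) (Fin d) ℝ, T.IsHermitian ∧
    T * T = M ∧ IsUnit T.det ∧ ∀ s, standardized M s = T⁻¹ * s * T⁻¹ := by
  have h0 : 0 ≤ M := hM.posSemidef.nonneg
  have h1 := CFC.sqrt_mul_sqrt_self M h0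
  refine ⟨CFC.sqrt M, (Matrix.nonneg_iff_posSemidef.1 (CFC.sqrt_nonneg M)).1, h1, ?_,
    fun s => rfl⟩
  have h2 : IsUnit M.det := hM.isUnit.map Matrix.detMonoidHom
  rw [← h1, Matrix.det_mul] at h2
  exact isUnit_of_mul_isUnit_left h2

theorem mulVec_inv_cancel (hM : M.PosDef) (v : Fin d → ℝ) : M.mulVec (M⁻¹.mulVec v) = v := by
  have h2 : IsUnit M.det := hM.isUnit.map Matrix.detMonoidHom
  rw [Matrix.mulVec_mulVec, Matrix.mul_nonsing_inv _ h2, Matrix.one_mulVec]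

/-- The vector `w` is `M^{-1/2} v`. It transfers Rayleigh bounds for `M` to the form of `M⁻¹`
without computing the spectrum of the inverse. -/
theorem exists_sqrt_mulVec (hM : M.PosDef) (v : Fin d → ℝ) : ∃ w : Fin d → ℝ,
    w ⬝ᵥ w = v ⬝ᵥ M⁻¹.mulVec v ∧ w ⬝ᵥ M.mulVec w = v ⬝ᵥ v := by
  obtain ⟨T, hT, hTT, -⟩ := exists_sqrt hM
  have e1 : T.mulVec (T.mulVec (M⁻¹.mulVec v)) = v := by
    rw [Matrix.mulVec_mulVec, hTT, mulVec_inv_cancel hM v]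
  refine ⟨T.mulVec (M⁻¹.mulVec v), ?_, ?_⟩
  · rw [dotProduct_mulVec_symm hT, e1]
  · rw [← hTT, ← Matrix.mulVec_mulVec, hTT, e1, dotProduct_mulVec_symm hT, e1]

theorem dotProduct_le_lamMax_mul (hM : M.PosDef) (v : Fin d → ℝ) :
    v ⬝ᵥ v ≤ lamMax M * (v ⬝ᵥ M⁻¹.mulVec v) := by
  obtain ⟨w, h1, h2⟩ := exists_sqrt_mulVec hM v
  rw [← h1, ← h2]
  exact le_lamMax_mul hM.1 w

theorem lamMin_mul_le_dotProduct (hM : M.PosDef) (v : Fin d → ℝ) :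
    lamMin M * (v ⬝ᵥ M⁻¹.mulVec v) ≤ v ⬝ᵥ v := by
  obtain ⟨w, h1, h2⟩ := exists_sqrt_mulVec hM v
  rw [← h1, ← h2]
  exact lamMin_mul_le hM.1 w

/-- The Rayleigh bound for `M^{-1/2} s M^{-1/2}`, taken at `M^{-1/2} v`. -/
theorem standardized_mulVec (hM : M.PosDef) {s : Matrix (Fin d) (Fin d) ℝ} (hs : s.IsHermitian) :
    (standardized M s).IsHermitian ∧ ∀ v : Fin d → ℝ,
      lamMin (standardized M s) * (v ⬝ᵥ M⁻¹.mulVec v) ≤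
        M⁻¹.mulVec v ⬝ᵥ s.mulVec (M⁻¹.mulVec v) := by
  obtain ⟨T, hT, hTT, hTu, hst⟩ := exists_sqrt hM
  have hTi : (T⁻¹).IsHermitian := hT.inv
  have hMi : T⁻¹ * T⁻¹ = M⁻¹ := by rw [← Matrix.mul_inv_rev, hTT]
  have hh : (standardized M s).IsHermitian := by
    rw [hst]
    have h1 : (T⁻¹).conjTranspose = T⁻¹ := hTi
    have h2 : s.conjTranspose = s := hs
    rw [Matrix.IsHermitian, Matrix.conjTranspose_mul, Matrix.conjTranspose_mul, h1, h2, mul_assoc]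
  refine ⟨hh, fun v => ?_⟩
  have h := lamMin_mul_le hh (T⁻¹.mulVec v)
  have e1 : T⁻¹.mulVec v ⬝ᵥ T⁻¹.mulVec v = v ⬝ᵥ M⁻¹.mulVec v := by
    rw [← dotProduct_mulVec_symm hTi, Matrix.mulVec_mulVec, hMi]
  have e2 : T⁻¹.mulVec v ⬝ᵥ (standardized M s).mulVec (T⁻¹.mulVec v) =
      M⁻¹.mulVec v ⬝ᵥ s.mulVec (M⁻¹.mulVec v) := by
    rw [hst, ← Matrix.mulVec_mulVec, ← Matrix.mulVec_mulVec, dotProduct_mulVec_symm hTi,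
      Matrix.mulVec_mulVec, hMi]
  rwa [e1, e2] at h

theorem standardized_posDef (hM : M.PosDef) {s : Matrix (Fin d) (Fin d) ℝ} (hs : s.PosDef) :
    (standardized M s).PosDef := by
  obtain ⟨T, hT, hTT, hTu, hst⟩ := exists_sqrt hM
  have hTi : (T⁻¹).IsHermitian := hT.inv
  refine Matrix.PosDef.of_dotProduct_mulVec_pos (standardized_mulVec hM hs.1).1 fun v hv => ?_
  rw [star_trivial, hst, ← Matrix.mulVec_mulVec, ← Matrix.mulVec_mulVec, dotProduct_mulVec_symm hTi]
  have hne : T⁻¹.mulVec v ≠ 0 := by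
    intro h
    have h2 := congrArg T.mulVec h
    rw [Matrix.mulVec_mulVec, Matrix.mul_nonsing_inv _ hTu, Matrix.one_mulVec,
      Matrix.mulVec_zero] at h2
    exact hv h2
  simpa using hs.dotProduct_mulVec_pos hne

theorem sq_norm_toLp (v : Fin d → ℝ) :
    ‖(WithLp.toLp 2 v : EuclideanSpace ℝ (Fin d))‖ ^ 2 = v ⬝ᵥ v := by
  rw [EuclideanSpace.norm_sq_eq]
  simp [dotProduct, sq]

theorem spectralNorm₂_pos (hM : M ≠ 0) : 0 < spectralNorm₂ M := by
  refine norm_pos_iff.2 fun h => hM ?_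
  exact (map_eq_zero_iff _ Matrix.toEuclideanCLM.injective).1 h

end Eigenvalues

/-! ### The Lyapunov equation -/

section Lyapunov

variable {d : ℕ} {A : Matrix (Fin d) (Fin d) ℝ}

theorem IsHurwitz.ne_zero (hd : 1 ≤ d) (hA : IsHurwitz A) : A ≠ 0 := by
  rintro rfl
  have h := hA 0 (by
    have : Nonempty (Fin d) := ⟨⟨0, hd⟩⟩
    refine Module.End.hasEigenvalue_of_hasEigenvector (x := fun _ => 1) ⟨?_, ?_⟩
    · rw [Module.End.mem_eigenspace_iff]; simp
    · intro h; simpa using congrFun h ⟨0, hd⟩)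
  simp at h

theorem IsHurwitz.re_neg (hA : IsHurwitz A) {z : ℂ} {v : Fin d → ℂ} (hv : v ≠ 0)
    (h : (A.map (algebraMap ℝ ℂ)).mulVec v = z • v) : z.re < 0 :=
  hA z (Module.End.hasEigenvalue_of_hasEigenvector (x := v)
    ⟨by rw [Module.End.mem_eigenspace_iff, Matrix.toLin'_apply, h], hv⟩)

theorem IsHurwitz.isUnit_one_sub (hA : IsHurwitz A) : IsUnit (1 - A).det := by
  rw [isUnit_iff_ne_zero]
  intro h
  have h2 : (1 - A.map (algebraMap ℝ ℂ)).det = 0 := by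
    have h3 : (1 - A).map (algebraMap ℝ ℂ) = 1 - A.map (algebraMap ℝ ℂ) := by
      rw [Matrix.map_sub _ (by simp), Matrix.map_one _ (by simp) (by simp)]
    rw [← h3, ← RingHom.mapMatrix_apply, ← RingHom.map_det, h, map_zero]
  obtain ⟨v, hv, hv2⟩ := Matrix.exists_mulVec_eq_zero_iff.2 h2
  rw [Matrix.sub_mulVec, Matrix.one_mulVec, sub_eq_zero] at hv2
  have := hA.re_neg hv (z := 1) (by rw [one_smul, ← hv2])
  norm_num at this

/-- The real part of `(z - 1)/(z + 1)` is `(|z|² - 1)/|z + 1|²`: the Cayley transform exchanges the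
left half plane and the unit disc. -/
theorem norm_lt_one_of_cayley {z : ℂ} (hz : z + 1 ≠ 0) (h : ((z - 1) / (z + 1)).re < 0) :
    ‖z‖ < 1 := by
  have h1 : ((z - 1) / (z + 1)).re = (Complex.normSq z - 1) / Complex.normSq (z + 1) := by
    rw [Complex.div_re, ← add_div]
    congr 1
    simp [Complex.normSq_apply]
    ring
  rw [h1, div_neg_iff] at h
  have h2 : 0 < Complex.normSq (z + 1) := Complex.normSq_pos.2 hz
  have h3 : Complex.normSq z < 1 := by
    rcases h with h | h
    · linarith [h.2]
    · linarith [h.1]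
  rw [Complex.normSq_eq_norm_sq] at h3
  nlinarith [norm_nonneg z]

-- Gelfand's formula. The spectral radius is attained by a point of the spectrum, hence is below 1,
-- and any `r` strictly between the two will do.
open scoped Matrix.Norms.Frobenius in
theorem exists_pow_norm_le (B : Matrix (Fin d) (Fin d) ℂ)
    (hB : ∀ z ∈ spectrum ℂ B, ‖z‖ < 1) :
    ∃ r : ℝ, 0 ≤ r ∧ r < 1 ∧ ∀ᶠ k : ℕ in atTop, ‖B ^ k‖ ≤ r ^ k := by
  rcases subsingleton_or_nontrivial (Matrix (Fin d) (Fin d) ℂ) with hsub | hnt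
  · exact ⟨0, le_rfl, one_pos, Eventually.of_forall fun k => by
      rw [Subsingleton.elim (B ^ k) 0, norm_zero]; positivity⟩
  obtain ⟨z, hz, hρ⟩ := spectrum.exists_nnnorm_eq_spectralRadius B
  obtain ⟨r, hr1, hr2⟩ := exists_between (hB z hz)
  have hr0 : 0 ≤ r := (norm_nonneg z).trans hr1.le
  refine ⟨r, hr0, hr2, ?_⟩
  have hlt : spectralRadius ℂ B < ENNReal.ofReal r := by
    rw [← hρ, ← enorm_eq_nnnorm, ← ofReal_norm]
    exact (ENNReal.ofReal_lt_ofReal_iff_of_nonneg (norm_nonneg z)).2 hr1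
  have ht := spectrum.pow_norm_pow_one_div_tendsto_nhds_spectralRadius B
  filter_upwards [ht.eventually_lt_const hlt, eventually_ge_atTop 1] with k hk hk1
  have h1 : ‖B ^ k‖ ^ (1 / k : ℝ) ≤ r :=
    ((ENNReal.ofReal_lt_ofReal_iff_of_nonneg (by positivity)).1 hk).le
  have hk0 : (k : ℝ) ≠ 0 := by positivity
  calc ‖B ^ k‖ = (‖B ^ k‖ ^ (1 / k : ℝ)) ^ k := by
        rw [← Real.rpow_natCast, ← Real.rpow_mul (norm_nonneg _), one_div_mul_cancel hk0,
          Real.rpow_one]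
    _ ≤ r ^ k := pow_le_pow_left₀ (by positivity) h1 k

/-- The discrete Lyapunov (Stein) equation. -/
theorem exists_stein_solution {B Q : Matrix (Fin d) (Fin d) ℝ} (hQ : Q.PosDef)
    (hB : ∀ z ∈ spectrum ℂ (B.map (algebraMap ℝ ℂ)), ‖z‖ < 1) :
    ∃ S : Matrix (Fin d) (Fin d) ℝ, S.PosDef ∧ S = Q + B * S * B.transpose := by
  open scoped Matrix.Norms.Frobenius in
  obtain ⟨r, hr0, hr1, hr⟩ := exists_pow_norm_le _ hB
  -- The Frobenius norm does not change under complexification, so the decay obtained from complex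
  -- eigenvalues serves the real series.
  have hnorm : ∀ k : ℕ, ‖(B.map (algebraMap ℝ ℂ)) ^ k‖ = ‖B ^ k‖ := by
    intro k
    rw [← RingHom.mapMatrix_apply, ← map_pow, RingHom.mapMatrix_apply]
    exact Matrix.frobenius_norm_map_eq _ _ fun a => by simp
  -- The solution is the sum of this series; conjugation by `B` shifts it by one term.
  set F : ℕ → Matrix (Fin d) (Fin d) ℝ := fun k => B ^ k * Q * (B ^ k).transpose with hF
  have hsum : Summable F := by
    have hg : Summable fun k : ℕ => ‖Q‖ * (r ^ 2) ^ k :=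
      (summable_geometric_of_lt_one (by positivity) (by nlinarith)).mul_left _
    refine Summable.of_norm_bounded_eventually_nat hg ?_
    filter_upwards [hr] with k hk
    rw [hnorm] at hk
    calc ‖F k‖ ≤ ‖B ^ k‖ * ‖Q‖ * ‖(B ^ k).transpose‖ :=
          (norm_mul_le _ _).trans (mul_le_mul_of_nonneg_right (norm_mul_le _ _) (norm_nonneg _))
      _ = ‖B ^ k‖ * ‖Q‖ * ‖B ^ k‖ := by rw [Matrix.frobenius_norm_transpose]
      _ ≤ r ^ k * ‖Q‖ * r ^ k := by gcongr
      _ = _ := by ring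
  have hstep : ∀ k, F (k + 1) = B * F k * B.transpose := by
    intro k
    simp only [hF, pow_succ', Matrix.transpose_mul, mul_assoc]
  have heq : ∑' k, F k = Q + B * (∑' k, F k) * B.transpose := by
    conv_lhs => rw [hsum.tsum_eq_zero_add]
    congr 1
    · simp [hF]
    · simp only [hstep]
      rw [Summable.tsum_mul_right _ (hsum.mul_left B), Summable.tsum_mul_left _ hsum]
  have hPk : ∀ k, (F k).PosSemidef := by
    intro k
    have := hQ.posSemidef.mul_mul_conjTranspose_same (B ^ k)
    simpa [hF] using this
  have hP : (∑' k, F k).PosSemidef := by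
    refine Matrix.PosSemidef.of_dotProduct_mulVec_nonneg ?_ fun x => ?_
    · rw [Matrix.IsHermitian, Matrix.conjTranspose_tsum]
      exact tsum_congr fun k => (hPk k).1
    · let L : Matrix (Fin d) (Fin d) ℝ →ₗ[ℝ] ℝ :=
        { toFun := fun M => x ⬝ᵥ M.mulVec x
          map_add' := fun M N => by rw [Matrix.add_mulVec, dotProduct_add]
          map_smul' := fun t M => by simp [Matrix.smul_mulVec] }
      have h := (LinearMap.toContinuousLinearMap L).map_tsum hsum
      change 0 ≤ (LinearMap.toContinuousLinearMap L) (∑' k, F k)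
      rw [h]
      exact tsum_nonneg fun k => by simpa [L] using (hPk k).dotProduct_mulVec_nonneg x
  refine ⟨∑' k, F k, ?_, heq⟩
  rw [heq]
  refine hQ.add_posSemidef ?_
  simpa using hP.mul_mul_conjTranspose_same B

/-- The continuous Lyapunov equation, by the Cayley transform. -/
theorem IsHurwitz.exists_lyapunov_solution (hA : IsHurwitz A) {s : Matrix (Fin d) (Fin d) ℝ}
    (hs : s.PosDef) : ∃ S : Matrix (Fin d) (Fin d) ℝ, S.PosDef ∧
      A * S + S * A.transpose + s = 0 := by
  have hu := hA.isUnit_one_sub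
  set R := (1 - A)⁻¹ with hR
  have hR1 : (1 - A) * R = 1 := Matrix.mul_nonsing_inv _ hu
  have hR2 : R * (1 - A) = 1 := Matrix.nonsing_inv_mul _ hu
  have hRt : R.transpose * (1 - A).transpose = 1 := by
    rw [← Matrix.transpose_mul, hR1, Matrix.transpose_one]
  have hRu : IsUnit R := ⟨⟨R, 1 - A, hR2, hR1⟩, rfl⟩
  have hQ : ((2 : ℝ) • (R * s * R.transpose)).PosDef := by
    refine Matrix.PosDef.smul ?_ two_pos
    have h := hs.mul_mul_conjTranspose_same (B := R) (Matrix.vecMul_injective_of_isUnit hRu)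
    simpa using h
  -- With `B = (1 - A)⁻¹(1 + A)`, multiplying the Stein equation by `1 - A` on the left and by its
  -- transpose on the right gives `(1 - A) S (1 - A)ᵀ = 2s + (1 + A) S (1 + A)ᵀ`, which expands to
  -- twice the Lyapunov equation.
  obtain ⟨S, hS, hSeq⟩ := exists_stein_solution (B := R * (1 + A)) hQ (by
    intro z hz
    rw [← Matrix.spectrum_toLin', ← Module.End.hasEigenvalue_iff_mem_spectrum] at hz
    obtain ⟨v, hv⟩ := hz.exists_hasEigenvector
    have hv1 := hv.apply_eq_smul
    have hv0 : v ≠ 0 := hv.2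
    set Ac := A.map (algebraMap ℝ ℂ) with hAc
    have hm : ∀ M N : Matrix (Fin d) (Fin d) ℝ, (M * N).map (algebraMap ℝ ℂ) =
      M.map (algebraMap ℝ ℂ) * N.map (algebraMap ℝ ℂ) := fun M N => Matrix.map_mul
    have h1 : (1 : Matrix (Fin d) (Fin d) ℝ).map (algebraMap ℝ ℂ) = 1 :=
      Matrix.map_one _ (by simp) (by simp)
    have h2 := congrArg (fun M : Matrix (Fin d) (Fin d) ℝ => M.map (algebraMap ℝ ℂ)) hR1
    simp only [hm, h1, Matrix.map_sub _ (map_sub (algebraMap ℝ ℂ)), ← hAc] at h2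
    rw [Matrix.toLin'_apply, hm, Matrix.map_add _ (map_add (algebraMap ℝ ℂ)), h1, ← hAc] at hv1
    have h3 := congrArg (1 - Ac).mulVec hv1
    rw [Matrix.mulVec_mulVec, ← mul_assoc, h2, one_mul, Matrix.mulVec_smul, Matrix.add_mulVec,
      Matrix.sub_mulVec, Matrix.one_mulVec] at h3
    -- An eigenvector of `B` for `z` is an eigenvector of `A` for `(z - 1)/(z + 1)`.
    have h4 : (z + 1) • Ac.mulVec v = (z - 1) • v := by
      rw [add_smul, sub_smul, one_smul, one_smul]
      rw [smul_sub] at h3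
      have : z • Ac.mulVec v = z • v - (v + Ac.mulVec v) := by rw [h3]; abel
      rw [this]; abel
    have hz1 : z + 1 ≠ 0 := by
      intro h0
      rw [h0, zero_smul] at h4
      have h5 : z - 1 = -2 := by linear_combination h0
      rw [h5] at h4
      exact (smul_ne_zero (by norm_num) hv0) h4.symm
    refine norm_lt_one_of_cayley hz1 (hA.re_neg hv0 ?_)
    rw [div_eq_inv_mul, mul_smul, ← h4, smul_smul, inv_mul_cancel₀ hz1, one_smul])
  refine ⟨S, hS, ?_⟩
  have h1 : (1 - A) * S * (1 - A).transpose =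
      (2 : ℝ) • s + (1 + A) * S * (1 + A).transpose := by
    have h2 := congrArg (fun M => (1 - A) * M * (1 - A).transpose) hSeq
    rw [h2, mul_add, add_mul]
    congr 1
    · rw [Matrix.mul_smul, Matrix.smul_mul]
      congr 1
      calc (1 - A) * (R * s * R.transpose) * (1 - A).transpose =
          ((1 - A) * R) * s * (R.transpose * (1 - A).transpose) := by simp only [mul_assoc]
        _ = s := by rw [hR1, hRt, one_mul, mul_one]
    · rw [Matrix.transpose_mul]
      calc (1 - A) * (R * (1 + A) * S * ((1 + A).transpose * R.transpose)) * (1 - A).transpose =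
          ((1 - A) * R) * ((1 + A) * S * (1 + A).transpose) *
            (R.transpose * (1 - A).transpose) := by simp only [mul_assoc]
        _ = _ := by rw [hR1, hRt, one_mul, mul_one]
  have h2 : (2 : ℝ) • (A * S + S * A.transpose + s) = 0 := by
    rw [Matrix.transpose_sub, Matrix.transpose_add, Matrix.transpose_one] at h1
    have h3 : (1 + A) * S * (1 + A.transpose) - (1 - A) * S * (1 - A.transpose) =
        (2 : ℝ) • (A * S + S * A.transpose) := by
      rw [two_smul]; noncomm_ring
    rw [smul_add, ← h3, h1]
    abel
  exact (smul_eq_zero.1 h2).resolve_left two_ne_zero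

theorem IsHurwitz.lyapunovSol_spec (hA : IsHurwitz A) {s : Matrix (Fin d) (Fin d) ℝ}
    (hs : s.PosDef) : (lyapunovSol A s).PosDef ∧
      A * lyapunovSol A s + lyapunovSol A s * A.transpose + s = 0 :=
  Classical.epsilon_spec (p := fun S : Matrix (Fin d) (Fin d) ℝ =>
    S.PosDef ∧ A * S + S * A.transpose + s = 0) (hA.exists_lyapunov_solution hs)

/-- The Lyapunov equation evaluated at `S⁻¹ y`, where its first two terms coincide. This identity is
the source of the contraction in the norm `|·|_Σ`. -/
theorem dotProduct_mulVec_of_lyapunov {S s : Matrix (Fin d) (Fin d) ℝ} (hS : S.PosDef)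
    (h : A * S + S * A.transpose + s = 0) (y : Fin d → ℝ) :
    S⁻¹.mulVec y ⬝ᵥ A.mulVec y = -(S⁻¹.mulVec y ⬝ᵥ s.mulVec (S⁻¹.mulVec y)) / 2 := by
  set z := S⁻¹.mulVec y with hz
  have hy : y = S.mulVec z := (mulVec_inv_cancel hS y).symm
  have h1 := congrArg (fun M : Matrix (Fin d) (Fin d) ℝ => z ⬝ᵥ M.mulVec z) h
  simp only [Matrix.add_mulVec, dotProduct_add, Matrix.zero_mulVec, dotProduct_zero] at h1
  have h2 : z ⬝ᵥ (S * A.transpose).mulVec z = z ⬝ᵥ (A * S).mulVec z := by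
    rw [← Matrix.mulVec_mulVec, dotProduct_mulVec_symm hS.1, ← Matrix.mulVec_mulVec,
      Matrix.mulVec_transpose, dotProduct_comm, ← Matrix.dotProduct_mulVec]
  rw [h2] at h1
  rw [hy, Matrix.mulVec_mulVec]
  linarith

end Lyapunov

end

noncomputable section

/-! ### Decomposition of positive definite matrices into integer rank one matrices -/

section IntegerCone

variable {d : ℕ}

/-- The matrices `∑ m_J J Jᵀ` with `m_J ≥ 0` and integer vectors `J`. -/
def integerCone (d : ℕ) : Submodule NNReal (Matrix (Fin d) (Fin d) ℝ) :=
  Submodule.span NNReal (Set.range fun J : Fin d → ℤ => Matrix.vecMulVec (realVec J) (realVec J))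

theorem smul_mem_integerCone {t : ℝ} (ht : 0 ≤ t) {M : Matrix (Fin d) (Fin d) ℝ}
    (hM : M ∈ integerCone d) : t • M ∈ integerCone d :=
  (integerCone d).smul_mem ⟨t, ht⟩ hM

theorem vecMulVec_mem_integerCone (J : Fin d → ℤ) :
    Matrix.vecMulVec (realVec J) (realVec J) ∈ integerCone d :=
  Submodule.subset_span ⟨J, rfl⟩

theorem realVec_single (i : Fin d) : realVec (Pi.single i 1) = Pi.single i 1 := by
  funext j
  by_cases h : j = i
  · subst h; simp [realVec]
  · simp [realVec, h]

theorem vecMulVec_add_self (v w : Fin d → ℝ) : Matrix.vecMulVec (v + w) (v + w) =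
    Matrix.vecMulVec v v + Matrix.vecMulVec w w +
      (Matrix.vecMulVec v w + Matrix.vecMulVec w v) := by
  ext i j; simp [Matrix.vecMulVec_apply]; ring

/-- This matrix is `|t|` times the rank one matrix of `e_i + e_j` or of `e_i - e_j`, according to
the sign of `t`. -/
theorem pair_mem_integerCone (i j : Fin d) (t : ℝ) :
    |t| • (Matrix.single i i (1 : ℝ) + Matrix.single j j 1) +
      t • (Matrix.single i j 1 + Matrix.single j i 1) ∈ integerCone d := by
  have hs : ∀ i j : Fin d, Matrix.single i j (1 : ℝ) =
      Matrix.vecMulVec (Pi.single i 1) (Pi.single j 1) := fun i j => by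
    rw [Matrix.single_eq_single_vecMulVec_single]
  simp only [hs]
  rcases le_total 0 t with h | h
  · have h2 := smul_mem_integerCone h
      (vecMulVec_mem_integerCone (Pi.single i 1 + Pi.single j 1 : Fin d → ℤ))
    rw [realVec_add, realVec_single, realVec_single, vecMulVec_add_self, smul_add] at h2
    rwa [abs_of_nonneg h]
  · have h2 := smul_mem_integerCone (neg_nonneg.2 h)
      (vecMulVec_mem_integerCone (Pi.single i 1 + -Pi.single j 1 : Fin d → ℤ))
    rw [realVec_add, realVec_neg, realVec_single, realVec_single, vecMulVec_add_self, smul_add] at h2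
    rw [abs_of_nonpos h]
    convert h2 using 2
    · simp [Matrix.vecMulVec_neg, Matrix.neg_vecMulVec]
    · simp [Matrix.vecMulVec_neg, Matrix.neg_vecMulVec]

theorem single_mem_integerCone (i : Fin d) : Matrix.single i i (1 : ℝ) ∈ integerCone d := by
  have h := vecMulVec_mem_integerCone (Pi.single i 1 : Fin d → ℤ)
  rwa [realVec_single, ← Matrix.single_eq_single_vecMulVec_single] at h

/-- Diagonally dominant symmetric matrices. -/
theorem mem_integerCone_of_dominant {M : Matrix (Fin d) (Fin d) ℝ} (hM : M.IsHermitian) {ε : ℝ}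
    (hε : ∀ i, ∑ j, |M i j| ≤ ε) : ε • (1 : Matrix (Fin d) (Fin d) ℝ) + M ∈ integerCone d := by
  -- Each entry is halved because the sum runs over ordered pairs. The diagonal spent on row `i` is
  -- then `∑ j |M i j|`, and the surplus up to `ε` goes to the matrices `e_i e_iᵀ`.
  have h1 : ∑ i, ∑ j, (|M i j / 2| • (Matrix.single i i (1 : ℝ) + Matrix.single j j 1) +
      (M i j / 2) • (Matrix.single i j 1 + Matrix.single j i 1)) ∈ integerCone d :=
    Submodule.sum_mem _ fun i _ => Submodule.sum_mem _ fun j _ => pair_mem_integerCone i j _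
  have h2 : ∑ i, (ε - ∑ j, |M i j|) • Matrix.single i i (1 : ℝ) ∈ integerCone d :=
    Submodule.sum_mem _ fun i _ =>
      smul_mem_integerCone (sub_nonneg.2 (hε i)) (single_mem_integerCone i)
  have hsym : ∀ i j, M i j = M j i := fun i j => by simpa using hM.apply j i
  have e1 : ∑ i, ∑ j, (M i j / 2) • (Matrix.single i j (1 : ℝ) + Matrix.single j i 1) = M := by
    have hM1 : ∑ i, ∑ j, (M i j / 2) • Matrix.single i j (1 : ℝ) = (1 / 2 : ℝ) • M := by
      conv_rhs => rw [Matrix.matrix_eq_sum_single M]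
      simp only [Finset.smul_sum, Matrix.smul_single, smul_eq_mul, mul_one]
      refine Finset.sum_congr rfl fun i _ => Finset.sum_congr rfl fun j _ => by congr 1; ring
    have hM2 : ∑ i, ∑ j, (M i j / 2) • Matrix.single j i (1 : ℝ) = (1 / 2 : ℝ) • M := by
      rw [Finset.sum_comm, ← hM1]
      refine Finset.sum_congr rfl fun i _ => Finset.sum_congr rfl fun j _ => by rw [hsym]
    simp only [smul_add, Finset.sum_add_distrib]
    rw [hM1, hM2, ← add_smul]
    norm_num
  have e2 : ∑ i, ∑ j, |M i j / 2| • (Matrix.single i i (1 : ℝ) + Matrix.single j j 1) =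
      ∑ i, (∑ j, |M i j|) • Matrix.single i i (1 : ℝ) := by
    have hM2 : ∑ i, ∑ j, |M i j / 2| • Matrix.single j j (1 : ℝ) =
        ∑ i, ∑ j, |M i j / 2| • Matrix.single i i (1 : ℝ) := by
      rw [Finset.sum_comm]
      refine Finset.sum_congr rfl fun i _ => Finset.sum_congr rfl fun j _ => by rw [hsym]
    simp only [smul_add, Finset.sum_add_distrib]
    rw [hM2, ← Finset.sum_add_distrib]
    refine Finset.sum_congr rfl fun i _ => ?_
    rw [← Finset.sum_smul, ← add_smul, ← Finset.sum_add_distrib]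
    congr 1
    refine Finset.sum_congr rfl fun j _ => ?_
    rw [abs_div, abs_two]; ring
  have e3 : ε • (1 : Matrix (Fin d) (Fin d) ℝ) = ∑ i, ε • Matrix.single i i (1 : ℝ) := by
    rw [← Finset.smul_sum, Matrix.sum_single_one]
  have h3 := Submodule.add_mem _ h1 h2
  have e4 : ε • (1 : Matrix (Fin d) (Fin d) ℝ) + M =
      ∑ i, ∑ j, (|M i j / 2| • (Matrix.single i i (1 : ℝ) + Matrix.single j j 1) +
      (M i j / 2) • (Matrix.single i j 1 + Matrix.single j i 1)) +
      ∑ i, (ε - ∑ j, |M i j|) • Matrix.single i i (1 : ℝ) := by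
    simp only [Finset.sum_add_distrib, sub_smul, Finset.sum_sub_distrib]
    rw [e1, e2, e3]
    abel
  rwa [e4]

/-- Every positive definite matrix is a nonnegative combination of integer rank one matrices. -/
theorem mem_integerCone_of_posDef (hd : 1 ≤ d) {M : Matrix (Fin d) (Fin d) ℝ} (hM : M.PosDef) :
    M ∈ integerCone d := by
  have hlam := lamMin_pos hd hM
  set ε := lamMin M / 2 with hε
  have hε0 : 0 < ε := by positivity
  have hN : (M - ε • (1 : Matrix (Fin d) (Fin d) ℝ)).PosDef := by
    refine Matrix.PosDef.of_dotProduct_mulVec_pos (hM.1.sub (by simp [Matrix.IsHermitian]))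
      fun v hv => ?_
    have h1 := lamMin_mul_le hM.1 v
    have h2 : 0 < v ⬝ᵥ v := by
      have := Matrix.dotProduct_star_self_pos_iff (v := v)
      simpa using this.2 hv
    rw [star_trivial, Matrix.sub_mulVec, dotProduct_sub, Matrix.smul_mulVec, Matrix.one_mulVec,
      dotProduct_smul, smul_eq_mul]
    nlinarith
  obtain ⟨T, hT, hTT, -, -⟩ := exists_sqrt hN
  have hTsym : ∀ i j, T i j = T j i := fun i j => by simpa using hT.apply j i
  -- The columns of the square root `T` are rounded to multiples of `1/k`. This approximates `T * T`
  -- by scaled integer rank one matrices, and the multiple `ε` of the identity held in reserve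
  -- dominates the error.
  have hlim : Tendsto (fun k : ℕ => fun i : Fin d => ∑ j : Fin d, |(T * T) i j -
      ∑ l, (⌊(k : ℝ) * T i l⌋ / k : ℝ) * (⌊(k : ℝ) * T j l⌋ / k)|) atTop (𝓝 0) := by
    rw [tendsto_pi_nhds]
    intro i
    have hfl : ∀ x : ℝ, Tendsto (fun k : ℕ => (⌊(k : ℝ) * x⌋ / k : ℝ)) atTop (𝓝 x) := fun x => by
      rw [tendsto_iff_dist_tendsto_zero]
      refine squeeze_zero' (Eventually.of_forall fun k => dist_nonneg) ?_
        tendsto_one_div_atTop_nhds_zero_nat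
      filter_upwards [eventually_gt_atTop 0] with k hk
      have hk' : (0 : ℝ) < k := by exact_mod_cast hk
      rw [Real.dist_eq, show (⌊(k : ℝ) * x⌋ / k : ℝ) - x = (⌊(k : ℝ) * x⌋ - k * x) / k by
        field_simp, abs_div, abs_of_pos hk']
      gcongr
      rw [abs_le]
      constructor <;> linarith [Int.floor_le ((k : ℝ) * x), Int.lt_floor_add_one ((k : ℝ) * x)]
    have h0 : (0 : ℝ) = ∑ j : Fin d, |(T * T) i j - ∑ l, T i l * T j l| := by
      symm
      refine Finset.sum_eq_zero fun j _ => ?_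
      rw [Matrix.mul_apply, abs_eq_zero, sub_eq_zero]
      exact Finset.sum_congr rfl fun l _ => by rw [hTsym l j]
    rw [Pi.zero_apply, h0]
    exact tendsto_finsetSum _ fun j _ => (tendsto_const_nhds.sub
      (tendsto_finsetSum _ fun l _ => (hfl _).mul (hfl _))).abs
  have hev : ∀ᶠ k : ℕ in atTop, ∀ i : Fin d, ∑ j : Fin d, |(T * T) i j -
      ∑ l, (⌊(k : ℝ) * T i l⌋ / k : ℝ) * (⌊(k : ℝ) * T j l⌋ / k)| ≤ ε :=
    Filter.eventually_all.2 fun i =>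
      ((tendsto_pi_nhds.1 hlim i).eventually_lt_const hε0).mono fun _ h => h.le
  obtain ⟨k, hk⟩ := hev.exists
  set K : Matrix (Fin d) (Fin d) ℝ := Matrix.of fun i j =>
    ∑ l, (⌊(k : ℝ) * T i l⌋ / k : ℝ) * (⌊(k : ℝ) * T j l⌋ / k) with hK
  have hKmem : K ∈ integerCone d := by
    have : K = ∑ l, (((k : ℝ) ^ 2)⁻¹) • Matrix.vecMulVec
        (realVec fun i => ⌊(k : ℝ) * T i l⌋) (realVec fun i => ⌊(k : ℝ) * T i l⌋) := by
      ext i j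
      rw [Matrix.sum_apply]
      simp only [hK, Matrix.of_apply, Matrix.smul_apply, Matrix.vecMulVec_apply, realVec,
        smul_eq_mul]
      exact Finset.sum_congr rfl fun l _ => by ring
    rw [this]
    exact Submodule.sum_mem _ fun l _ =>
      smul_mem_integerCone (by positivity) (vecMulVec_mem_integerCone _)
  have hKh : K.IsHermitian := by
    ext i j
    simp only [hK, Matrix.conjTranspose_apply, Matrix.of_apply, star_trivial]
    exact Finset.sum_congr rfl fun l _ => mul_comm _ _
  have h1 := mem_integerCone_of_dominant (M := T * T - K) (ε := ε)
    (by rw [hTT]; exact hN.1.sub hKh) fun i => hk i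
  have h2 := Submodule.add_mem _ h1 hKmem
  have e : ε • (1 : Matrix (Fin d) (Fin d) ℝ) + (T * T - K) + K = M := by
    rw [hTT]; abel
  rwa [e] at h2

theorem exists_finsupp_of_posDef (hd : 1 ≤ d) {M : Matrix (Fin d) (Fin d) ℝ} (hM : M.PosDef) :
    ∃ m : (Fin d → ℤ) →₀ NNReal, ∑ J ∈ m.support, (m J : ℝ) •
      Matrix.vecMulVec (realVec J) (realVec J) = M := by
  obtain ⟨m, hm⟩ := Finsupp.mem_span_range_iff_exists_finsupp.1 (mem_integerCone_of_posDef hd hM)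
  exact ⟨m, hm⟩

end IntegerCone

end

noncomputable section

/-! ### Elementary processes with prescribed drift and diffusion matrices -/

section ElementaryProcess

variable {d : ℕ}

theorem single_one_injective {i j : Fin d} (h : (Pi.single i 1 : Fin d → ℤ) = Pi.single j 1) :
    i = j := by
  by_contra hij
  have := congrFun h i
  simp [Pi.single_eq_of_ne hij] at this

/-- Symmetric positive weights realising a given diffusion matrix. -/
theorem exists_symmetric_weights (hd : 1 ≤ d) {s : Matrix (Fin d) (Fin d) ℝ} (hs : s.PosDef) :
    ∃ (T : Finset (Fin d → ℤ)) (w : (Fin d → ℤ) → ℝ), (∀ J ∈ T, 0 < w J) ∧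
      (∀ J ∈ T, -J ∈ T) ∧ (∀ J, w (-J) = w J) ∧
      (∀ j : Fin d, Pi.single j 1 ∈ T ∧ lamMin s / 4 ≤ w (Pi.single j 1)) ∧
      ∑ J ∈ T, w J • Matrix.vecMulVec (realVec J) (realVec J) = s := by
  classical
  have hlam := lamMin_pos hd hs
  set lam := lamMin s with hlamdef
  have hN : (s - (lam / 2) • (1 : Matrix (Fin d) (Fin d) ℝ)).PosDef := by
    refine Matrix.PosDef.of_dotProduct_mulVec_pos (hs.1.sub (by simp [Matrix.IsHermitian]))
      fun v hv => ?_
    have h1 := lamMin_mul_le hs.1 v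
    have h2 : 0 < v ⬝ᵥ v := by
      have := Matrix.dotProduct_star_self_pos_iff (v := v)
      simpa using this.2 hv
    rw [star_trivial, Matrix.sub_mulVec, dotProduct_sub, Matrix.smul_mulVec, Matrix.one_mulVec,
      dotProduct_smul, smul_eq_mul]
    nlinarith
  obtain ⟨m, hm⟩ := exists_finsupp_of_posDef hd hN
  set e : Fin d → Fin d → ℤ := fun j => Pi.single j 1 with he
  -- `b` marks the jumps `±e_j`. Adding `(lam / 4) b` restores the `(lam / 2)` multiple of the
  -- identity that was subtracted, and secures a weight of at least `lam / 4` on each of them.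
  set b : (Fin d → ℤ) → ℝ := fun J =>
    ∑ j, ((if J = e j then (1 : ℝ) else 0) + (if J = -e j then (1 : ℝ) else 0)) with hb
  have hb0 : ∀ J, 0 ≤ b J := fun J => Finset.sum_nonneg fun j _ => by positivity
  have hb1 : ∀ j, 1 ≤ b (e j) := fun j => by
    refine le_trans ?_ (Finset.single_le_sum (f := fun i => (if e j = e i then (1 : ℝ) else 0) +
      (if e j = -e i then (1 : ℝ) else 0)) (fun i _ => by positivity) (Finset.mem_univ j))
    rw [if_pos rfl]
    have : (0 : ℝ) ≤ if e j = -e j then (1 : ℝ) else 0 := by positivity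
    linarith
  have hbneg : ∀ J, b (-J) = b J := fun J => by
    refine Finset.sum_congr rfl fun j _ => ?_
    rw [add_comm]
    simp only [neg_eq_iff_eq_neg, neg_neg]
  set T : Finset (Fin d → ℤ) := m.support ∪ m.support.image Neg.neg ∪
    (Finset.univ.image e ∪ Finset.univ.image fun j => -e j) with hT
  have hTm : ∀ J, J ∈ T ↔ (m J ≠ 0 ∨ m (-J) ≠ 0) ∨ ((∃ j, e j = J) ∨ ∃ j, -e j = J) := fun J => by
    simp only [hT, Finset.mem_union, Finsupp.mem_support_iff, Finset.mem_image, Finset.mem_univ,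
      true_and]
    have : (∃ a, m a ≠ 0 ∧ -a = J) ↔ m (-J) ≠ 0 :=
      ⟨fun ⟨a, h1, h2⟩ => by rw [← h2, neg_neg]; exact h1, fun h => ⟨-J, h, neg_neg J⟩⟩
    rw [this]
  have hTneg : ∀ J ∈ T, -J ∈ T := fun J hJ => by
    rw [hTm] at hJ ⊢
    rw [neg_neg]
    rcases hJ with (h | h) | ⟨j, h⟩ | ⟨j, h⟩
    · exact Or.inl (Or.inr h)
    · exact Or.inl (Or.inl h)
    · exact Or.inr (Or.inr ⟨j, by rw [h]⟩)
    · exact Or.inr (Or.inl ⟨j, by rw [← h, neg_neg]⟩)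
  have heT : ∀ j, e j ∈ T := fun j => (hTm _).2 (Or.inr (Or.inl ⟨j, rfl⟩))
  -- Since `J Jᵀ` is even in `J`, symmetrising the weights leaves the matrix unchanged while it
  -- makes their drift cancel.
  refine ⟨T, fun J => ((m J : ℝ) + m (-J)) / 2 + lam / 4 * b J, fun J hJ => ?_, hTneg,
    fun J => ?_, fun j => ⟨heT j, ?_⟩, ?_⟩
  · have h1 : (0 : ℝ) ≤ m J := (m J).2
    have h2 : (0 : ℝ) ≤ m (-J) := (m (-J)).2
    have h3 := mul_nonneg (show 0 ≤ lam / 4 by positivity) (hb0 J)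
    rcases (hTm J).1 hJ with (h | h) | ⟨j, h⟩ | ⟨j, h⟩
    · have : (0 : ℝ) < m J := NNReal.coe_pos.2 (pos_iff_ne_zero.2 h)
      linarith
    · have : (0 : ℝ) < m (-J) := NNReal.coe_pos.2 (pos_iff_ne_zero.2 h)
      linarith
    · have := hb1 j
      rw [h] at this
      have : 0 < lam / 4 * b J := by positivity
      linarith
    · have := hb1 j
      rw [← hbneg, h] at this
      have : 0 < lam / 4 * b J := by positivity
      linarith
  · simp only [neg_neg, hbneg]
    ring
  · have h1 : (0 : ℝ) ≤ m (e j) := (m _).2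
    have h2 : (0 : ℝ) ≤ m (-e j) := (m _).2
    have h3 := mul_le_mul_of_nonneg_left (hb1 j) (show 0 ≤ lam / 4 by positivity)
    change lam / 4 ≤ ((m (e j) : ℝ) + m (-e j)) / 2 + lam / 4 * b (e j)
    linarith
  · set V : (Fin d → ℤ) → Matrix (Fin d) (Fin d) ℝ := fun J =>
      Matrix.vecMulVec (realVec J) (realVec J) with hV
    have hVneg : ∀ J, V (-J) = V J := fun J => by
      simp only [hV, realVec_neg, Matrix.neg_vecMulVec, Matrix.vecMulVec_neg, neg_neg]
    have s1 : ∑ J ∈ T, (m J : ℝ) • V J = s - (lam / 2) • 1 := by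
      rw [← hm]
      refine (Finset.sum_subset (fun J hJ => ?_) fun J _ hJ => ?_).symm
      · exact (hTm J).2 (Or.inl (Or.inl (Finsupp.mem_support_iff.1 hJ)))
      · rw [Finsupp.notMem_support_iff.1 hJ, NNReal.coe_zero, zero_smul]
    have s2 : ∑ J ∈ T, (m (-J) : ℝ) • V J = s - (lam / 2) • 1 := by
      rw [← s1]
      refine Finset.sum_bij' (fun J _ => -J) (fun J _ => -J) (fun J hJ => hTneg J hJ)
        (fun J hJ => hTneg J hJ) (fun J _ => neg_neg J) (fun J _ => neg_neg J) fun J _ => ?_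
      rw [hVneg]
    have hVe : ∀ j, V (e j) = Matrix.single j j 1 := fun j => by
      simp only [hV, he, realVec_single, Matrix.single_eq_single_vecMulVec_single]
    have s3 : ∑ J ∈ T, b J • V J = (2 : ℝ) • 1 := by
      simp only [hb, Finset.sum_smul]
      rw [Finset.sum_comm, ← Matrix.sum_single_one, Finset.smul_sum]
      refine Finset.sum_congr rfl fun j _ => ?_
      simp only [add_smul, ite_smul, one_smul, zero_smul, Finset.sum_add_distrib,
        Finset.sum_ite_eq', heT j, hTneg _ (heT j), if_true, hVneg, hVe]
      rw [two_smul]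
    calc ∑ J ∈ T, (((m J : ℝ) + m (-J)) / 2 + lam / 4 * b J) • V J =
        (1 / 2 : ℝ) • ∑ J ∈ T, (m J : ℝ) • V J + (1 / 2 : ℝ) • ∑ J ∈ T, (m (-J) : ℝ) • V J +
          (lam / 4) • ∑ J ∈ T, b J • V J := by
          simp only [Finset.smul_sum, ← Finset.sum_add_distrib, smul_smul, ← add_smul]
          refine Finset.sum_congr rfl fun J _ => ?_
          congr 1
          ring
      _ = s := by
          rw [s1, s2, s3, smul_smul, ← add_smul, smul_sub, smul_smul]
          norm_num
          rw [show lam / 4 * 2 = lam / 2 by ring, sub_add_cancel]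

open Classical in
/-- The process with the rates `w_J`, plus the linear rate `(A (x - c))_j` for the jump `e_j`,
truncated at zero. -/
def elementaryProcess (A : Matrix (Fin d) (Fin d) ℝ) (c : EuclideanSpace ℝ (Fin d))
    (T : Finset (Fin d → ℤ)) (w : (Fin d → ℤ) → ℝ) : JumpProcess d where
  jumps := T
  g J x := max 0 (w J + ∑ j, if J = Pi.single j 1 then
    (Matrix.toEuclideanCLM (𝕜 := ℝ) A (x - c)) j else 0)
  g_nonneg _ _ _ := le_max_left _ _

/-- The symmetric weights give covariance `s` and no drift; the linear rates of the `e_j` give the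
drift `A(x - c)`. On the stated ball a linear rate is at most `λ_min(s)/8` in absolute value, half
of the guaranteed weight `λ_min(s)/4`, so the truncation at zero is inactive and the rates stay
above half their values at `c`. -/
theorem exists_elementary (hd : 1 ≤ d) {A s : Matrix (Fin d) (Fin d) ℝ} (hA : IsHurwitz A)
    (hs : s.PosDef) (c : EuclideanSpace ℝ (Fin d)) :
    ∃ P : JumpProcess d, P.Elementary c (lamMin s / (8 * spectralNorm₂ A)) ∧ P.A c = A ∧
      P.sigma2 c = s := by
  classical
  obtain ⟨T, w, hw0, hTneg, hwneg, hwe, hws⟩ := exists_symmetric_weights hd hs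
  have hlam := lamMin_pos hd hs
  have hnA : 0 < spectralNorm₂ A := spectralNorm₂_pos (hA.ne_zero hd)
  set ρ := lamMin s / (8 * spectralNorm₂ A) with hρ
  have hρ0 : 0 < ρ := by positivity
  set L := Matrix.toEuclideanCLM (𝕜 := ℝ) A with hL
  set P := elementaryProcess A c T w with hP
  have hself : c ∈ Metric.closedBall c ρ := Metric.mem_closedBall_self hρ0.le
  have hy : ∀ x ∈ Metric.closedBall c ρ, ∀ j, |(L (x - c)) j| ≤ lamMin s / 8 := by
    intro x hx j
    rw [mem_closedBall_iff_norm] at hx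
    calc |(L (x - c)) j| ≤ ‖L (x - c)‖ := by
          simpa only [Real.norm_eq_abs] using PiLp.norm_apply_le (L (x - c)) j
      _ ≤ spectralNorm₂ A * ‖x - c‖ := L.le_opNorm _
      _ ≤ spectralNorm₂ A * ρ := by gcongr
      _ = lamMin s / 8 := by rw [hρ]; field_simp
  have hse : ∀ (k : Fin d) (y : Fin d → ℝ),
      ∑ j, (if (Pi.single k 1 : Fin d → ℤ) = Pi.single j 1 then y j else 0) = y k := by
    intro k y
    rw [Finset.sum_eq_single k]
    · rw [if_pos rfl]
    · intro j _ hj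
      rw [if_neg fun h => hj (single_one_injective h).symm]
    · intro h; exact absurd (Finset.mem_univ k) h
  have hge : ∀ k, ∀ x ∈ Metric.closedBall c ρ,
      P.g (Pi.single k 1) x = w (Pi.single k 1) + (L (x - c)) k := by
    intro k x hx
    simp only [hP, elementaryProcess, hse k]
    refine max_eq_right ?_
    have h1 := (abs_le.1 (hy x hx k)).1
    have h2 := (hwe k).2
    change 0 ≤ w (Pi.single k 1) + (L (x - c)) k
    linarith
  have hgo : ∀ J ∈ T, (∀ j : Fin d, J ≠ Pi.single j 1) → ∀ x, P.g J x = w J := by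
    intro J hJ hne x
    simp only [hP, elementaryProcess]
    rw [Finset.sum_eq_zero fun j _ => if_neg (hne j), add_zero]
    exact max_eq_right (hw0 J hJ).le
  have hg : ∀ J ∈ T, ∀ x ∈ Metric.closedBall c ρ,
      P.g J x = w J + ∑ j, if J = Pi.single j 1 then (L (x - c)) j else 0 := by
    intro J hJ x hx
    by_cases h : ∃ k, J = Pi.single k 1
    · obtain ⟨k, rfl⟩ := h
      rw [hge k x hx, hse k]
    · push Not at h
      rw [hgo J hJ h, Finset.sum_eq_zero fun j _ => if_neg (h j), add_zero]
  have hgc : ∀ J ∈ T, P.g J c = w J := by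
    intro J hJ
    rw [hg J hJ c hself]
    simp
  have hsym : ∑ J ∈ T, w J • intVec J = 0 := by
    have h1 : ∑ J ∈ T, w J • intVec J = ∑ J ∈ T, -(w J • intVec J) := by
      refine Finset.sum_bij' (fun J _ => -J) (fun J _ => -J) (fun J hJ => hTneg J hJ)
        (fun J hJ => hTneg J hJ) (fun J _ => neg_neg J) (fun J _ => neg_neg J) fun J _ => ?_
      rw [hwneg, ← smul_neg]
      congr 1
      ext i
      simp [intVec]
    rw [Finset.sum_neg_distrib] at h1
    have h2 : (2 : ℝ) • ∑ J ∈ T, w J • intVec J = 0 := by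
      rw [two_smul]
      nth_rewrite 1 [h1]
      exact neg_add_cancel _
    exact (smul_eq_zero.1 h2).resolve_left two_ne_zero
  have hdrift : ∀ x ∈ Metric.closedBall c ρ, P.drift x = L (x - c) := by
    intro x hx
    have h1 : P.drift x = ∑ J ∈ T, (w J • intVec J +
        ∑ j, if J = Pi.single j 1 then (L (x - c)) j • intVec J else 0) := by
      refine Finset.sum_congr rfl fun J hJ => ?_
      rw [hg J hJ x hx, add_smul, Finset.sum_smul]
      simp only [ite_smul, zero_smul]
    rw [h1, Finset.sum_add_distrib, hsym, zero_add, Finset.sum_comm]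
    have h2 : ∀ j, ∑ J ∈ T, (if J = Pi.single j 1 then (L (x - c)) j • intVec J else 0) =
        EuclideanSpace.single j ((L (x - c)) j) := by
      intro j
      rw [Finset.sum_ite_eq', if_pos (hwe j).1]
      ext i
      by_cases h : i = j
      · subst h; simp [intVec]
      · simp [intVec, h]
    simp only [h2]
    ext i
    simp [Finset.sum_apply, Pi.single_apply]
  have hAc : P.A c = A := by
    have h1 : HasFDerivAt P.drift L c := by
      have h2 : HasFDerivAt (fun x => L (x - c)) L c := by
        have h3 := HasFDerivAt.comp (g := L) (f := fun x => x - c) c L.hasFDerivAt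
          ((hasFDerivAt_id c).sub_const c)
        rwa [ContinuousLinearMap.comp_id] at h3
      refine h2.congr_of_eventuallyEq ?_
      filter_upwards [Metric.closedBall_mem_nhds c hρ0] with x hx using hdrift x hx
    ext i j
    rw [JumpProcess.A, Matrix.of_apply, h1.fderiv, hL]
    change A.mulVec (Pi.single j 1) i = A i j
    rw [Matrix.mulVec_single_one]
    rfl
  have hsc : P.sigma2 c = s := by
    rw [← hws]
    exact Finset.sum_congr rfl fun J hJ => by rw [hgc J hJ]; rfl
  refine ⟨P, ⟨hρ0, ?_, by rwa [hAc], fun J hJ => (hgc J hJ).symm ▸ hw0 J hJ,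
    fun j => ⟨(hwe j).1, hTneg _ (hwe j).1⟩, fun J hJ hne x _ => ?_, fun j => ?_,
    fun j x hx => ?_⟩, hAc, hsc⟩
  · rw [hdrift c hself, sub_self, map_zero]
  · rw [hgo J hJ hne, hgo J hJ hne]
  · refine ⟨(EuclideanSpace.proj j : EuclideanSpace ℝ (Fin d) →L[ℝ] ℝ).comp L,
      w (Pi.single j 1) - (L c) j, fun x hx => ?_⟩
    rw [hge j x hx, map_sub]
    change w (Pi.single j 1) + ((L x) j - (L c) j) = (L x) j + (w (Pi.single j 1) - (L c) j)
    ring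
  · rw [hgc _ (hwe j).1, hge j x hx]
    have h1 := (abs_le.1 (hy x hx j)).1
    have h2 := (hwe j).2
    linarith

end ElementaryProcess

end

noncomputable section

/-! ### Density dependent processes as lattice models -/

/-- The mean value inequality used twice: for the derivative, and then for `f` minus its
linearisation on the ball of radius `‖x - c‖`. The factor `1/2` of Taylor's formula is given away.
-/
theorem abs_sub_sub_fderiv_le {E : Type*} [NormedAddCommGroup E] [NormedSpace ℝ E] {f : E → ℝ}
    {c : E} {r K : ℝ} (hr : 0 < r) (hf : ContDiffOn ℝ 2 f (Metric.closedBall c r))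
    (hK : ∀ x ∈ Metric.closedBall c r, ‖iteratedFDerivWithin ℝ 2 f (Metric.closedBall c r) x‖ ≤ K)
    {x : E} (hx : x ∈ Metric.closedBall c r) :
    |f x - f c - fderiv ℝ f c (x - c)| ≤ K * ‖x - c‖ ^ 2 := by
  set B := Metric.closedBall c r with hB
  have hcB : c ∈ B := Metric.mem_closedBall_self hr.le
  have hconv : Convex ℝ B := convex_closedBall c r
  have hu : UniqueDiffOn ℝ B := uniqueDiffOn_convex hconv
    ⟨c, Metric.ball_subset_interior_closedBall (Metric.mem_ball_self hr)⟩
  have hK0 : 0 ≤ K := (norm_nonneg _).trans (hK c hcB)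
  have hd1 : DifferentiableOn ℝ f B := hf.differentiableOn (by norm_num)
  have hd2 : DifferentiableOn ℝ (fderivWithin ℝ f B) B :=
    (hf.fderivWithin (m := 1) hu (by norm_num)).differentiableOn (by norm_num)
  have hbound : ∀ y ∈ B, ‖fderivWithin ℝ (fderivWithin ℝ f B) B y‖ ≤ K := by
    intro y hy
    rw [← norm_iteratedFDerivWithin_one _ (hu y hy),
      norm_iteratedFDerivWithin_fderivWithin hu hy]
    exact hK y hy
  have hfc : fderivWithin ℝ f B c = fderiv ℝ f c :=
    fderivWithin_of_mem_nhds (Metric.closedBall_mem_nhds c hr)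
  have hsub : Metric.closedBall c ‖x - c‖ ⊆ B :=
    Metric.closedBall_subset_closedBall (mem_closedBall_iff_norm.1 hx)
  have h := (convex_closedBall c ‖x - c‖).norm_image_sub_le_of_norm_hasFDerivWithin_le'
    (f := f) (f' := fderivWithin ℝ f B) (φ := fderiv ℝ f c) (C := K * ‖x - c‖)
    (fun y hy => (hd1 y (hsub hy)).hasFDerivWithinAt.mono hsub) (fun y hy => ?_)
    (Metric.mem_closedBall_self (norm_nonneg _)) (mem_closedBall_iff_norm.2 le_rfl)
  · rw [Real.norm_eq_abs] at h
    calc _ ≤ _ := h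
      _ = _ := by ring
  · rw [← hfc]
    refine (hconv.norm_image_sub_le_of_norm_fderivWithin_le hd2 hbound hcB (hsub hy)).trans ?_
    gcongr
    exact mem_closedBall_iff_norm.1 hy

theorem Finset.exists_pos_le {α : Type*} (s : Finset α) {f : α → ℝ} (hf : ∀ a ∈ s, 0 < f a) :
    ∃ ε : ℝ, 0 < ε ∧ ∀ a ∈ s, ε ≤ f a := by
  rcases s.eq_empty_or_nonempty with rfl | hs
  · exact ⟨1, one_pos, fun a ha => absurd ha (Finset.notMem_empty a)⟩
  · obtain ⟨b, hb, hmin⟩ := s.exists_min_image f hs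
    exact ⟨f b, hf b hb, hmin⟩

theorem clm_apply_eq_dotProduct {d : ℕ} (L : EuclideanSpace ℝ (Fin d) →L[ℝ] ℝ)
    (v : EuclideanSpace ℝ (Fin d)) :
    L v = (fun j => L (EuclideanSpace.single j 1)) ⬝ᵥ v.ofLp := by
  have h : v = ∑ j, v j • EuclideanSpace.single j (1 : ℝ) := by
    ext i
    simp [Finset.sum_apply, Pi.single_apply]
  conv_lhs => rw [h, map_sum]
  simp only [map_smul, smul_eq_mul, dotProduct]
  exact Finset.sum_congr rfl fun j _ => mul_comm _ _

namespace JumpProcess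

variable {d : ℕ} {P : JumpProcess d} {c : EuclideanSpace ℝ (Fin d)}

theorem sigma2_mulVec (v w : Fin d → ℝ) :
    v ⬝ᵥ (P.sigma2 c).mulVec w =
      ∑ J ∈ P.jumps, P.g J c * ((realVec J ⬝ᵥ v) * (realVec J ⬝ᵥ w)) := by
  rw [sigma2, Matrix.sum_mulVec, dotProduct_sum]
  refine Finset.sum_congr rfl fun J _ => ?_
  rw [Matrix.smul_mulVec, dotProduct_smul, smul_eq_mul, Matrix.vecMulVec_mulVec]
  rw [dotProduct_smul, dotProduct_comm v]
  rfl

theorem sigma2_isHermitian : (P.sigma2 c).IsHermitian := by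
  rw [sigma2, Matrix.IsHermitian, Matrix.conjTranspose_sum]
  refine Finset.sum_congr rfl fun J _ => ?_
  ext i j
  simp [Matrix.vecMulVec_apply, mul_comm]

/-- A vector on which the form vanishes is orthogonal to every jump, hence to sums of jumps, hence
to every `e_j`. -/
theorem sigma2_posDef (hpos : ∀ J ∈ P.jumps, 0 < P.g J c)
    (hgen : ∀ j : Fin d, ∃ l : List (Fin d → ℤ), (∀ J ∈ l, J ∈ P.jumps) ∧
      Pi.single j 1 = l.sum) : (P.sigma2 c).PosDef := by
  refine Matrix.PosDef.of_dotProduct_mulVec_pos sigma2_isHermitian fun v hv => ?_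
  rw [star_trivial, sigma2_mulVec]
  have hnn : ∀ J ∈ P.jumps, 0 ≤ P.g J c * ((realVec J ⬝ᵥ v) * (realVec J ⬝ᵥ v)) := fun J hJ =>
    mul_nonneg (hpos J hJ).le (mul_self_nonneg _)
  refine (Finset.sum_nonneg hnn).lt_of_ne' fun h => hv ?_
  have h0 := (Finset.sum_eq_zero_iff_of_nonneg hnn).1 h
  have h1 : ∀ J ∈ P.jumps, realVec J ⬝ᵥ v = 0 := fun J hJ =>
    mul_self_eq_zero.1 ((mul_eq_zero.1 (h0 J hJ)).resolve_left (hpos J hJ).ne')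
  have h2 : ∀ l : List (Fin d → ℤ), (∀ J ∈ l, J ∈ P.jumps) → realVec l.sum ⬝ᵥ v = 0 := by
    intro l
    induction l with
    | nil => intro _; simp [realVec, dotProduct]
    | cons J l ih =>
      intro hl
      rw [List.sum_cons, realVec_add, add_dotProduct, h1 J (hl J List.mem_cons_self),
        ih fun K hK => hl K (List.mem_cons_of_mem _ hK), add_zero]
  funext j
  obtain ⟨l, hl, hj⟩ := hgen j
  have h3 := h2 l hl
  rw [← hj, realVec_single, single_one_dotProduct] at h3
  exact h3

theorem A_eq_jumpJacobian (hdiff : ∀ J ∈ P.jumps, DifferentiableAt ℝ (P.g J) c) :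
    P.A c = jumpJacobian P.jumps
      fun J j => fderiv ℝ (P.g J) c (EuclideanSpace.single j 1) := by
  have h : HasFDerivAt P.drift
      (∑ J ∈ P.jumps, (fderiv ℝ (P.g J) c).smulRight (intVec J)) c := by
    have h2 := HasFDerivAt.fun_sum (u := P.jumps) (A := fun J x => P.g J x • intVec J)
      (A' := fun J => (fderiv ℝ (P.g J) c).smulRight (intVec J)) (x := c) fun J hJ =>
        (hdiff J hJ).hasFDerivAt.smul_const (intVec J)
    exact h2
  ext i j
  rw [A, Matrix.of_apply, h.fderiv, jumpJacobian, Matrix.of_apply]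
  simp [intVec, mul_comm]

theorem sigma2_eq_jumpCovariance :
    P.sigma2 c = jumpCovariance P.jumps fun J => P.g J c := by
  ext i j
  rw [sigma2, Matrix.sum_apply, jumpCovariance, Matrix.of_apply]
  simp [Matrix.vecMulVec_apply]

theorem Lam_eq : P.Lam c = ∑ J ∈ P.jumps, P.g J c * (realVec J ⬝ᵥ realVec J) := by
  rw [Lam, sigma2, Matrix.trace_sum]
  refine Finset.sum_congr rfl fun J _ => ?_
  rw [Matrix.trace_smul, Matrix.trace_vecMulVec]
  rfl

/-- In effect `|J| ≤ |J|²` for integer vectors; this lets the remainder terms add up to the trace of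
`σ²`. -/
theorem realVec_dotProduct_self_sq (J : Fin d → ℤ) :
    realVec J ⬝ᵥ realVec J ≤ (realVec J ⬝ᵥ realVec J) ^ 2 := by
  have h : realVec J ⬝ᵥ realVec J = ((J ⬝ᵥ J : ℤ) : ℝ) := by simp [dotProduct, realVec]
  rw [h]
  have h2 : J ⬝ᵥ J ≤ (J ⬝ᵥ J) ^ 2 := Int.le_self_sq _
  exact_mod_cast h2

theorem smul_intVec_sub {n : ℕ} (hn : 1 ≤ n) (X : Fin d → ℤ) :
    (n : ℝ)⁻¹ • intVec X - c = (n : ℝ)⁻¹ • WithLp.toLp 2 (devVec c.ofLp n X) := by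
  have hn' : (n : ℝ) ≠ 0 := by positivity
  ext i
  simp only [intVec, devVec, PiLp.sub_apply, PiLp.smul_apply, smul_eq_mul]
  field_simp

theorem Sig_spec (hst : IsHurwitz (P.A c)) (hs : (P.sigma2 c).PosDef) :
    (P.Sig c).PosDef ∧ P.A c * P.Sig c + P.Sig c * (P.A c).transpose + P.sigma2 c = 0 :=
  hst.lyapunovSol_spec hs

/-- A process with linearly approximated rates gives a lattice model, on a ball that is small
compared with the size of the second order terms. -/
theorem latticeModel (hd : 1 ≤ d) {r L δ : ℝ} (heq : P.drift c = 0) (hst : IsHurwitz (P.A c))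
    (hpos : ∀ J ∈ P.jumps, 0 < P.g J c)
    (hgen : ∀ j : Fin d, ∃ l : List (Fin d → ℤ), (∀ J ∈ l, J ∈ P.jumps) ∧
      Pi.single j 1 = l.sum)
    (hdiff : ∀ J ∈ P.jumps, DifferentiableAt ℝ (P.g J) c)
    (htaylor : ∀ J ∈ P.jumps, ∀ x ∈ Metric.closedBall c r,
      |P.g J x - P.g J c - fderiv ℝ (P.g J) c (x - c)| ≤ L * P.g J c * ‖x - c‖ ^ 2)
    (hlow : ∃ ε : ℝ, 0 < ε ∧ ∀ J ∈ P.jumps, ∀ x ∈ Metric.closedBall c r,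
      ε * P.g J c ≤ P.g J x)
    (hL : 0 ≤ L) (hδ : 0 < δ) (hδr : δ * √(lamMax (P.Sig c)) ≤ r)
    (hcond : 4 * P.Lam c * L * lamMax (P.Sig c) * δ ≤ P.alpha1 c * √(lamMin (P.Sig c))) :
    LatticeModel (P.Sig c)⁻¹ c.ofLp δ P.jumps (fun J => P.g J c)
      (fun J j => fderiv ℝ (P.g J) c (EuclideanSpace.single j 1)) P.latticeRate := by
  have hs := sigma2_posDef hpos hgen
  obtain ⟨hSig, hlyap⟩ := Sig_spec hst hs
  set Sg := P.Sig c with hSg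
  have hΘ : (Sg⁻¹).PosDef := hSig.inv
  set Θ := Sg⁻¹ with hΘdef
  have hΘinv : Θ⁻¹ = Sg := Matrix.nonsing_inv_nonsing_inv _ (hSig.isUnit.map Matrix.detMonoidHom)
  have hlm := lamMin_pos hd hSig
  have hlM := lamMax_pos hd hSig
  have hα : 0 < P.alpha1 c := by
    have := lamMin_pos hd (standardized_posDef hSig hs)
    exact half_pos this
  set u : (Fin d → ℤ) → Fin d → ℝ :=
    fun J j => fderiv ℝ (P.g J) c (EuclideanSpace.single j 1) with hu
  have hA : P.A c = jumpJacobian P.jumps u := A_eq_jumpJacobian hdiff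
  have hnorm : ∀ n : ℕ, 1 ≤ n → ∀ X : Fin d → ℤ, ‖(n : ℝ)⁻¹ • intVec X - c‖ ^ 2 ≤
      lamMax Sg * (qform Θ (devVec c.ofLp n X) / n / n) := by
    intro n hn X
    have hn' : (0 : ℝ) < n := by positivity
    rw [smul_intVec_sub hn, norm_smul, mul_pow, sq_norm_toLp, norm_inv, Real.norm_natCast]
    have h := dotProduct_le_lamMax_mul hSig (devVec c.ofLp n X)
    calc ((n : ℝ)⁻¹) ^ 2 * (devVec c.ofLp n X ⬝ᵥ devVec c.ofLp n X) ≤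
        ((n : ℝ)⁻¹) ^ 2 * (lamMax Sg * qform Θ (devVec c.ofLp n X)) := by gcongr; exact h
      _ = _ := by field_simp
  have hball : ∀ n : ℕ, 1 ≤ n → ∀ X : Fin d → ℤ, qform Θ (devVec c.ofLp n X) ≤ (n * δ) ^ 2 →
      (n : ℝ)⁻¹ • intVec X ∈ Metric.closedBall c r := by
    intro n hn X hX
    have hn' : (0 : ℝ) < n := by positivity
    rw [mem_closedBall_iff_norm]
    refine le_trans ?_ hδr
    refine le_of_sq_le_sq ?_ (by positivity)
    rw [mul_pow, Real.sq_sqrt hlM.le]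
    refine (hnorm n hn X).trans ?_
    rw [mul_comm]
    gcongr
    rw [div_div, div_le_iff₀ (by positivity)]
    linarith
  have hrem : ∀ n : ℕ, 1 ≤ n → ∀ J ∈ P.jumps, ∀ X, qform Θ (devVec c.ofLp n X) ≤ (n * δ) ^ 2 →
      |P.latticeRate n J X - (P.g J c + (u J ⬝ᵥ devVec c.ofLp n X) / n)| ≤
        L * P.g J c * (lamMax Sg * (qform Θ (devVec c.ofLp n X) / n / n)) := by
    intro n hn J hJ X hX
    have h := htaylor J hJ _ (hball n hn X hX)
    have e : fderiv ℝ (P.g J) c ((n : ℝ)⁻¹ • intVec X - c) = (u J ⬝ᵥ devVec c.ofLp n X) / n := by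
      rw [smul_intVec_sub hn, map_smul, clm_apply_eq_dotProduct, smul_eq_mul, inv_mul_eq_div]
    rw [e] at h
    rw [← sub_sub]
    refine h.trans ?_
    have := (hpos J hJ).le
    gcongr
    exact hnorm n hn X
  refine ⟨hΘ, hδ, fun i => ?_, ?_, ?_, ?_, ?_, hgen⟩
  · have h := congrArg (fun v : EuclideanSpace ℝ (Fin d) => v i) heq
    simpa [drift, intVec] using h
  · rw [hΘinv, ← hA, ← sigma2_eq_jumpCovariance]
    exact hlyap
  · refine ⟨L * (∑ J ∈ P.jumps, P.g J c) * lamMax Sg + 1, ?_, fun n hn J hJ X hX => ?_⟩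
    · have := Finset.sum_nonneg fun J hJ => (hpos J hJ).le
      positivity
    · have hq : 0 ≤ qform Θ (devVec c.ofLp n X) / n / n := by
        have := qform_nonneg hΘ (devVec c.ofLp n X); positivity
      have h1 := Finset.single_le_sum (fun J hJ => (hpos J hJ).le) hJ
      have h2 : L * P.g J c * (lamMax Sg * (qform Θ (devVec c.ofLp n X) / n / n)) ≤
          L * (∑ J ∈ P.jumps, P.g J c) * (lamMax Sg * (qform Θ (devVec c.ofLp n X) / n / n)) := by
        gcongr
      have h3 := (hrem n hn J hJ X hX).trans h2
      linarith
  · obtain ⟨ε, hε, h⟩ := hlow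
    obtain ⟨ε', hε', h'⟩ := P.jumps.exists_pos_le hpos
    refine ⟨ε * ε', by positivity, fun n hn J hJ X hX => ?_⟩
    exact (mul_le_mul_of_nonneg_left (h' J hJ) hε.le).trans (h J hJ _ (hball n hn X hX))
  -- The linear part of the drift contracts at rate `α₁`; the smallness condition on `δ` limits the
  -- second order remainder to a quarter of it.
  · refine ⟨3 / 4 * P.alpha1 c, by positivity, fun n hn X hX => ?_⟩
    have hn' : (0 : ℝ) < n := by positivity
    set Y := devVec c.ofLp n X with hY
    set q := qform Θ Y with hq
    have hq0 : 0 ≤ q := qform_nonneg hΘ Y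
    set z := Θ.mulVec Y with hz
    have hb : ∀ J, bform Θ (realVec J) Y = realVec J ⬝ᵥ z := fun J => rfl
    have t1 : ∑ J ∈ P.jumps, P.g J c * bform Θ (realVec J) Y = 0 := by
      have h : ∑ J ∈ P.jumps, P.g J c • realVec J = 0 := by
        funext i
        have h := congrArg (fun v : EuclideanSpace ℝ (Fin d) => v i) heq
        simpa [drift, intVec, realVec] using h
      have h2 := congrArg (fun v => v ⬝ᵥ z) h
      simp only [sum_dotProduct, smul_dotProduct, zero_dotProduct, smul_eq_mul] at h2
      simpa only [hb] using h2
    have t2 : ∑ J ∈ P.jumps, (u J ⬝ᵥ Y) / n * bform Θ (realVec J) Y ≤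
        -(P.alpha1 c * (q / n)) := by
      have h1 : z ⬝ᵥ (P.A c).mulVec Y = ∑ J ∈ P.jumps, (u J ⬝ᵥ Y) * bform Θ (realVec J) Y := by
        have h2 : (P.A c).mulVec Y = ∑ J ∈ P.jumps, (u J ⬝ᵥ Y) • realVec J := by
          rw [hA]
          funext i
          simp only [jumpJacobian, Matrix.mulVec, dotProduct, Matrix.of_apply, Finset.sum_apply,
            Pi.smul_apply, smul_eq_mul, realVec, Finset.sum_mul]
          rw [Finset.sum_comm]
          exact Finset.sum_congr rfl fun _ _ => Finset.sum_congr rfl fun _ _ => by ring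
        rw [h2, dotProduct_sum]
        refine Finset.sum_congr rfl fun J _ => ?_
        rw [dotProduct_smul, hb, smul_eq_mul, dotProduct_comm z]
      have h3 := dotProduct_mulVec_of_lyapunov hSig hlyap Y
      have h4 := (standardized_mulVec hSig hs.1).2 Y
      have h5 : lamMin (standardized Sg (P.sigma2 c)) = 2 * P.alpha1 c := by
        rw [alpha1]; ring
      rw [h5] at h4
      change 2 * P.alpha1 c * q ≤ z ⬝ᵥ (P.sigma2 c).mulVec z at h4
      change z ⬝ᵥ (P.A c).mulVec Y = -(z ⬝ᵥ (P.sigma2 c).mulVec z) / 2 at h3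
      rw [h1] at h3
      have h6 : ∑ J ∈ P.jumps, (u J ⬝ᵥ Y) / n * bform Θ (realVec J) Y =
          (∑ J ∈ P.jumps, (u J ⬝ᵥ Y) * bform Θ (realVec J) Y) / n := by
        rw [Finset.sum_div]
        exact Finset.sum_congr rfl fun _ _ => by ring
      rw [h6, h3, ← mul_div_assoc, ← neg_div]
      gcongr
      linarith
    -- The remainder is cubic in the deviation. One factor `√q` is bounded by `nδ`, which leaves a
    -- multiple of `q/n` with the small factor `δ`.
    have t3 : ∀ J ∈ P.jumps,
        (P.latticeRate n J X - (P.g J c + (u J ⬝ᵥ Y) / n)) * bform Θ (realVec J) Y ≤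
        P.g J c * (realVec J ⬝ᵥ realVec J) * (L * lamMax Sg * δ / √(lamMin Sg) * (q / n)) := by
      intro J hJ
      have hgJ := (hpos J hJ).le
      have h1 := hrem n hn J hJ X hX
      have hJJ : 0 ≤ realVec J ⬝ᵥ realVec J := by
        rw [← sq_norm_toLp]; positivity
      have h2 : √(qform Θ (realVec J)) ≤ (realVec J ⬝ᵥ realVec J) / √(lamMin Sg) := by
        rw [Real.sqrt_le_left (by positivity), div_pow, Real.sq_sqrt hlm.le,
          le_div_iff₀ hlm, mul_comm]
        exact (lamMin_mul_le_dotProduct hSig _).trans (realVec_dotProduct_self_sq J)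
      have h3 : √q ≤ n * δ := (qform_le_sq_iff _ (by positivity)).1 hX
      have h4 : |bform Θ (realVec J) Y| ≤
          (realVec J ⬝ᵥ realVec J) / √(lamMin Sg) * (n * δ) :=
        (abs_bform_le hΘ _ _).trans (mul_le_mul h2 h3 (Real.sqrt_nonneg _) (by positivity))
      calc _ ≤ |P.latticeRate n J X - (P.g J c + (u J ⬝ᵥ Y) / n)| * |bform Θ (realVec J) Y| := by
            rw [← abs_mul]; exact le_abs_self _
        _ ≤ L * P.g J c * (lamMax Sg * (q / n / n)) *
            ((realVec J ⬝ᵥ realVec J) / √(lamMin Sg) * (n * δ)) :=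
          mul_le_mul h1 h4 (abs_nonneg _) (by positivity)
        _ = _ := by field_simp
    have t4 : L * lamMax Sg * δ / √(lamMin Sg) * P.Lam c ≤ P.alpha1 c / 4 := by
      rw [div_mul_eq_mul_div, div_le_iff₀ (by positivity)]
      linarith
    have t5 := Finset.sum_le_sum t3
    rw [← Finset.sum_mul, ← Lam_eq, mul_comm, mul_right_comm] at t5
    have t6 := mul_le_mul_of_nonneg_right t4 (show 0 ≤ q / n by positivity)
    have e : ∑ J ∈ P.jumps, P.latticeRate n J X * bform Θ (realVec J) Y =
        ∑ J ∈ P.jumps, P.g J c * bform Θ (realVec J) Y +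
        ∑ J ∈ P.jumps, (u J ⬝ᵥ Y) / n * bform Θ (realVec J) Y +
        ∑ J ∈ P.jumps,
          (P.latticeRate n J X - (P.g J c + (u J ⬝ᵥ Y) / n)) * bform Θ (realVec J) Y := by
      rw [← Finset.sum_add_distrib, ← Finset.sum_add_distrib]
      exact Finset.sum_congr rfl fun J _ => by ring
    rw [e, t1]
    linarith

end JumpProcess

end

noncomputable section

/-! ### Regular and elementary processes as lattice models, and the main theorem. -/

namespace JumpProcess

variable {d : ℕ} {P : JumpProcess d} {c : EuclideanSpace ℝ (Fin d)}

theorem Regular.g_pos {δ₀ : ℝ} (h : P.Regular c δ₀) {J : Fin d → ℤ} (hJ : J ∈ P.jumps) :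
    0 < P.g J c := by
  obtain ⟨ε, hε, h'⟩ := h.lower_bound
  exact pos_of_mul_pos_right (h' J hJ).1 hε.le

/-- Continuity on the compact ball makes the supremum in `L2` a genuine bound; for an unbounded
family it would take the default value 0. -/
theorem Regular.norm_iteratedFDerivWithin_le {δ₀ : ℝ} (h : P.Regular c δ₀) {J : Fin d → ℤ}
    (hJ : J ∈ P.jumps) {x : EuclideanSpace ℝ (Fin d)} (hx : x ∈ Metric.closedBall c δ₀) :
    ‖iteratedFDerivWithin ℝ 2 (P.g J) (Metric.closedBall c δ₀) x‖ ≤ P.L2 c δ₀ * P.g J c := by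
  have hu : UniqueDiffOn ℝ (Metric.closedBall c δ₀) := uniqueDiffOn_convex (convex_closedBall c δ₀)
    ⟨c, Metric.ball_subset_interior_closedBall (Metric.mem_ball_self h.radius_pos)⟩
  have hcont : ContinuousOn (fun x => ‖iteratedFDerivWithin ℝ 2 (P.g J) (Metric.closedBall c δ₀) x‖)
      (Metric.closedBall c δ₀) :=
    ((h.smooth J hJ).continuousOn_iteratedFDerivWithin (m := 2) le_rfl hu).norm
  obtain ⟨B, hB⟩ := (isCompact_closedBall c δ₀).bddAbove_image hcont
  have h1 : ‖iteratedFDerivWithin ℝ 2 (P.g J) (Metric.closedBall c δ₀) x‖ ≤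
      ⨆ x : Metric.closedBall c δ₀,
        ‖iteratedFDerivWithin ℝ 2 (P.g J) (Metric.closedBall c δ₀) x.1‖ := by
    refine le_ciSup (f := fun x : Metric.closedBall c δ₀ =>
      ‖iteratedFDerivWithin ℝ 2 (P.g J) (Metric.closedBall c δ₀) x.1‖) ⟨B, ?_⟩ ⟨x, hx⟩
    rintro _ ⟨y, rfl⟩
    exact hB (Set.mem_image_of_mem _ y.2)
  have h2 := le_ciSup (f := fun J : P.jumps => (⨆ x : Metric.closedBall c δ₀,
    ‖iteratedFDerivWithin ℝ 2 (P.g J.1) (Metric.closedBall c δ₀) x.1‖) / P.g J.1 c)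
    (Set.finite_range _).bddAbove ⟨J, hJ⟩
  exact h1.trans ((div_le_iff₀ (h.g_pos hJ)).1 h2)

theorem Regular.L2_nonneg {δ₀ : ℝ} (h : P.Regular c δ₀) : 0 ≤ P.L2 c δ₀ :=
  Real.iSup_nonneg fun J => div_nonneg (Real.iSup_nonneg fun _ => norm_nonneg _) (h.g_pos J.2).le

theorem Regular.latticeModel (hd : 1 ≤ d) {δ₀ δ : ℝ} (h : P.Regular c δ₀) (hδ : 0 < δ)
    (hδr : δ * √(lamMax (P.Sig c)) ≤ δ₀)
    (hcond : 4 * P.Lam c * P.L2 c δ₀ * lamMax (P.Sig c) * δ ≤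
      P.alpha1 c * √(lamMin (P.Sig c))) :
    LatticeModel (P.Sig c)⁻¹ c.ofLp δ P.jumps (fun J => P.g J c)
      (fun J j => fderiv ℝ (P.g J) c (EuclideanSpace.single j 1)) P.latticeRate := by
  refine JumpProcess.latticeModel hd h.equilibrium h.stable (fun J hJ => h.g_pos hJ) h.generate
    (fun J hJ => ?_) (fun J hJ x hx => ?_) ?_ h.L2_nonneg hδ hδr hcond
  · exact ((h.smooth J hJ).contDiffAt (Metric.closedBall_mem_nhds c h.radius_pos)).differentiableAt
      (by norm_num)
  · exact abs_sub_sub_fderiv_le h.radius_pos (h.smooth J hJ)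
      (fun y hy => h.norm_iteratedFDerivWithin_le hJ hy) hx
  · obtain ⟨ε, hε, h'⟩ := h.lower_bound
    exact ⟨ε, hε, fun J hJ => (h' J hJ).2⟩

theorem Elementary.exists_hasFDerivAt {r : ℝ} (h : P.Elementary c r) {J : Fin d → ℤ}
    (hJ : J ∈ P.jumps) : ∃ a : EuclideanSpace ℝ (Fin d) →L[ℝ] ℝ, HasFDerivAt (P.g J) a c ∧
      ∀ x ∈ Metric.closedBall c r, P.g J x - P.g J c = a (x - c) := by
  have hc : c ∈ Metric.closedBall c r := Metric.mem_closedBall_self h.radius_pos.le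
  have hnhds := Metric.closedBall_mem_nhds c h.radius_pos
  by_cases hj : ∃ j : Fin d, J = Pi.single j 1
  · obtain ⟨j, rfl⟩ := hj
    obtain ⟨a, b, hab⟩ := h.linear j
    refine ⟨a, ?_, fun x hx => by rw [hab x hx, hab c hc, map_sub]; ring⟩
    refine (a.hasFDerivAt.add_const b).congr_of_eventuallyEq ?_
    filter_upwards [hnhds] with x hx using hab x hx
  · push Not at hj
    have hconst := h.const J hJ hj
    refine ⟨0, ?_, fun x hx => by rw [hconst x hx, sub_self]; simp⟩
    refine (hasFDerivAt_const (P.g J c) c).congr_of_eventuallyEq ?_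
    filter_upwards [hnhds] with x hx using hconst x hx

theorem Elementary.half_le {r : ℝ} (h : P.Elementary c r) {J : Fin d → ℤ} (hJ : J ∈ P.jumps)
    {x : EuclideanSpace ℝ (Fin d)} (hx : x ∈ Metric.closedBall c r) :
    1 / 2 * P.g J c ≤ P.g J x := by
  by_cases hj : ∃ j : Fin d, J = Pi.single j 1
  · obtain ⟨j, rfl⟩ := hj
    linarith [h.half j x hx]
  · push Not at hj
    rw [h.const J hJ hj x hx]
    linarith [h.g_pos J hJ]

theorem Elementary.generate {r : ℝ} (h : P.Elementary c r) (j : Fin d) :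
    ∃ l : List (Fin d → ℤ), (∀ J ∈ l, J ∈ P.jumps) ∧ Pi.single j 1 = l.sum :=
  ⟨[Pi.single j 1], fun J hJ => by rw [List.mem_singleton.1 hJ]; exact (h.unit_mem j).1,
    List.sum_singleton.symm⟩

/-- The rates are affine on the ball, so the second order constant is 0 and the smallness condition
holds trivially. -/
theorem Elementary.latticeModel (hd : 1 ≤ d) {r δ : ℝ} (h : P.Elementary c r) (hδ : 0 < δ)
    (hδr : δ * √(lamMax (P.Sig c)) ≤ r) :
    LatticeModel (P.Sig c)⁻¹ c.ofLp δ P.jumps (fun J => P.g J c)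
      (fun J j => fderiv ℝ (P.g J) c (EuclideanSpace.single j 1)) P.latticeRate := by
  have hs := sigma2_posDef h.g_pos h.generate
  have hSig := (Sig_spec h.stable hs).1
  have hα : 0 < P.alpha1 c := half_pos (lamMin_pos hd (standardized_posDef hSig hs))
  refine JumpProcess.latticeModel (L := 0) hd h.equilibrium h.stable h.g_pos h.generate
    (fun J hJ => ?_) (fun J hJ x hx => ?_)
    ⟨1 / 2, by norm_num, fun J hJ x hx => h.half_le hJ hx⟩ le_rfl hδ hδr ?_
  · obtain ⟨a, ha, -⟩ := h.exists_hasFDerivAt hJ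
    exact ha.differentiableAt
  · obtain ⟨a, ha, ha'⟩ := h.exists_hasFDerivAt hJ
    rw [ha.fderiv, ha' x hx, sub_self, abs_zero, zero_mul, zero_mul]
  · rw [mul_zero, zero_mul, zero_mul]
    positivity

theorem mem_states_iff (hSig : (P.Sig c).PosDef) {n : ℕ} {δ : ℝ} (hδ : 0 ≤ δ) (X : Fin d → ℤ) :
    X ∈ P.states c n δ ↔ qform (P.Sig c)⁻¹ (devVec c.ofLp n X) ≤ (n * δ) ^ 2 := by
  rw [states, mem_latticeBall hSig, qform_le_sq_iff _ (by positivity)]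
  rfl

/-- Rounding `nc` down gives a lattice point at Euclidean distance at most `√d` from `nc`,
independently of `n`. -/
theorem eventually_states_nonempty (hd : 1 ≤ d) (hSig : (P.Sig c).PosDef) {δ : ℝ} (hδ : 0 < δ) :
    ∀ᶠ n : ℕ in atTop, (P.states c n δ).Nonempty := by
  have hlm := lamMin_pos hd hSig
  filter_upwards [eventually_ge_atTop ⌈√(d / lamMin (P.Sig c)) / δ⌉₊] with n hn
  have hn' : √(d / lamMin (P.Sig c)) ≤ n * δ := by
    rw [← div_le_iff₀ hδ]
    exact (Nat.le_ceil _).trans (Nat.cast_le.2 hn)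
  refine ⟨fun i => ⌊n * c i⌋, (mem_states_iff hSig hδ.le _).2 ?_⟩
  set Y := devVec c.ofLp n fun i => ⌊n * c i⌋ with hY
  have h1 : Y ⬝ᵥ Y ≤ d := by
    calc Y ⬝ᵥ Y ≤ ∑ _i : Fin d, (1 : ℝ) := by
          refine Finset.sum_le_sum fun i _ => ?_
          rw [← abs_le_one_iff_mul_self_le_one, hY, devVec, abs_le]
          constructor <;> linarith [Int.floor_le (n * c i), Int.lt_floor_add_one (n * c i)]
      _ = d := by simp
  have h2 : qform (P.Sig c)⁻¹ Y ≤ d / lamMin (P.Sig c) := by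
    rw [le_div_iff₀ hlm, mul_comm]
    exact (lamMin_mul_le_dotProduct hSig Y).trans h1
  refine h2.trans ?_
  rw [← Real.sq_sqrt (show 0 ≤ d / lamMin (P.Sig c) by positivity)]
  gcongr

end JumpProcess

/-- The logarithm is pure slack: it is at least 1 from `n = 3` on. -/
theorem div_sqrt_isBigO (C : ℝ) : (fun n : ℕ => C / √n) =O[atTop]
    fun n : ℕ => (n : ℝ) ^ (-(1 / 2) : ℝ) * Real.log n := by
  refine Asymptotics.IsBigO.of_bound |C| ?_
  filter_upwards [eventually_ge_atTop 3] with n hn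
  have hn' : (3 : ℝ) ≤ n := by exact_mod_cast hn
  have hlog : 1 ≤ Real.log n := by
    rw [Real.le_log_iff_exp_le (by linarith)]
    linarith [Real.exp_one_lt_d9]
  rw [Real.rpow_neg (by linarith), ← Real.sqrt_eq_rpow, norm_div, norm_mul, Real.norm_eq_abs,
    Real.norm_eq_abs, norm_inv, Real.norm_eq_abs, Real.norm_eq_abs, abs_of_nonneg (Real.sqrt_nonneg _),
    abs_of_nonneg (show 0 ≤ Real.log n by linarith), div_eq_mul_inv]
  gcongr
  exact le_mul_of_one_le_right (by positivity) hlog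

end

theorem mainTheorem2 {d : ℕ} (hd : 1 ≤ d) (X : JumpProcess d) (c : EuclideanSpace ℝ (Fin d))
    (δ₀ : ℝ) (hX : X.Regular c δ₀) :
    ∃ Xh : JumpProcess d,
      Xh.Elementary c (lamMin (X.sigma2 c) / (8 * spectralNorm₂ (X.A c))) ∧
      Xh.A c = X.A c ∧ Xh.sigma2 c = X.sigma2 c ∧
      ∀ δ : ℝ, 0 < δ → δ < δ₀ / √(lamMax (X.Sig c)) →
        δ < min 1 (lamMin (X.sigma2 c) / (8 * spectralNorm₂ (X.A c)) /
          (3 * √(lamMax (X.Sig c)))) →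
        4 * X.Lam c * X.L2 c δ₀ * lamMax (X.Sig c) * δ ≤
          X.alpha1 c * √(lamMin (X.Sig c)) →
        (∀ᶠ n : ℕ in atTop,
          (∃! p : PMF (Fin d → ℤ), X.IsEquilibrium c n δ p) ∧
          (∃! p : PMF (Fin d → ℤ), Xh.IsEquilibrium c n δ p)) ∧
        (fun n : ℕ => dTV (X.equilibriumDist c n δ) (Xh.equilibriumDist c n δ)) =O[atTop]
          (fun n : ℕ => (n : ℝ) ^ (-(1 / 2) : ℝ) * Real.log n) := by
  have hs := JumpProcess.sigma2_posDef (fun J hJ => hX.g_pos hJ) hX.generate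
  obtain ⟨Xh, hXh, hA, hσ⟩ := exists_elementary hd hX.stable hs c
  refine ⟨Xh, hXh, hA, hσ, fun δ hδ hδ₀ hδ₁ hcond => ?_⟩
  have hSig := (JumpProcess.Sig_spec hX.stable hs).1
  -- `Σ` is a function of `A` and `σ²`, so both processes have the same state space and the same
  -- Gaussian weight.
  have hSigh : Xh.Sig c = X.Sig c := by rw [JumpProcess.Sig, hA, hσ, JumpProcess.Sig]
  have hstates : ∀ n, Xh.states c n δ = X.states c n δ := fun n => by
    rw [JumpProcess.states, hSigh, JumpProcess.states]
  have hlM : 0 < √(lamMax (X.Sig c)) := Real.sqrt_pos.2 (lamMax_pos hd hSig)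
  have M := hX.latticeModel hd hδ ((lt_div_iff₀ hlM).1 hδ₀).le hcond
  -- Only `δ √λ_max(Σ)` being at most the radius is needed; the factor 3 in the bound on `δ` is to
  -- spare.
  have Mh := hXh.latticeModel hd hδ (by
    rw [hSigh]
    have h1 := (lt_div_iff₀ (by positivity)).1 (hδ₁.trans_le (min_le_right _ _))
    have h2 := mul_pos hδ hlM
    linarith)
  rw [hSigh] at Mh
  -- Each model compared with itself gives uniqueness; the two compared with each other give the
  -- distance.
  obtain ⟨C₁, -, h₁⟩ := M.exists_sum_abs_sub_le M
  obtain ⟨C₂, -, h₂⟩ := Mh.exists_sum_abs_sub_le Mh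
  obtain ⟨C₃, -, h₃⟩ := M.exists_sum_abs_sub_le Mh
  have hsmall : ∀ C : ℝ, ∀ᶠ n : ℕ in atTop, C / √n < 2 := fun C =>
    (Tendsto.const_div_atTop (Real.tendsto_sqrt_atTop.comp tendsto_natCast_atTop_atTop)
      C).eventually_lt_const two_pos
  have hmem : ∀ n X', X' ∈ X.states c n δ ↔
      qform (X.Sig c)⁻¹ (devVec c.ofLp n X') ≤ (n * δ) ^ 2 := fun n X' =>
    JumpProcess.mem_states_iff hSig hδ.le X'
  have hunique : ∀ᶠ n : ℕ in atTop,
      (∃! p : PMF (Fin d → ℤ), X.IsEquilibrium c n δ p) ∧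
      (∃! p : PMF (Fin d → ℤ), Xh.IsEquilibrium c n δ p) := by
    filter_upwards [h₁, h₂, hsmall C₁, hsmall C₂, eventually_ge_atTop 1,
      JumpProcess.eventually_states_nonempty hd hSig hδ] with n h₁ h₂ hC₁ hC₂ hn hne
    refine ⟨X.existsUnique_isEquilibrium c hn hne fun π π' hπ hπ' =>
      (h₁ _ (hmem n) π π' hπ hπ').trans_lt hC₁,
      Xh.existsUnique_isEquilibrium c hn (by rwa [hstates]) fun π π' hπ hπ' => ?_⟩
    rw [hstates] at hπ hπ' ⊢
    exact (h₂ _ (hmem n) π π' hπ hπ').trans_lt hC₂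
  refine ⟨hunique, Asymptotics.IsBigO.trans (Asymptotics.IsBigO.of_bound 1 ?_)
    (div_sqrt_isBigO C₃)⟩
  filter_upwards [hunique, h₃, eventually_ge_atTop 1] with n hu h₃ hn
  have hp := JumpProcess.IsEquilibrium.equilibriumDist hu.1.exists
  have hq := JumpProcess.IsEquilibrium.equilibriumDist hu.2.exists
  have hq' := hq.isStationaryLaw hn
  rw [hstates] at hq'
  have hle := (dTV_le_sum_abs_sub hp.1 (by rw [← hstates]; exact hq.1)).trans
    (h₃ _ (hmem n) _ _ (hp.isStationaryLaw hn) hq')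
  rw [one_mul, Real.norm_eq_abs, abs_of_nonneg (dTV_nonneg _ _)]
  exact hle.trans (le_abs_self _)
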